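/- Let $K$ be a global function field with finite constant field $\mathbb F_q$ (algebraically closed in $K$), let $\infty$ be a place of $K$, and let $A\subset K$ be the ring of functions regular outside $\infty$; the other places $v$ of $K$ are called finite, $K_v$ is the completion of $K$ at $v$ and $O_v$ its valuation ring. Let $D$ be a finite-dimensional central simple $K$-algebra which is definite, i.e. $D\otimes_K K_\infty$ is a division algebra. Let $R$ be a hereditary $A$-order in $D$, i.e. an $A$-order all of whose right (equivalently, left) ideals are projective $R$-modules. For a finite place $v$ write $D_v=D\otimes_K K_v\cong\mathrm{Mat}_{m_v}(\Delta_v)$ with $\Delta_v$ a division algebra, $O_{\Delta_v}$ for the maximal order of $\Delta_v$ and $\mathfrak P_v$ for its maximal ideal, and $L_v=L\otimes_A O_v$ for an $A$-lattice $L$ in $D$. For a vector $f=(f_1,\dots,f_r)$ of positive integers with sum $m_v$ let $\mathrm{Mat}(f,O_{\Delta_v})$ be the ring of all $(X_{ij})_{1\le i,j\le r}$ with $X_{ij}\in \mathrm{Mat}_{f_i\times f_j}(O_{\Delta_v})$ if $i\le j$ and $X_{ij}\in \mathrm{Mat}_{f_i\times f_j}(\mathfrak P_v)$ if $i>j$.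 An order $R'$ in $D$ has invariant $f$ at $v$ if some isomorphism $D_v\cong\mathrm{Mat}_{m_v}(\Delta_v)$ carries $R'_v$ onto $\mathrm{Mat}(f,O_{\Delta_v})$. A right ideal of an order $R'$ in $D$ is a full $A$-lattice $I$ in $D$ with $IR'\subseteq I$; it is locally free if for each finite $v$ there is $\alpha_v\in D_v^\times$ with $I_v=\alpha_vR'_v$. Two right ideals $I,J$ of $R'$ are in the same genus if for each finite $v$ there is $\alpha_v\in D_v^\times$ with $J_v=\alpha_vI_v$; they are in the same class if $J=\alpha I$ for some $\alpha\in D^\times$. The class number $h(\mathcal L)$ of a genus $\mathcal L$ is the number of classes in $\mathcal L$, and $h(R')$ is the number of classes of locally free right ideals of $R'$. Then at every finite place $v$ the order $R$ has an invariant $f_v=(f_{v,1},\dots,f_{v,r_v})$, and the number of right ideal classes of $R$ is finite. Fix for each $v$ such a vector $f_v$ and an isomorphism of $D_v$ with $\mathrm{Mat}_{m_v}(\Delta_v)$ carrying $R_v$ onto $\mathrm{Mat}(f_v,O_{\Delta_v})$. Let $M_{v,1}=O_{\Delta_v}^{m_v}$ (row vectors, a right $R_v$-module) and $M_{v,i}=M_{v,i-1}\cdot\mathrm{rad}(R_v)$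 for $1<i\le r_v$, where $\mathrm{rad}$ is the Jacobson radical. Let $\mathcal G$ be the set of all families $\mathbf g=(g_v)_{v\ne\infty}$ with $g_v=(g_{v,1},\dots,g_{v,r_v})\in\mathbb Z_{\ge0}^{r_v}$ and $\sum_i g_{v,i}=m_v$. Say that a right ideal $I$ of $R$ is of type $\mathbf g$ if $I_v\cong M_{v,1}^{g_{v,1}}\oplus\cdots\oplus M_{v,r_v}^{g_{v,r_v}}$ as right $R_v$-modules for all finite $v$. Then: (1) The set $\mathcal G$ is finite, and it parametrizes the genera of right ideals of $R$: there is a bijection $\mathbf g\mapsto\mathcal L(\mathbf g)$ from $\mathcal G$ onto the set of genera such that a right ideal of $R$ lies in $\mathcal L(\mathbf g)$ if and only if it is of type $\mathbf g$. (2) If $I(\mathbf g)$ is any right ideal of type $\mathbf g$ and $R_{I(\mathbf g)}=\{x\in D: xI(\mathbf g)\subseteq I(\mathbf g)\}$ is its left order, then $R_{I(\mathbf g)}$ is a hereditary $A$-order in $D$ whose invariant at each finite place $v$ is $g_v^{o}$, the vector obtained from $g_v$ by removing its zero entries; moreover $h(R_{I(\mathbf g)})$ is finite and $h(\mathcal L(\mathbf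 g))=h(R_{I(\mathbf g)})$. (3) For any choice of a right ideal $I(\mathbf g)$ of type $\mathbf g$ for each $\mathbf g\in\mathcal G$, the total number of right ideal classes of $R$ equals $\sum_{\mathbf g\in\mathcal G}h(R_{I(\mathbf g)})$. -/

import Mathlib

open scoped TensorProduct

namespace GlobalOrders

noncomputable section

universe u w

/-- `K` is a global function field whose full constant field is the finite field `Fq`. -/
structure IsGlobalFunctionField (Fq : Type*) (K : Type*) [Field Fq] [Field K] [Algebra Fq K] :
    Prop where
  finite_const : Finite Fq
  /-- `K` is a finite extension of a rational function field `Fq(X)` (over `Fq`). -/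
  functionField : ∃ (_ : Algebra (RatFunc Fq) K) (_ : IsScalarTower Fq (RatFunc Fq) K),
    FunctionField Fq K
  /-- `Fq` is algebraically closed in `K`. -/
  const_closed : ∀ x : K, IsAlgebraic Fq x → x ∈ Set.range (algebraMap Fq K)

section Places

variable {K : Type u} [Field K]

/-- A place of `K`, given by its valuation ring, a proper valuation subring of `K`.
(The nonzero elements of a finite constant field are roots of unity, so that every valuation
ring of a global function field contains the constants.) -/
abbrev Place (K : Type u) [Field K] : Type u := {v : ValuationSubring K // v ≠ ⊤}

/-- The finite places: those different from the fixed place `infty`. -/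
abbrev FinitePlace (infty : Place K) : Type u := {v : Place K // v ≠ infty}

/-- The ring `A` of elements of `K` that are regular outside `infty`. -/
def regularRing (infty : Place K) : Subring K :=
  ⨅ v : FinitePlace infty, v.1.1.toSubring

/-- The completion `K_v` of `K` at the place `v`. -/
abbrev Compl (v : Place K) : Type u := v.1.valuation.Completion

instance (v : Place K) : UniformContinuousConstSMul K (WithVal v.1.valuation) where
  uniformContinuous_const_smul c := by
    have h : (fun x : WithVal v.1.valuation => c • x) =
        fun x => WithVal.toVal v.1.valuation c * x := by
      funext x
      exact WithVal.ofVal_injective _ (by simp)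
    rw [h]
    exact uniformContinuous_const_smul (WithVal.toVal v.1.valuation c)

/-- The embedding of `K` into `K_v` is the canonical one. -/
theorem algebraMap_compl (v : Place K) (x : K) :
    algebraMap K (Compl v) x = ((WithVal.toVal v.1.valuation x : WithVal v.1.valuation) : Compl v) :=
  rfl

/-- The valuation ring `O_v` of `K_v`. -/
abbrev complInt (v : Place K) : Subring (Compl v) :=
  (Valued.v (R := Compl v) : Valuation (Compl v) v.1.ValueGroup).integer

end Places

section Algebra

variable {K : Type u} [Field K] (D : Type w) [Ring D] [Algebra K D]

/-- The completion `D_v = K_v ⊗_K D`. -/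
abbrev AlgCompl (v : Place K) : Type (max u w) := Compl v ⊗[K] D

/-- The central simple algebra `D` is definite with respect to `infty`: the completion
`D_infty` is a division algebra. -/
def IsDefinite (infty : Place K) : Prop :=
  ∀ x : AlgCompl D infty, x ≠ 0 → IsUnit x

variable {D}

/-- The completion `I_v` of an `A`-submodule `I` of `D` as a submodule of `D_v`:
the `O_v`-submodule of `D_v` generated by `I`. -/
def completeModule {infty : Place K} (I : Submodule (regularRing infty) D)
    (v : FinitePlace infty) : Submodule (complInt v.1) (AlgCompl D v.1) :=
  Submodule.span _ ((fun x : D => (1 : Compl v.1) ⊗ₜ[K] x) '' (I : Set D))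

/-- The completion `R_v` of an `A`-subalgebra `R` of `D` as an `O_v`-subalgebra of `D_v`. -/
def completeOrder {infty : Place K} (R : Subalgebra (regularRing infty) D)
    (v : FinitePlace infty) : Subalgebra (complInt v.1) (AlgCompl D v.1) :=
  Algebra.adjoin _ ((fun x : D => (1 : Compl v.1) ⊗ₜ[K] x) '' (R : Set D))

/-- The two ways to complete an order agree. -/
theorem completeOrder_toSubmodule {infty : Place K} (R : Subalgebra (regularRing infty) D)
    (v : FinitePlace infty) :
    Subalgebra.toSubmodule (completeOrder R v) =
      completeModule (Subalgebra.toSubmodule R) v := by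
  have h : ((R.toSubmonoid.map
      (Algebra.TensorProduct.includeRight : D →ₐ[K] Compl v.1 ⊗[K] D).toMonoidHom :
        Submonoid (AlgCompl D v.1)) : Set (AlgCompl D v.1)) =
      (fun x : D => (1 : Compl v.1) ⊗ₜ[K] x) '' (R : Set D) := rfl
  rw [completeOrder, completeModule, Algebra.adjoin_eq_span, ← h, Submonoid.closure_eq]
  rfl

/-- `R` is an `A`-order in `D`: a subring containing `A`, finitely generated as an `A`-module,
which spans `D` over `K`. -/
structure IsOrder {infty : Place K} (R : Subalgebra (regularRing infty) D) : Prop where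
  fg : (Subalgebra.toSubmodule R).FG
  span_eq_top : Submodule.span K (R : Set D) = ⊤

/-- An order is hereditary if all its right ideals are projective (right) modules.  (For orders
this is equivalent to the same condition on left ideals.) -/
def IsHereditary {infty : Place K} (R : Subalgebra (regularRing infty) D) : Prop :=
  ∀ I : Submodule (↥R)ᵐᵒᵖ ↥R, Module.Projective (↥R)ᵐᵒᵖ ↥I

/-- A right ideal of `R`: a (full) `A`-lattice in `D` which is a right `R`-submodule of `D`. -/
structure RightIdeal {infty : Place K} (R : Subalgebra (regularRing infty) D) where
  carrier : Submodule (regularRing infty) D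
  fg : carrier.FG
  span_eq_top : Submodule.span K (carrier : Set D) = ⊤
  mul_mem : ∀ x ∈ carrier, ∀ r ∈ R, x * r ∈ carrier

/-- The left order `{x ∈ D | x I ⊆ I}` of a right ideal. -/
def leftOrder {infty : Place K} {R : Subalgebra (regularRing infty) D} (I : RightIdeal R) :
    Subalgebra (regularRing infty) D where
  carrier := {x | ∀ y ∈ I.carrier, x * y ∈ I.carrier}
  mul_mem' {a b} ha hb y hy := by rw [mul_assoc]; exact ha _ (hb y hy)
  add_mem' {a b} ha hb y hy := by rw [add_mul]; exact I.carrier.add_mem (ha y hy) (hb y hy)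
  algebraMap_mem' c y hy := by rw [← Algebra.smul_def]; exact I.carrier.smul_mem c hy

/-- `J = a I` inside a ring `B`. -/
def IsLeftMul {S B : Type*} [CommRing S] [Ring B] [Algebra S B] (a : Bˣ) (I J : Submodule S B) :
    Prop :=
  J = I.map (LinearMap.mulLeft S (a : B))

theorem IsLeftMul.refl {S B : Type*} [CommRing S] [Ring B] [Algebra S B] (I : Submodule S B) :
    IsLeftMul 1 I I := by
  simp [IsLeftMul, LinearMap.mulLeft_one]

theorem IsLeftMul.trans {S B : Type*} [CommRing S] [Ring B] [Algebra S B] {a b : Bˣ}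
    {I J L : Submodule S B} (h : IsLeftMul a I J) (h' : IsLeftMul b J L) :
    IsLeftMul (b * a) I L := by
  simp only [IsLeftMul] at *
  rw [h', h, ← Submodule.map_comp, ← LinearMap.mulLeft_mul]
  rfl

theorem IsLeftMul.symm {S B : Type*} [CommRing S] [Ring B] [Algebra S B] {a : Bˣ}
    {I J : Submodule S B} (h : IsLeftMul a I J) : IsLeftMul a⁻¹ J I := by
  simp only [IsLeftMul] at *
  rw [h, ← Submodule.map_comp, ← LinearMap.mulLeft_mul]
  simp [LinearMap.mulLeft_one]

variable {infty : Place K}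

/-- Global equivalence of right ideals: `J = α I` for some `α ∈ D^×`. -/
def globalSetoid (R : Subalgebra (regularRing infty) D) : Setoid (RightIdeal R) where
  r I J := ∃ a : Dˣ, IsLeftMul a I.carrier J.carrier
  iseqv :=
    { refl := fun _ => ⟨1, IsLeftMul.refl _⟩
      symm := fun ⟨a, h⟩ => ⟨a⁻¹, h.symm⟩
      trans := fun ⟨a, h⟩ ⟨b, h'⟩ => ⟨b * a, h.trans h'⟩ }

/-- Local equivalence everywhere: for each finite place `v` there is `α_v ∈ D_v^×` with
`J_v = α_v I_v`. -/
def genusSetoid (R : Subalgebra (regularRing infty) D) : Setoid (RightIdeal R) where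
  r I J := ∀ v : FinitePlace infty, ∃ a : (AlgCompl D v.1)ˣ,
    IsLeftMul a (completeModule I.carrier v) (completeModule J.carrier v)
  iseqv :=
    { refl := fun _ _ => ⟨1, IsLeftMul.refl _⟩
      symm := fun h v => let ⟨a, h⟩ := h v; ⟨a⁻¹, h.symm⟩
      trans := fun h h' v => let ⟨a, h⟩ := h v; let ⟨b, h'⟩ := h' v; ⟨b * a, h.trans h'⟩ }

/-- The set of genera of right ideals of `R`. -/
abbrev Genus (R : Subalgebra (regularRing infty) D) : Type w := Quotient (genusSetoid R)

/-- The genus `L(I)` of a right ideal `I`. -/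
def genusOf {R : Subalgebra (regularRing infty) D} (I : RightIdeal R) : Genus R :=
  Quotient.mk (genusSetoid R) I

/-- The set of all right ideal classes of `R`. -/
abbrev RightIdealClass (R : Subalgebra (regularRing infty) D) : Type w :=
  Quotient (globalSetoid R)

/-- The set `L/∼` of global equivalence classes of the ideals in the genus `L`. -/
abbrev GenusClass {R : Subalgebra (regularRing infty) D} (L : Genus R) : Type w :=
  Quotient ((globalSetoid R).comap (Subtype.val : {I : RightIdeal R // genusOf I = L} → _))

/-- `I` is locally free: for each finite place `v` there is `α_v ∈ D_v^×` with
`I_v = α_v R_v`. -/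
def IsLocallyFree {R : Subalgebra (regularRing infty) D} (I : RightIdeal R) : Prop :=
  ∀ v : FinitePlace infty, ∃ a : (AlgCompl D v.1)ˣ,
    IsLeftMul a (Subalgebra.toSubmodule (completeOrder R v)) (completeModule I.carrier v)

/-- The set `Cl(R)` of global equivalence classes of locally free right ideals of `R`. -/
abbrev LocallyFreeClass (R : Subalgebra (regularRing infty) D) : Type w :=
  Quotient ((globalSetoid R).comap (Subtype.val : {I : RightIdeal R // IsLocallyFree I} → _))

/-- The class number `h(R)`. -/
def classNumber (R : Subalgebra (regularRing infty) D) : ℕ := Nat.card (LocallyFreeClass R)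

end Algebra

section Local

/-- The maximal order `O_Δ` of a division algebra `Δ` over a complete discretely valued field
with valuation ring `O`: the elements of `Δ` that are integral over `O`. -/
def maxOrder (O Δ : Type*) [CommRing O] [DivisionRing Δ] [Algebra O Δ] : Set Δ :=
  {x | IsIntegral O x}

/-- The maximal ideal of `O_Δ`: its non-units. -/
def maxIdeal (O Δ : Type*) [CommRing O] [DivisionRing Δ] [Algebra O Δ] : Set Δ :=
  {x | IsIntegral O x ∧ (x = 0 ∨ ¬ IsIntegral O x⁻¹)}

/-- Row and column indices of block matrices with block sizes `f = (f_1, …, f_r)`: a block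
number and a position in that block.  This set has `f_1 + ⋯ + f_r` elements. -/
abbrev BlockIndex (f : List ℕ) : Type := Σ i : Fin f.length, Fin (f.get i)

/-- `Mat(f, O_Δ)`: the block matrices over `O_Δ` whose blocks below the diagonal have their
entries in the maximal ideal. -/
def standardOrder (O Δ : Type*) [CommRing O] [DivisionRing Δ] [Algebra O Δ] (f : List ℕ) :
    Set (Matrix (BlockIndex f) (BlockIndex f) Δ) :=
  {X | ∀ a b, (a.1 ≤ b.1 → X a b ∈ maxOrder O Δ) ∧ (b.1 < a.1 → X a b ∈ maxIdeal O Δ)}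

variable {K : Type u} [Field K] {D : Type w} [Ring D] [Algebra K D] {infty : Place K}

/-- The division algebra `Δ` is the division part of `D_v`, and the order `R` has invariant `f`
at `v`: the entries of `f` are positive, and there is an isomorphism of `D_v` with the algebra of
matrices of size `f_1 + ⋯ + f_r` over `Δ` that carries `R_v` onto `Mat(f, O_Δ)`. -/
def HasInvariant (R : Subalgebra (regularRing infty) D) (v : FinitePlace infty)
    (Δ : Type (max u w)) [DivisionRing Δ] [Algebra (Compl v.1) Δ] (f : List ℕ) : Prop :=
  (∀ k ∈ f, 0 < k) ∧
    ∃ φ : AlgCompl D v.1 ≃ₐ[Compl v.1] Matrix (BlockIndex f) (BlockIndex f) Δ,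
      φ '' (completeOrder R v : Set (AlgCompl D v.1)) = standardOrder (complInt v.1) Δ f

/-- A description of the local order `R_v`: the division part `Δ_v` of `D_v`, the invariant
`f_v` of `R_v`, and an isomorphism of `D_v` with a matrix algebra over `Δ_v` that carries `R_v`
onto `Mat(f_v, O_Δ)`. -/
structure LocalDescription (R : Subalgebra (regularRing infty) D) (v : FinitePlace infty) where
  Δ : Type (max u w)
  [divisionRing : DivisionRing Δ]
  [algebra : Algebra (Compl v.1) Δ]
  f : List ℕ
  f_pos : ∀ k ∈ f, 0 < k
  φ : AlgCompl D v.1 ≃ₐ[Compl v.1] Matrix (BlockIndex f) (BlockIndex f) Δ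
  image_φ : φ '' (completeOrder R v : Set (AlgCompl D v.1)) = standardOrder (complInt v.1) Δ f

attribute [instance] LocalDescription.divisionRing LocalDescription.algebra

namespace LocalDescription

variable {R : Subalgebra (regularRing infty) D} {v : FinitePlace infty}

/-- The period `r_v` of `R_v`. -/
abbrev period (S : LocalDescription R v) : ℕ := S.f.length

/-- The local capacity `m_v`, i.e. the size of the matrix algebra over `Δ_v`. -/
abbrev capacity (S : LocalDescription R v) : ℕ := S.f.sum

/-- The indecomposable right `R_v`-modules `M_1, …, M_r` (here with indices `0, …, r - 1`),
in the space of row vectors over `Δ_v`, on which `R_v` acts from the right through `φ`: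
`M_1` consists of all row vectors over `O_Δ`, and `M_{i+1} = M_i · rad(R_v)` with the Jacobson
radical of `R_v`. -/
def indec (S : LocalDescription R v) : ℕ → AddSubgroup (BlockIndex S.f → S.Δ)
  | 0 => AddSubgroup.closure {y | ∀ a, y a ∈ maxOrder (complInt v.1) S.Δ}
  | i + 1 => AddSubgroup.closure {z | ∃ y ∈ indec S i, ∃ ρ ∈ Ring.jacobson ↥(completeOrder R v),
      z = Matrix.vecMul y (S.φ (ρ : AlgCompl D v.1))}

/-- The index set of the local isomorphism types at `v`: the vectors of `r_v` non-negative
integers with sum `m_v`. -/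
abbrev TypeIndex (S : LocalDescription R v) : Type :=
  {g : Fin S.period → ℕ // ∑ i, g i = S.capacity}

/-- `g^o`: the vector `g` with its zero entries removed. -/
def removeZeros (S : LocalDescription R v) (g : S.TypeIndex) : List ℕ :=
  (List.ofFn g.1).filter (fun k => k ≠ 0)

/-- The completion at `v` of the right ideal `I` is isomorphic, as a right `R_v`-module, to
`M_1^{g_1} ⊕ ⋯ ⊕ M_r^{g_r}`. -/
def HasLocalType (S : LocalDescription R v) (I : RightIdeal R) (g : S.TypeIndex) : Prop :=
  ∃ e : completeModule I.carrier v ≃+ ((a : Σ i : Fin S.period, Fin (g.1 i)) → S.indec a.1),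
    ∀ x y : completeModule I.carrier v, ∀ ρ : AlgCompl D v.1, ρ ∈ completeOrder R v →
      (y : AlgCompl D v.1) = x * ρ →
        ∀ a, (e y a : BlockIndex S.f → S.Δ) = Matrix.vecMul (e x a : _ → S.Δ) (S.φ ρ)

end LocalDescription

/-- The index set of the genera: the families `g = (g_v)_v`, over the finite places `v`, of
vectors of `r_v` non-negative integers with sum `m_v`. -/
abbrev GenusIndex {R : Subalgebra (regularRing infty) D}
    (S : ∀ v : FinitePlace infty, LocalDescription R v) : Type u :=
  ∀ v : FinitePlace infty, (S v).TypeIndex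

/-- The right ideal `I` has local isomorphism type `g_v` at all finite places `v`, i.e. `I` is an
ideal `I(g)`. -/
def HasType {R : Subalgebra (regularRing infty) D}
    (S : ∀ v : FinitePlace infty, LocalDescription R v) (I : RightIdeal R) (g : GenusIndex S) :
    Prop :=
  ∀ v, (S v).HasLocalType I (g v)

end Local

end

end GlobalOrders

/-!
# Genera and class numbers of right ideals of hereditary orders over function fields

The argument reduces everything to elementary statements about lattices, by expressing that an order
is hereditary through dual bases: `HasDualBases Λ` says that `1 ∈ J (Λ : J)` for every full right
lattice `J`. Over the ring `A` of functions regular outside `∞` this is equivalent to being hereditary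
(`IsHereditary.hasDualBases`; `HasDualBases.isHereditary` for the converse in a division algebra). It
passes to the left orders of right ideals (`HasDualBases.leftOrder`) and, because every local lattice
is the completion of a global one (`exists_completeModule_eq`), to the completions of the order
(`HasDualBases.completeOrder`).

*The arithmetic of `A`.* A dimension count produces a function `t` whose only pole is `∞`
(`exists_pole_only_at`). Hence `A` is the integral closure of `k[t]` in `K`: a Dedekind domain with
finite quotients, finite over `k[t]` (`exists_polynomial_finite`). So an order in the definite algebra
`D`, which is a division algebra, is a finite free `k[t]`-module without zero divisors. Dividing by an
element of minimal norm shows that its nonzero right ideals are principal up to a bounded scalar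
(`exists_forall_smul_eq_mul`), and the number of right ideal classes is finite
(`finite_rightIdealClass`).

*Local structure.* `D_v` is simple, as the coordinates of an element are recovered from it by
two-sided multiplications (`exists_sum_mul_mul_eq`, `isSimpleRing_tensorProduct`); so it is a matrix
algebra over a division algebra `Δ`, to which the valuation extends by Hensel's lemma. A dual basis
splits every right lattice into lattices of row vectors (`exists_unit_forall_mem_iff`), and the row
lattices form a chain (`IsLocalFieldBase.isRowLattice_le_or_le`). Comparing the rows of the order
itself shows that each of its entries runs through the maximal order of `Δ` or its maximal ideal, which
is the standard form (`IsLocalFieldBase.exists_image_eq_standardOrder`). Over an order in standard form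
each row lattice is, up to scaling, one of the modules `M_{v,i}`
(`IsLocalFieldBase.exists_smul_stdRow`, `LocalDescription.coe_indec`), so every right ideal has a local
type. The type is unique, as the multiplicities are exponents of indices that do not depend on the
decomposition (`LocalDescription.HasLocalType.unique`). Two right ideals of the same type differ
locally by a unit, and the left order of a sum of modules `M_{v,i}` is again standard, one block for
each `i` that occurs (`LocalDescription.HasRowType.exists_image_eq_standardOrder`).

*Genera and classes.* The two-sided multiplications above are integral at almost all places, and there
the completion of the order is a maximal order, with only one type (`finite_setOf_one_lt_period`).
Therefore any family of types is realized by modifying the order at finitely many places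
(`exists_hasType`), and the genera correspond to the types (`exists_genusIndex_equiv`). For a right
ideal `I` with left order `R'`, the maps `X ↦ X I` and `J ↦ (J : I)` are inverse bijections between
the locally free right ideals of `R'` and the genus of `I`, compatible with left multiplication
(`genusClassEquiv`). The classes of right ideals are the disjoint union of the classes in the genera,
and summation gives the class number formula (`card_rightIdealClass_eq_finsum`).
-/

namespace GlobalOrders

noncomputable section

universe u w

/-! ### Finiteness over polynomial rings -/

open IntermediateField Algebra in
/-- `K` is finite over `k(x)` for every transcendental `x`, since it has transcendence degree one and
is finitely generated. -/
theorem finiteDimensional_adjoin_of_transcendental {Fq K : Type*} [Field Fq] [Field K]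
    [Algebra Fq K] (hK : IsGlobalFunctionField Fq K) {x : K} (hx : Transcendental Fq x) :
    FiniteDimensional Fq⟮x⟯ K := by
  obtain ⟨_, _, hfin⟩ := hK.functionField
  have : Algebra.IsAlgebraic (Polynomial Fq) (RatFunc Fq) :=
    IsLocalization.isAlgebraic _ (nonZeroDivisors (Polynomial Fq))
  have h1 : Algebra.trdeg Fq (RatFunc Fq) = 1 := by
    rw [← trdeg_add_eq Fq (Polynomial Fq) (A := RatFunc Fq), Polynomial.trdeg_of_isDomain,
      trdeg_eq_zero, add_zero]
  have h2 := lift_trdeg_add_eq Fq (RatFunc Fq) K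
  rw [h1, trdeg_eq_zero] at h2
  have h3 : Algebra.trdeg Fq K = 1 := by
    simpa using h2.symm
  have hind : AlgebraicIndependent Fq ![x] := by
    simpa [algebraicIndependent_unique_type_iff] using hx
  have hb := hind.isTranscendenceBasis_of_lift_trdeg_le_of_finite (by simp [h3])
  have halg := hb.isAlgebraic_field
  have hr : Set.range ![x] = {x} := by simp
  rw [hr] at halg
  have : Algebra.EssFiniteType Fq (RatFunc Fq) := by
    have := Algebra.EssFiniteType.of_isLocalization (RatFunc Fq) (nonZeroDivisors (Polynomial Fq))
    exact Algebra.EssFiniteType.comp Fq (Polynomial Fq) (RatFunc Fq)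
  have : Algebra.EssFiniteType Fq K := Algebra.EssFiniteType.comp Fq (RatFunc Fq) K
  have : Algebra.EssFiniteType Fq⟮x⟯ K := Algebra.EssFiniteType.of_comp Fq Fq⟮x⟯ K
  obtain ⟨s, hs⟩ := IntermediateField.fg_top (F := Fq⟮x⟯) (E := K)
  have hf := IntermediateField.finiteDimensional_adjoin (K := Fq⟮x⟯) (L := K) (S := (s : Set K))
    (fun y _ => (halg.isAlgebraic y).isIntegral)
  rw [hs] at hf
  exact Module.Finite.equiv (IntermediateField.topEquiv (F := Fq⟮x⟯) (E := K)).toLinearEquiv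

/-- If all `p^n`-th powers of `K` lie in `L`, then `a ↦ a^(p^n)` embeds the integral closure of `P`
in `K` into the integral closure of `P` in `L`. -/
theorem exists_pow_integralClosure (P L K : Type*) [CommRing P] [Field L] [Field K] [Algebra P L]
    [Algebra P K] [Algebra L K] [IsScalarTower P L K] (p n : ℕ) [ExpChar K p]
    (h : ∀ a : K, a ^ p ^ n ∈ (algebraMap L K).range) :
    ∃ g : integralClosure P K →+* integralClosure P L, ∀ a,
      algebraMap L K (g a) = (a : K) ^ p ^ n := by
  choose f hf using h
  have hinj := (algebraMap L K).injective
  have hint : ∀ a : integralClosure P K, IsIntegral P (f a) := fun a => by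
    rw [← isIntegral_algebraMap_iff hinj, hf]
    exact a.2.pow _
  refine ⟨{ toFun := fun a => ⟨f a, hint a⟩, map_one' := ?_, map_zero' := ?_, map_mul' := ?_,
            map_add' := ?_ }, fun a => hf a⟩
  · exact Subtype.ext (hinj (by simp [hf]))
  · intro a b
    exact Subtype.ext (hinj (by simp [hf, mul_pow]))
  · exact Subtype.ext (hinj (by simp [hf, (expChar_pos K p).ne']))
  · intro a b
    exact Subtype.ext (hinj (by simp [hf, add_pow_expChar_pow]))

theorem finite_of_comp_finite {P B C : Type*} [CommRing P] [IsNoetherianRing P] [CommRing B]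
    [CommRing C] (f : P →+* B) (g : B →+* C) (hg : Function.Injective g) (h : (g.comp f).Finite) :
    f.Finite := by
  algebraize [f, g, g.comp f]
  have : Module.Finite P C := h
  exact Module.Finite.of_injective (IsScalarTower.toAlgHom P B C).toLinearMap hg

/-- Finiteness of integral closures without a separability assumption. For some `n` all `p^n`-th
powers of elements of `K` lie in the separable closure of `E` in `K`, so `a ↦ a^(p^n)` embeds the
integral closure of `P` in `K` into a finite `P`-module, on which `P` acts through the `n`-th power of
Frobenius. -/
theorem integralClosure_finite_of_frobenius_finite (P E K : Type*) [CommRing P] [IsDomain P]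
    [IsNoetherianRing P] [IsIntegrallyClosed P] [Field E] [Field K] [Algebra P E]
    [IsFractionRing P E] [Algebra P K] [Algebra E K] [IsScalarTower P E K] [FiniteDimensional E K]
    (p : ℕ) [ExpChar P p] (hfrob : ∀ n, (iterateFrobenius P p n).Finite) :
    Module.Finite P (integralClosure P K) := by
  let L := separableClosure E K
  have : FaithfulSMul P E := (faithfulSMul_iff_algebraMap_injective P E).2
    (IsFractionRing.injective P E)
  have hPK : Function.Injective (algebraMap P K) := by
    rw [IsScalarTower.algebraMap_eq P E K]
    exact (algebraMap E K).injective.comp (IsFractionRing.injective P E)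
  have : ExpChar K p := expChar_of_injective_ringHom hPK p
  have : ExpChar E p := expChar_of_injective_ringHom (IsFractionRing.injective P E) p
  have : ExpChar L p := expChar_of_injective_ringHom (algebraMap E L).injective p
  have : IsScalarTower P L K := .of_algebraMap_eq fun x => rfl
  have hfinL : Module.Finite P (integralClosure P L) :=
    IsIntegralClosure.finite P E L (integralClosure P L)
  obtain ⟨n, hn⟩ := (IsPurelyInseparable.hasExponent_iff L K).1 inferInstance
  rw [ringExpChar.eq L p] at hn
  obtain ⟨g, hg'⟩ := exists_pow_integralClosure P L K p n hn
  have hg : Function.Injective g := by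
    intro a b hab
    have := congrArg (fun z : integralClosure P L => algebraMap L K z) hab
    simp only [hg'] at this
    exact Subtype.ext (iterateFrobenius_inj K p n this)
  refine RingHom.finite_algebraMap.1 (finite_of_comp_finite _ g hg ?_)
  have : g.comp (algebraMap P (integralClosure P K)) =
      (algebraMap P (integralClosure P L)).comp (iterateFrobenius P p n) := by
    refine RingHom.ext fun a => Subtype.ext ((algebraMap L K).injective ?_)
    simp only [RingHom.comp_apply]
    rw [hg', iterateFrobenius_def]
    simp only [Subalgebra.coe_algebraMap, map_pow, SubmonoidClass.coe_pow]
    rfl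
  rw [this]
  exact RingHom.Finite.comp (RingHom.finite_algebraMap.2 hfinL) (hfrob n)

theorem iterateFrobenius_finite_of_finiteType (k P : Type*) [Field k]
    [CommRing P] [Algebra k P] [Algebra.FiniteType k P] (p : ℕ) [ExpChar k p] [PerfectRing k p]
    [ExpChar P p] (n : ℕ) :
    (iterateFrobenius P p n).Finite := by
  apply RingHom.IsIntegral.to_finite
  · intro y
    refine ⟨Polynomial.X ^ p ^ n - Polynomial.C y, Polynomial.monic_X_pow_sub_C y
      (pow_pos (expChar_pos P p) n).ne', by simp [iterateFrobenius_def]⟩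
  · apply RingHom.FiniteType.of_comp_finiteType (f := algebraMap k P)
    have : (iterateFrobenius P p n).comp (algebraMap k P) =
      (algebraMap k P).comp (iterateFrobenius k p n) := by
      ext a; simp [iterateFrobenius_def]
    rw [this]
    exact RingHom.FiniteType.comp (RingHom.finiteType_algebraMap.2 ‹_›)
      (RingHom.FiniteType.of_surjective _ (bijective_iterateFrobenius k p n).2)

section AdjoinSimple

variable {k K : Type*} [Field k] [Field K] [Algebra k K]

theorem isPrincipalIdealRing_adjoin_singleton (x : K) :
    IsPrincipalIdealRing (Algebra.adjoin k {x}) := by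
  rw [Algebra.adjoin_singleton_eq_range_aeval]
  exact IsPrincipalIdealRing.of_surjective (Polynomial.aeval (R := k) x).rangeRestrict
    (Polynomial.aeval (R := k) x).rangeRestrict_surjective

open IntermediateField algebraAdjoinAdjoin

/-- The integral closure of `k[x]` in a function field is finite over `k[x]`, also when the
extension `K / k(x)` is inseparable: then a power of the Frobenius embeds it into the integral
closure in the separable closure of `k(x)` in `K`. -/
theorem finite_integralClosure_adjoin [Finite k] (x : K) [FiniteDimensional k⟮x⟯ K] :
    Module.Finite (Algebra.adjoin k {x}) (integralClosure (Algebra.adjoin k {x}) K) := by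
  have := isPrincipalIdealRing_adjoin_singleton (k := k) x
  obtain ⟨p, hp⟩ := CharP.exists k
  have hp' : Fact p.Prime := ⟨CharP.char_is_prime k p⟩
  have : ExpChar k p := ExpChar.prime hp'.out
  have : ExpChar (Algebra.adjoin k {x}) p :=
    expChar_of_injective_ringHom (algebraMap k (Algebra.adjoin k {x})).injective p
  have : Algebra.FiniteType k (Algebra.adjoin k {x}) :=
    (Subalgebra.fg_iff_finiteType _).1 ⟨{x}, by simp⟩
  exact integralClosure_finite_of_frobenius_finite (Algebra.adjoin k {x}) k⟮x⟯ K p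
    (iterateFrobenius_finite_of_finiteType k _ p)

theorem isFractionRing_integralClosure_adjoin (x : K) [FiniteDimensional k⟮x⟯ K] :
    IsFractionRing (integralClosure (Algebra.adjoin k {x}) K) K :=
  integralClosure.isFractionRing_of_finite_extension k⟮x⟯ K

theorem isDedekindDomain_integralClosure_adjoin [Finite k] (x : K) [FiniteDimensional k⟮x⟯ K] :
    IsDedekindDomain (integralClosure (Algebra.adjoin k {x}) K) := by
  have := isPrincipalIdealRing_adjoin_singleton (k := k) x
  have := finite_integralClosure_adjoin (k := k) x
  have : IsNoetherianRing (integralClosure (Algebra.adjoin k {x}) K) :=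
    isNoetherian_of_tower (Algebra.adjoin k {x}) inferInstance
  have := isFractionRing_integralClosure_adjoin (k := k) x
  have : IsIntegrallyClosed (integralClosure (Algebra.adjoin k {x}) K) :=
    integralClosure.isIntegrallyClosedOfFiniteExtension k⟮x⟯
  have : Ring.DimensionLEOne (integralClosure (Algebra.adjoin k {x}) K) :=
    Ring.DimensionLEOne.integralClosure _ _
  have : IsDedekindRing (integralClosure (Algebra.adjoin k {x}) K) := {}
  exact {}

/-- Constants are contained in every valuation ring. -/
theorem algebraMap_mem_valuationSubring [Finite k] (O : ValuationSubring K) (c : k) :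
    algebraMap k K c ∈ O := by
  have := Fintype.ofFinite k
  rcases eq_or_ne c 0 with rfl | hc
  · simp
  rcases O.mem_or_inv_mem (algebraMap k K c) with h | h
  · exact h
  · have h1 : algebraMap k K c = (algebraMap k K c)⁻¹ ^ (Fintype.card k - 2) := by
      have h2 := FiniteField.pow_card_sub_one_eq_one c hc
      have h3 : Fintype.card k - 1 = (Fintype.card k - 2) + 1 := by
        have := Fintype.one_lt_card (α := k)
        omega
      rw [h3, pow_succ] at h2
      rw [← map_inv₀, ← map_pow, inv_pow]
      congr 1
      exact eq_inv_of_mul_eq_one_right h2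
    rw [h1]
    exact pow_mem h _

end AdjoinSimple

section Center

open IsDedekindDomain

variable {C K : Type*} [CommRing C] [IsDedekindDomain C] [Field K] [Algebra C K]
  [IsFractionRing C K]

/-- A proper valuation ring containing a Dedekind domain `C` is the localization of `C` at a
nonzero prime. -/
theorem exists_heightOneSpectrum_of_le (O : ValuationSubring K) (hO : O ≠ ⊤)
    (hC : ∀ c : C, algebraMap C K c ∈ O) :
    ∃ P : HeightOneSpectrum C, (P.valuation K).valuationSubring = O ∧
      ∀ c : C, c ∈ P.asIdeal ↔ O.valuation (algebraMap C K c) < 1 := by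
  let f : C →+* O := (algebraMap C K).codRestrict O.toSubring hC
  let I : Ideal C := (IsLocalRing.maximalIdeal O).comap f
  have hI : ∀ c : C, c ∈ I ↔ O.valuation (algebraMap C K c) < 1 := fun c => by
    rw [Ideal.mem_comap, O.valuation_lt_one_iff]
    rfl
  have hprime : I.IsPrime := Ideal.comap_isPrime f _
  have hbot : I ≠ ⊥ := by
    intro hb
    refine hO (top_le_iff.1 fun x _ => ?_)
    obtain ⟨a, s, hs, rfl⟩ := IsFractionRing.div_surjective (A := C) x
    have hs0 : s ≠ 0 := nonZeroDivisors.ne_zero hs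
    have h1 : ¬ O.valuation (algebraMap C K s) < 1 := by
      rw [← hI, hb]; simpa using hs0
    have h2 : O.valuation (algebraMap C K s) = 1 :=
      le_antisymm ((O.valuation_le_one_iff _).2 (hC s)) (not_lt.1 h1)
    rw [← O.valuation_le_one_iff, map_div₀, h2, div_one]
    exact (O.valuation_le_one_iff _).2 (hC a)
  let P : HeightOneSpectrum C := ⟨I, hprime, hbot⟩
  refine ⟨P, ?_, hI⟩
  refine ValuationSubring.eq_of_le_of_ne_top _ ?_ hO
  intro x hx
  obtain ⟨n, d, hnd⟩ := P.exists_primeCompl_mul_eq_of_integer x hx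
  have h1 : ¬ O.valuation (algebraMap C K d) < 1 := by
    rw [← hI]; exact d.2
  have h2 : O.valuation (algebraMap C K d) = 1 :=
    le_antisymm ((O.valuation_le_one_iff _).2 (hC d)) (not_lt.1 h1)
  rw [← O.valuation_le_one_iff]
  have := (O.valuation_le_one_iff _).2 (hC n)
  rwa [← hnd, map_mul, h2, mul_one] at this

theorem exists_pow_mul_valuation_le_one (P : HeightOneSpectrum C) {y : K}
    (hy : P.valuation K y < 1) (b : K) : ∃ d : ℕ, ∀ e ≥ d, P.valuation K (y ^ e * b) ≤ 1 := by
  by_cases hb : b = 0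
  · exact ⟨0, fun e _ => by simp [hb]⟩
  have hb' : 0 < (P.valuation K b)⁻¹ := by
    simpa [zero_lt_iff] using hb
  obtain ⟨d, hd⟩ := exists_pow_lt₀ hy (Units.mk0 _ hb'.ne')
  refine ⟨d, fun e he => ?_⟩
  have h1 : P.valuation K y ^ e ≤ (P.valuation K b)⁻¹ :=
    (pow_le_pow_right_of_le_one' hy.le he).trans hd.le
  rw [map_mul, map_pow]
  calc _ ≤ (P.valuation K b)⁻¹ * P.valuation K b := mul_le_mul_left h1 _
    _ = 1 := inv_mul_cancel₀ (by simpa using hb)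

end Center

/-! ### The ring of functions regular outside a place -/

section Poles

open IsDedekindDomain IntermediateField

variable {k K : Type*} [Field k] [Field K] [Algebra k K]

theorem mem_regularRing {infty : Place K} {x : K} :
    x ∈ regularRing infty ↔ ∀ v : FinitePlace infty, x ∈ v.1.1 := by
  simp [regularRing, Subring.mem_iInf]

theorem mem_valuationSubring_of_mem_adjoin [Finite k] (O : ValuationSubring K) {x b : K}
    (hx : x ∈ O) (hb : b ∈ Algebra.adjoin k {x}) : b ∈ O := by
  induction hb using Algebra.adjoin_induction with
  | mem y hy => rwa [Set.mem_singleton_iff.1 hy]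
  | algebraMap c => exact algebraMap_mem_valuationSubring O c
  | add _ _ _ _ h1 h2 => exact add_mem h1 h2
  | mul _ _ _ _ h1 h2 => exact mul_mem h1 h2

theorem mem_valuationSubring_of_isIntegral_adjoin [Finite k] (O : ValuationSubring K) {x b : K}
    (hx : x ∈ O) (hb : IsIntegral (Algebra.adjoin k {x}) b) : b ∈ O := by
  have h : IsIntegral O (RingHom.id K b) :=
    hb.map_of_comp_eq ((algebraMap (Algebra.adjoin k {x}) K).codRestrict O.toSubring
      fun a => mem_valuationSubring_of_mem_adjoin O hx a.2) (RingHom.id K) (by ext; rfl)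
  obtain ⟨y, hy⟩ := IsIntegrallyClosed.isIntegral_iff.1 h
  have hy' : (y : K) = b := hy
  rw [← hy']
  exact y.2

theorem finite_setOf_mem_asIdeal {C : Type*} [CommRing C] [IsDedekindDomain C] {c : C}
    (hc : c ≠ 0) : {P : HeightOneSpectrum C | c ∈ P.asIdeal}.Finite := by
  have := Ideal.finite_factors (I := Ideal.span {c}) (by simpa using hc)
  refine this.subset fun P hP => ?_
  exact Ideal.dvd_iff_le.2 ((Ideal.span_singleton_le_iff_mem _).2 hP)

/-- The poles of a function integral over `k[1/x]` are zeros of `x`, so it becomes integral over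
`k[x]` after multiplication by a power of `x`. -/
theorem exists_pow_mul_isIntegral_adjoin [Finite k] {x c : K} (hx0 : x ≠ 0)
    [FiniteDimensional k⟮x⟯ K] (hc : IsIntegral (Algebra.adjoin k {x⁻¹}) c) :
    ∃ d : ℕ, ∀ e ≥ d, IsIntegral (Algebra.adjoin k {x}) (x ^ e * c) := by
  let B := integralClosure (Algebra.adjoin k {x}) K
  have : IsDedekindDomain B := isDedekindDomain_integralClosure_adjoin x
  have : IsFractionRing B K := isFractionRing_integralClosure_adjoin x
  let x' : B := algebraMap (Algebra.adjoin k {x}) B ⟨x, Algebra.self_mem_adjoin_singleton k x⟩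
  have hx' : algebraMap B K x' = x := rfl
  have hx'0 : x' ≠ 0 := by
    intro h
    rw [h, map_zero] at hx'
    exact hx0 hx'.symm
  have hfin := finite_setOf_mem_asIdeal hx'0
  have hd : ∀ Q : HeightOneSpectrum B, ∃ d : ℕ, x' ∈ Q.asIdeal →
      ∀ e ≥ d, Q.valuation K (x ^ e * c) ≤ 1 := by
    intro Q
    by_cases hQ : x' ∈ Q.asIdeal
    · obtain ⟨d, hd⟩ := exists_pow_mul_valuation_le_one Q (y := x)
        ((Q.valuation_lt_one_iff_mem (K := K) x').2 hQ) c
      exact ⟨d, fun _ => hd⟩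
    · exact ⟨0, fun h => (hQ h).elim⟩
  choose d hd using hd
  refine ⟨hfin.toFinset.sup d, fun e he => ?_⟩
  have : x ^ e * c ∈ (algebraMap B K).range := by
    apply HeightOneSpectrum.mem_integers_of_valuation_le_one (R := B)
    intro Q
    by_cases hQ : x' ∈ Q.asIdeal
    · exact hd Q hQ e ((Finset.le_sup (f := d) (hfin.mem_toFinset.2 hQ)).trans he)
    · have h1 : Q.valuation K x = 1 := (Q.valuation_eq_one_iff_notMem (K := K)).2 hQ
      have h2 : c ∈ (Q.valuation K).valuationSubring :=
        mem_valuationSubring_of_isIntegral_adjoin _ (x := x⁻¹)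
          (by rw [Valuation.mem_valuationSubring_iff, map_inv₀, h1, inv_one]) hc
      rw [Valuation.mem_valuationSubring_iff] at h2
      rwa [map_mul, map_pow, h1, one_pow, one_mul]
  obtain ⟨z, hz⟩ := this
  rw [← hz]
  exact z.2

/-- If `y` vanishes at a place, then a nonzero polynomial of degree less than `n` in `y` vanishes
there to a smaller order than `y^n`. -/
theorem valuation_pow_lt_valuation_aeval [Finite k] (O : ValuationSubring K) {y : K} (hy0 : y ≠ 0)
    (hy : O.valuation y < 1) {p : Polynomial k} (hp : p ≠ 0) {n : ℕ} (hn : p.degree < n) :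
    O.valuation (y ^ n) < O.valuation (Polynomial.aeval y p) := by
  have hyO : y ∈ O := (O.valuation_le_one_iff _).1 hy.le
  obtain ⟨r, hr, hr0⟩ := Polynomial.exists_eq_pow_rootMultiplicity_mul_and_not_dvd p hp 0
  set j := p.rootMultiplicity 0
  rw [Polynomial.C_0, sub_zero] at hr hr0
  have hc : r.coeff 0 ≠ 0 := fun h => hr0 (Polynomial.X_dvd_iff.2 h)
  have hj : j < n := by
    have h1 : p.natDegree = j + r.natDegree := by
      conv_lhs => rw [hr]
      rw [Polynomial.natDegree_mul (by simp) (by rintro rfl; simp at hc),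
        Polynomial.natDegree_X_pow]
    have h2 : p.natDegree < n := (Polynomial.natDegree_lt_iff_degree_lt hp).2 hn
    omega
  have h1 : O.valuation (Polynomial.aeval y r) = 1 := by
    rw [← Polynomial.divX_mul_X_add r]
    simp only [map_add, map_mul, Polynomial.aeval_X, Polynomial.aeval_C]
    have h3 : O.valuation (algebraMap k K (r.coeff 0)) = 1 := by
      refine le_antisymm ((O.valuation_le_one_iff _).2 (algebraMap_mem_valuationSubring O _)) ?_
      have h4 := (O.valuation_le_one_iff _).2
        (algebraMap_mem_valuationSubring O (r.coeff 0)⁻¹)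
      rw [map_inv₀, map_inv₀] at h4
      exact (inv_le_one₀ (by simpa [zero_lt_iff] using hc)).1 h4
    have h4 : O.valuation (Polynomial.aeval y r.divX) ≤ 1 :=
      (O.valuation_le_one_iff _).2 (mem_valuationSubring_of_mem_adjoin (k := k) O hyO
        (by rw [Algebra.adjoin_singleton_eq_range_aeval]; exact ⟨_, rfl⟩))
    have h5 : O.valuation (Polynomial.aeval y r.divX * y) < 1 := by
      rw [map_mul]
      calc _ ≤ 1 * O.valuation y := mul_le_mul_left h4 _
        _ < 1 := by rwa [one_mul]
    rw [Valuation.map_add_eq_of_lt_right _ (by rw [h3]; exact h5), h3]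
  rw [hr, map_mul, map_mul, h1, mul_one, map_pow, map_pow, Polynomial.aeval_X, map_pow]
  exact pow_lt_pow_right_of_lt_one₀ (by simpa [zero_lt_iff] using hy0) hy hj

/-- An element of a Dedekind domain that is a unit at `P` and is divisible by `y` at all other
primes containing `y`. -/
theorem exists_notMem_forall_valuation_le {C : Type*} [CommRing C] [IsDedekindDomain C]
    [Algebra C K] [IsFractionRing C K] (P : HeightOneSpectrum C) {y : C} (hy : y ≠ 0) :
    ∃ s : C, s ∉ P.asIdeal ∧ ∀ Q : HeightOneSpectrum C, y ∈ Q.asIdeal → Q ≠ P →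
      Q.valuation K (algebraMap C K s * (algebraMap C K y)⁻¹) ≤ 1 := by
  classical
  have hfin := finite_setOf_mem_asIdeal hy
  have hex : ∀ Q : HeightOneSpectrum C, ∃ s : C, Q ≠ P → s ∈ Q.asIdeal ∧ s ∉ P.asIdeal := by
    intro Q
    by_cases hQ : Q = P
    · exact ⟨0, fun h => (h hQ).elim⟩
    · have : ¬ Q.asIdeal ≤ P.asIdeal := fun h =>
        hQ (HeightOneSpectrum.ext (Q.isMaximal.eq_of_le P.isPrime.ne_top h))
      obtain ⟨s, hs, hs'⟩ := Set.not_subset.1 this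
      exact ⟨s, fun _ => ⟨hs, hs'⟩⟩
  choose s hs using hex
  let s0 : C := ∏ Q ∈ hfin.toFinset.erase P, s Q
  have hs0P : s0 ∉ P.asIdeal := by
    intro h
    obtain ⟨Q, hQ, hQ'⟩ := (Ideal.IsPrime.prod_mem_iff (hp := P.isPrime)).1 h
    exact (hs Q (Finset.ne_of_mem_erase hQ)).2 hQ'
  have hs0Q : ∀ Q : HeightOneSpectrum C, y ∈ Q.asIdeal → Q ≠ P → s0 ∈ Q.asIdeal := by
    intro Q hQ hQP
    exact Ideal.mem_of_dvd _ (Finset.dvd_prod_of_mem s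
      (Finset.mem_erase.2 ⟨hQP, hfin.mem_toFinset.2 hQ⟩)) (hs Q hQP).1
  have hM : ∀ Q : HeightOneSpectrum C, ∃ M : ℕ, y ∈ Q.asIdeal → Q ≠ P → ∀ e ≥ M,
      Q.valuation K (algebraMap C K s0 ^ e * (algebraMap C K y)⁻¹) ≤ 1 := by
    intro Q
    by_cases hQ : y ∈ Q.asIdeal ∧ Q ≠ P
    · obtain ⟨d, hd⟩ := exists_pow_mul_valuation_le_one (K := K) Q (y := algebraMap C K s0)
        ((Q.valuation_lt_one_iff_mem s0).2 (hs0Q Q hQ.1 hQ.2)) (algebraMap C K y)⁻¹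
      exact ⟨d, fun _ _ => hd⟩
    · exact ⟨0, fun h1 h2 => (hQ ⟨h1, h2⟩).elim⟩
  choose M hM using hM
  refine ⟨s0 ^ hfin.toFinset.sup M, fun h => hs0P (P.isPrime.mem_of_pow_mem _ h), ?_⟩
  intro Q hQ hQP
  rw [map_pow]
  exact hM Q hQ hQP _ (Finset.le_sup (f := M) (hfin.mem_toFinset.2 hQ))

/-- The functions of the form `g' + x^(-n) h` with `x^n g'` integral over `k[x]` and `h` integral over
`k[1/x]`. -/
def polePart (k : Type*) [Field k] [Algebra k K] (x : K) (n : ℕ) : Submodule k K where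
  carrier := {g | ∃ g' h : K, IsIntegral (Algebra.adjoin k {x}) (x ^ n * g') ∧
    IsIntegral (Algebra.adjoin k {x⁻¹}) h ∧ g = g' + x⁻¹ ^ n * h}
  add_mem' := by
    rintro _ _ ⟨g, h, hg, hh, rfl⟩ ⟨g', h', hg', hh', rfl⟩
    exact ⟨g + g', h + h', by rw [mul_add]; exact hg.add hg', hh.add hh', by ring⟩
  zero_mem' := ⟨0, 0, by simpa using isIntegral_zero, isIntegral_zero, by simp⟩
  smul_mem' := by
    rintro c _ ⟨g, h, hg, hh, rfl⟩
    refine ⟨c • g, c • h, ?_, ?_, by rw [smul_add, mul_smul_comm]⟩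
    · rw [mul_smul_comm]; exact hg.smul c
    · exact hh.smul c

/-- There is a function regular outside `infty` with a pole at `infty`. Let `x` have a pole at
`infty` and let `y = 1/x`. Choose `s` integral over `k[y]`, a unit at `infty` and divisible by `y`
at the other zeros of `y`. The functions integral over `k[y]` modulo `polePart k x n` span a space
whose dimension is bounded independently of `n`. Hence for large `n` there is a nonzero polynomial
`p` of degree less than `n` with `s^n p(y) = g + y^n h`, where `x^n g` is integral over `k[x]` and
`h` is integral over `k[y]`. Now `x^n g` has a pole at `infty`, because `p(y)` vanishes to a smaller
order than `y^n` there. At the other poles of `x` it is regular, because `s/y` is. -/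
theorem exists_pole_only_at [Finite k]
    (hfd : ∀ x : K, Transcendental k x → FiniteDimensional k⟮x⟯ K)
    (hconst : ∀ x : K, IsAlgebraic k x → x ∈ Set.range (algebraMap k K)) (infty : Place K) :
    ∃ t ∈ regularRing infty, t ∉ infty.1 := by
  obtain ⟨x, -, hx⟩ := SetLike.exists_of_lt (lt_top_iff_ne_top.2 infty.2)
  have htr : ∀ z : K, z ∉ infty.1 ∨ z⁻¹ ∉ infty.1 → Transcendental k z := by
    intro z hz halg
    obtain ⟨c, rfl⟩ := hconst z halg
    rcases hz with hz | hz
    · exact hz (algebraMap_mem_valuationSubring _ c)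
    · rw [← map_inv₀] at hz
      exact hz (algebraMap_mem_valuationSubring _ c⁻¹)
  have hx0 : x ≠ 0 := by rintro rfl; exact hx (zero_mem _)
  set y := x⁻¹ with hy
  have := hfd x (htr x (Or.inl hx))
  have := hfd y (htr y (Or.inr (by rwa [hy, inv_inv])))
  let C := integralClosure (Algebra.adjoin k {y}) K
  have : IsDedekindDomain C := isDedekindDomain_integralClosure_adjoin y
  have : IsFractionRing C K := isFractionRing_integralClosure_adjoin y
  have hCfin : Module.Finite (Algebra.adjoin k {y}) C := finite_integralClosure_adjoin y
  let y' : C := algebraMap (Algebra.adjoin k {y}) C ⟨y, Algebra.self_mem_adjoin_singleton k y⟩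
  have hy' : algebraMap C K y' = y := rfl
  have hy0 : y ≠ 0 := inv_ne_zero hx0
  have hy'0 : y' ≠ 0 := by
    intro h
    rw [h, map_zero] at hy'
    exact hy0 hy'.symm
  have hval : ∀ O : ValuationSubring K, x ∉ O → y ∈ O ∧ O.valuation y < 1 := by
    intro O hO
    have h1 : ¬ O.valuation x ≤ 1 := fun h => hO ((O.valuation_le_one_iff _).1 h)
    have h2 : O.valuation y < 1 := by
      rw [hy, map_inv₀]
      exact inv_lt_one_of_one_lt₀ (not_le.1 h1)
    exact ⟨(O.valuation_le_one_iff _).1 h2.le, h2⟩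
  have hCO : ∀ O : ValuationSubring K, x ∉ O → ∀ c : C, algebraMap C K c ∈ O := fun O hO c =>
    mem_valuationSubring_of_isIntegral_adjoin O (hval O hO).1 c.2
  obtain ⟨P, hP, hP'⟩ := exists_heightOneSpectrum_of_le infty.1 infty.2 (hCO _ hx)
  obtain ⟨s, hsP, hsQ⟩ := exists_notMem_forall_valuation_le (K := K) P hy'0
  obtain ⟨G, hG⟩ := hCfin.fg_top
  have hd : ∀ c : C, ∃ d : ℕ, ∀ e ≥ d, IsIntegral (Algebra.adjoin k {x}) (x ^ e * c) := fun c =>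
    exists_pow_mul_isIntegral_adjoin hx0 c.2
  choose d' hd' using hd
  let d := G.sup d'
  have hd : ∀ c ∈ G, ∀ e ≥ d, IsIntegral (Algebra.adjoin k {x}) (x ^ e * c) := fun c hc e he =>
    hd' c e ((Finset.le_sup hc).trans he)
  clear_value d
  classical
  -- `n` exceeds the number of generators of the space `F` below, which does not depend on `n`
  let n := (G ×ˢ Finset.range d).card + 1 + d
  have hnd : d ≤ n := by omega
  let W := polePart k x n
  let F' : Finset K := (G ×ˢ Finset.range d).image fun z => y ^ (n - d + z.2) * (z.1 : K)
  let F : Submodule k K := Submodule.span k F'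
  have hmono : ∀ c ∈ G, ∀ l : ℕ, y ^ l * (c : K) ∈ W ⊔ F := by
    intro c hc l
    rcases le_or_gt (l + d) n with hl | hl
    · refine Submodule.mem_sup_left ⟨y ^ l * c, 0, ?_, isIntegral_zero, by simp⟩
      have : x ^ n * (y ^ l * (c : K)) = x ^ (n - l) * c := by
        have h1 : x ^ n = x ^ (n - l) * x ^ l := by rw [← pow_add]; congr 1; omega
        calc _ = x ^ (n - l) * ((x * y) ^ l * c) := by rw [h1, mul_pow]; ring
          _ = _ := by rw [mul_inv_cancel₀ hx0, one_pow, one_mul]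
      rw [this]
      exact hd c hc _ (by omega)
    rcases le_or_gt n l with hl' | hl'
    · refine Submodule.mem_sup_left ⟨0, y ^ (l - n) * c, by simpa using isIntegral_zero, ?_, ?_⟩
      · exact (y' ^ (l - n) * c).2
      · rw [zero_add, ← mul_assoc, ← pow_add]; congr 2; omega
    · refine Submodule.mem_sup_right (Submodule.subset_span ?_)
      refine Finset.mem_coe.2 (Finset.mem_image.2 ⟨(c, l - (n - d)), ?_, ?_⟩)
      · simp only [Finset.mem_product, Finset.mem_range]
        exact ⟨hc, by omega⟩
      · simp only
        congr 2; omega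
  have hCW : ∀ c : C, (c : K) ∈ W ⊔ F := by
    intro c
    have hc : c ∈ Submodule.span (Algebra.adjoin k {y}) (G : Set C) := by rw [hG]; trivial
    obtain ⟨a, -, rfl⟩ := Submodule.mem_span_finset.1 hc
    rw [AddSubmonoidClass.coe_finsetSum]
    refine Submodule.sum_mem _ fun c hc => ?_
    obtain ⟨p, hp⟩ : (a c : K) ∈ (Polynomial.aeval (R := k) y).range := by
      rw [← Algebra.adjoin_singleton_eq_range_aeval]
      exact (a c).2
    have : ((a c • c : C) : K) = Polynomial.aeval y p * c := by
      rw [show Polynomial.aeval y p = (a c : K) from hp]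
      rfl
    rw [this, Polynomial.aeval_eq_sum_range, Finset.sum_mul]
    refine Submodule.sum_mem _ fun l _ => ?_
    rw [smul_mul_assoc]
    exact Submodule.smul_mem _ _ (hmono c hc l)
  have hpoly : ∀ p : Polynomial k, (s : K) ^ n * Polynomial.aeval y p ∈ W ⊔ F := by
    intro p
    have : Polynomial.aeval y p ∈ Algebra.adjoin k {y} := by
      rw [Algebra.adjoin_singleton_eq_range_aeval]; exact ⟨p, rfl⟩
    exact hCW (s ^ n * algebraMap (Algebra.adjoin k {y}) C ⟨_, this⟩)
  let φ : Polynomial.degreeLT k n →ₗ[k] K ⧸ W := W.mkQ ∘ₗ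
    (LinearMap.mulLeft k ((s : K) ^ n)) ∘ₗ (Polynomial.aeval y).toLinearMap ∘ₗ
      (Polynomial.degreeLT k n).subtype
  have hφ : ∀ p, φ p ∈ F.map W.mkQ := by
    intro p
    obtain ⟨w, hw, f, hf, hwf⟩ := Submodule.mem_sup.1 (hpoly p)
    refine ⟨f, hf, ?_⟩
    have h2 : φ p = W.mkQ ((s : K) ^ n * Polynomial.aeval y (p : Polynomial k)) := rfl
    rw [h2, ← hwf, map_add, (Submodule.Quotient.mk_eq_zero W).2 hw |> fun h => (h : W.mkQ w = 0),
      zero_add]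
  have hninj : ¬ Function.Injective (φ.codRestrict _ hφ) := by
    intro hinj
    have h1 := LinearMap.finrank_le_finrank_of_injective hinj
    have h2 : Module.finrank k (Polynomial.degreeLT k n) = n := by
      rw [(Polynomial.degreeLTEquiv k n).finrank_eq, Module.finrank_fin_fun]
    have h3 : Module.finrank k (F.map W.mkQ) ≤ Module.finrank k F := Submodule.finrank_map_le _ _
    have h4 : Module.finrank k F ≤ F'.card := finrank_span_finset_le_card F'
    have h5 : F'.card ≤ (G ×ˢ Finset.range d).card := Finset.card_image_le
    omega
  obtain ⟨⟨p, hpn⟩, hp, hp0⟩ : ∃ p, φ p = 0 ∧ p ≠ 0 := by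
    by_contra! hcon
    refine hninj ((injective_iff_map_eq_zero _).2 fun p hp => hcon p ?_)
    exact congrArg Subtype.val hp
  have hp0 : p ≠ 0 := fun h => hp0 (Subtype.ext h)
  have hpn : p.degree < n := Polynomial.mem_degreeLT.1 hpn
  obtain ⟨g, h, hg, hh, hgh⟩ : (s : K) ^ n * Polynomial.aeval y p ∈ W :=
    (Submodule.Quotient.mk_eq_zero W).1 hp
  have hgh' : x ^ n * g = (s * y⁻¹) ^ n * Polynomial.aeval y p - h := by
    have h1 : g = (s : K) ^ n * Polynomial.aeval y p - y ^ n * h := by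
      rw [hgh]; exact (add_sub_cancel_right g _).symm
    have h2 : (x * y) ^ n = 1 := by rw [mul_inv_cancel₀ hx0, one_pow]
    have h3 : y⁻¹ = x := inv_inv x
    rw [h1, h3]
    linear_combination (-h) * h2
  have hpO : ∀ O : ValuationSubring K, x ∉ O → Polynomial.aeval y p ∈ O := fun O hO =>
    mem_valuationSubring_of_mem_adjoin (k := k) O (hval O hO).1
      (by rw [Algebra.adjoin_singleton_eq_range_aeval]; exact ⟨_, rfl⟩)
  refine ⟨x ^ n * g, mem_regularRing.2 fun v => ?_, fun hcon => ?_⟩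
  · by_cases hxv : x ∈ v.1.1
    · exact mem_valuationSubring_of_isIntegral_adjoin _ hxv hg
    · obtain ⟨Q, hQ, hQ'⟩ := exists_heightOneSpectrum_of_le v.1.1 v.1.2 (hCO _ hxv)
      have hyQ : y' ∈ Q.asIdeal := (hQ' y').2 (hval _ hxv).2
      have hQP : Q ≠ P := by
        rintro rfl
        exact v.2 (Subtype.ext (hQ.symm.trans hP))
      rw [hgh']
      refine sub_mem (mul_mem (pow_mem ?_ _) (hpO _ hxv)) (hCO _ hxv ⟨h, hh⟩)
      rw [← hQ, Valuation.mem_valuationSubring_iff]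
      exact hsQ Q hyQ hQP
  · have h1 : (s * y⁻¹) ^ n * Polynomial.aeval y p ∈ infty.1 := by
      have := add_mem hcon (hCO _ hx ⟨h, hh⟩)
      rw [hgh'] at this
      simpa using this
    have h2 : infty.1.valuation (s : K) = 1 :=
      le_antisymm ((infty.1.valuation_le_one_iff _).2 (hCO _ hx s))
        (not_lt.1 fun h => hsP ((hP' s).2 h))
    rw [← infty.1.valuation_le_one_iff, map_mul, map_pow, map_mul, h2, one_mul, map_inv₀] at h1
    have h3 := valuation_pow_lt_valuation_aeval infty.1 hy0 (hval _ hx).2 hp0 hpn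
    rw [map_pow] at h3
    have h4 : (0 : infty.1.ValueGroup) < infty.1.valuation y ^ n :=
      pow_pos (by simpa [zero_lt_iff] using hy0) _
    rw [inv_pow, inv_mul_le_one₀ h4] at h1
    exact absurd h1 (not_le.2 h3)

end Poles

section RegularRing

open IsDedekindDomain IntermediateField

variable {k K : Type*} [Field k] [Field K] [Algebra k K]

/-- A function with a pole is transcendental over the constants. -/
theorem transcendental_of_notMem (hK : IsGlobalFunctionField k K) {O : ValuationSubring K}
    {t : K} (ht : t ∉ O) : Transcendental k t := by
  have := hK.finite_const
  intro halg
  obtain ⟨c, rfl⟩ := hK.const_closed t halg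
  exact ht (algebraMap_mem_valuationSubring O c)

/-- `A` is the integral closure in `K` of `k[t]` for any `t` whose only pole is `infty`: both rings
are the intersection of the valuation rings in which `t` lies. -/
theorem exists_regularRing_eq_integralClosure (hK : IsGlobalFunctionField k K) (infty : Place K) :
    ∃ t : K, Transcendental k t ∧ t ∈ regularRing infty ∧ t ∉ infty.1 ∧
      regularRing infty = (integralClosure (Algebra.adjoin k {t}) K).toSubring := by
  have := hK.finite_const
  obtain ⟨t, htA, ht⟩ := exists_pole_only_at
    (fun x hx => finiteDimensional_adjoin_of_transcendental hK hx) hK.const_closed infty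
  have htr := transcendental_of_notMem hK ht
  refine ⟨t, htr, htA, ht, le_antisymm (fun x hx => ?_) fun x hx => ?_⟩
  · have := finiteDimensional_adjoin_of_transcendental hK htr
    let C := integralClosure (Algebra.adjoin k {t}) K
    have : IsDedekindDomain C := isDedekindDomain_integralClosure_adjoin t
    have : IsFractionRing C K := isFractionRing_integralClosure_adjoin t
    have htC : IsIntegral (Algebra.adjoin k {t}) t :=
      isIntegral_algebraMap (x := (⟨t, Algebra.self_mem_adjoin_singleton k t⟩ :
        Algebra.adjoin k {t}))
    obtain ⟨z, hz⟩ : x ∈ (algebraMap C K).range := by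
      apply HeightOneSpectrum.mem_integers_of_valuation_le_one (R := C)
      intro Q
      have htop : (Q.valuation K).valuationSubring ≠ ⊤ := by
        simp only [ne_eq, Valuation.valuationSubring_eq_top_iff, not_not]; infer_instance
      have hinf : (⟨_, htop⟩ : Place K) ≠ infty := by
        rintro rfl
        exact ht (Q.valuation_le_one (K := K) (⟨t, htC⟩ : C))
      exact mem_regularRing.1 hx ⟨⟨_, htop⟩, hinf⟩
    rw [← hz]
    exact z.2
  · exact mem_regularRing.2 fun v =>
      mem_valuationSubring_of_isIntegral_adjoin _ (mem_regularRing.1 htA v) hx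

theorem isDedekindDomain_regularRing (hK : IsGlobalFunctionField k K) (infty : Place K) :
    IsDedekindDomain (regularRing infty) := by
  have := hK.finite_const
  obtain ⟨t, htr, -, -, h⟩ := exists_regularRing_eq_integralClosure hK infty
  have := finiteDimensional_adjoin_of_transcendental hK htr
  rw [h]
  exact isDedekindDomain_integralClosure_adjoin t

theorem isFractionRing_regularRing (hK : IsGlobalFunctionField k K) (infty : Place K) :
    IsFractionRing (regularRing infty) K := by
  obtain ⟨t, htr, -, -, h⟩ := exists_regularRing_eq_integralClosure hK infty
  have := finiteDimensional_adjoin_of_transcendental hK htr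
  rw [h]
  exact isFractionRing_integralClosure_adjoin t

/-- Noether normalization of `A`: it is a finite extension of a polynomial ring over the
constants. -/
theorem exists_polynomial_finite (hK : IsGlobalFunctionField k K) (infty : Place K) :
    ∃ ρ : Polynomial k →+* regularRing infty, Function.Injective ρ ∧ ρ.Finite := by
  have := hK.finite_const
  obtain ⟨t, htr, -, -, h⟩ := exists_regularRing_eq_integralClosure hK infty
  have := finiteDimensional_adjoin_of_transcendental hK htr
  rw [h]
  have hfin : (algebraMap (Algebra.adjoin k {t}) (integralClosure (Algebra.adjoin k {t}) K)).Finite :=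
    RingHom.finite_algebraMap.2 (finite_integralClosure_adjoin t)
  let e : Polynomial k →+* Algebra.adjoin k {t} :=
    (Polynomial.aeval t).toRingHom.codRestrict (Algebra.adjoin k {t}) fun p => by
      rw [Algebra.adjoin_singleton_eq_range_aeval]; exact ⟨p, rfl⟩
  refine ⟨RingHom.comp _ e, ?_, RingHom.Finite.comp hfin (RingHom.Finite.of_surjective e ?_)⟩
  · intro p q hpq
    exact transcendental_iff_injective.1 htr (congrArg Subtype.val hpq)
  · rintro ⟨x, hx⟩
    rw [Algebra.adjoin_singleton_eq_range_aeval] at hx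
    obtain ⟨p, hp⟩ := hx
    exact ⟨p, Subtype.ext hp⟩

/-- The maximal ideal of `A` belonging to a finite place. -/
theorem exists_heightOneSpectrum (hK : IsGlobalFunctionField k K) {infty : Place K}
    (v : FinitePlace infty) :
    have := isDedekindDomain_regularRing hK infty
    have := isFractionRing_regularRing hK infty
    ∃ P : HeightOneSpectrum (regularRing infty), (P.valuation K).valuationSubring = v.1.1 ∧
      ∀ c : regularRing infty, c ∈ P.asIdeal ↔ v.1.1.valuation (c : K) < 1 := by
  have := isDedekindDomain_regularRing hK infty
  have := isFractionRing_regularRing hK infty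
  exact exists_heightOneSpectrum_of_le v.1.1 v.1.2 fun c => mem_regularRing.1 c.2 v

/-- Every proper ideal of `A` has a zero at a finite place. The excluded place does not come from a
maximal ideal of `A`, since some function in `A` has a pole there. -/
theorem exists_finitePlace (hK : IsGlobalFunctionField k K) {infty : Place K}
    (I : Ideal (regularRing infty)) (hI : I ≠ ⊤) :
    ∃ v : FinitePlace infty, ∀ c ∈ I, v.1.1.valuation (c : K) < 1 := by
  have := isDedekindDomain_regularRing hK infty
  have := isFractionRing_regularRing hK infty
  obtain ⟨t, htr, htA, ht, -⟩ := exists_regularRing_eq_integralClosure hK infty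
  obtain ⟨ρ, hρ, hρfin⟩ := exists_polynomial_finite hK infty
  have hfield : ¬ IsField (regularRing infty) := by
    algebraize [ρ]
    have : Module.Finite (Polynomial k) (regularRing infty) := hρfin
    rw [← Algebra.IsIntegral.isField_iff_isField (R := Polynomial k) hρ]
    exact Polynomial.not_isField k
  obtain ⟨M, hM, hIM⟩ := Ideal.exists_le_maximal I hI
  let P : HeightOneSpectrum (regularRing infty) :=
    ⟨M, hM.isPrime, Ring.ne_bot_of_isMaximal_of_not_isField hM hfield⟩
  have htop : (P.valuation K).valuationSubring ≠ ⊤ := by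
    simp only [ne_eq, Valuation.valuationSubring_eq_top_iff, not_not]; infer_instance
  have hinf : (⟨_, htop⟩ : Place K) ≠ infty := by
    intro h
    apply ht
    rw [← h]
    exact P.valuation_le_one (K := K) (⟨t, htA⟩ : regularRing _)
  refine ⟨⟨⟨_, htop⟩, hinf⟩, fun c hc => ?_⟩
  have h1 := (P.valuation_lt_one_iff_mem (K := K) c).2 (hIM hc)
  exact (Valuation.isEquiv_valuation_valuationSubring (P.valuation K)).lt_one_iff_lt_one.1 h1

/-- An ideal of `A` that contains a unit at every finite place contains `1`. -/
theorem one_mem_of_forall_exists_valuation_eq_one (hK : IsGlobalFunctionField k K)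
    {infty : Place K} (I : Ideal (regularRing infty))
    (h : ∀ v : FinitePlace infty, ∃ s ∈ I, v.1.1.valuation (s : K) = 1) : (1 : regularRing infty) ∈ I := by
  rw [← Ideal.eq_top_iff_one]
  by_contra hI
  obtain ⟨v, hv⟩ := exists_finitePlace hK I hI
  obtain ⟨s, hs, hs1⟩ := h v
  exact (hv s hs).ne hs1

/-- The valuation ring of a finite place is a localization of `A`. -/
theorem exists_mul_mem_regularRing (hK : IsGlobalFunctionField k K) {infty : Place K}
    (v : FinitePlace infty) {x : K} (hx : x ∈ v.1.1) :
    ∃ s : regularRing infty, v.1.1.valuation (s : K) = 1 ∧ x * s ∈ regularRing infty := by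
  have := isDedekindDomain_regularRing hK infty
  have := isFractionRing_regularRing hK infty
  obtain ⟨P, hP, hP'⟩ := exists_heightOneSpectrum hK v
  rw [← hP] at hx
  obtain ⟨n, d, hnd⟩ := P.exists_primeCompl_mul_eq_of_integer x hx
  refine ⟨d, ?_, ?_⟩
  · refine le_antisymm ((v.1.1.valuation_le_one_iff _).2 (mem_regularRing.1 d.1.2 v)) ?_
    rw [← not_lt, ← hP']
    exact d.2
  · have h : x * ((d : regularRing infty) : K) = (n : K) := hnd
    rw [h]
    exact n.2

/-- The valuation of a finite place has rank one. -/
theorem exists_pow_mul_mem (hK : IsGlobalFunctionField k K) {infty : Place K}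
    (v : FinitePlace infty) {y : K} (hy : v.1.1.valuation y < 1) (x : K) :
    ∃ d : ℕ, ∀ e ≥ d, y ^ e * x ∈ v.1.1 := by
  have := isDedekindDomain_regularRing hK infty
  have := isFractionRing_regularRing hK infty
  obtain ⟨P, hP, -⟩ := exists_heightOneSpectrum hK v
  have hy' : P.valuation K y < 1 := by
    rw [(Valuation.isEquiv_valuation_valuationSubring (P.valuation K)).lt_one_iff_lt_one, hP]
    exact hy
  obtain ⟨d, hd⟩ := exists_pow_mul_valuation_le_one P hy' x
  refine ⟨d, fun e he => ?_⟩
  rw [← hP]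
  exact hd e he

theorem finite_setOf_valuation_lt_one (hK : IsGlobalFunctionField k K) {infty : Place K}
    {c : regularRing infty} (hc : c ≠ 0) :
    {v : FinitePlace infty | v.1.1.valuation (c : K) < 1}.Finite := by
  have := isDedekindDomain_regularRing hK infty
  have := isFractionRing_regularRing hK infty
  choose P hP hP' using fun v : FinitePlace infty => exists_heightOneSpectrum hK v
  refine (finite_setOf_mem_asIdeal hc).preimage (f := P) ?_ |>.subset ?_
  · intro v _ w _ hvw
    refine Subtype.ext (Subtype.ext ?_)
    rw [← hP v, ← hP w]
    exact congrArg (fun Q => (HeightOneSpectrum.valuation K Q).valuationSubring) hvw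
  · intro v hv
    exact (hP' v c).2 hv

theorem hasFiniteQuotients_polynomial (k : Type*) [Field k] [Finite k] :
    Ring.HasFiniteQuotients (Polynomial k) where
  finiteQuotient {I} hI := by
    obtain ⟨f, rfl⟩ := (inferInstance : I.IsPrincipal)
    have hf : f ≠ 0 := by rintro rfl; simp at hI
    have : Module.Finite k (AdjoinRoot f) := (AdjoinRoot.powerBasis hf).finite
    exact Module.finite_of_finite (M := AdjoinRoot f) k

theorem hasFiniteQuotients_regularRing (hK : IsGlobalFunctionField k K) (infty : Place K) :
    Ring.HasFiniteQuotients (regularRing infty) := by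
  have := hK.finite_const
  obtain ⟨ρ, hρ, hρfin⟩ := exists_polynomial_finite hK infty
  algebraize [ρ]
  have : Module.Finite (Polynomial k) (regularRing infty) := hρfin
  have := hasFiniteQuotients_polynomial k
  exact Ring.HasFiniteQuotients.of_module_finite (Polynomial k) _

end RegularRing

/-! ### Approximation and the Jordan-Zassenhaus theorem -/

section Approximation

variable {Z S : Type*} [EuclideanDomain Z] [Ring S] [Algebra Z S]

/-- The norm is a form of degree the rank in the coordinates; hence elements with small coordinates
have small norm. -/
theorem exists_abv_norm_le (abv : AbsoluteValue Z ℤ) {ι : Type*} [Fintype ι]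
    (bS : Module.Basis ι Z S) : ∃ C : ℝ, 0 < C ∧ ∀ (s : S) (y : ℝ),
      (∀ i, (abv (bS.repr s i) : ℝ) ≤ y) → (abv (Algebra.norm Z s) : ℝ) ≤ C * y ^ Fintype.card ι := by
  classical
  obtain ⟨m, hm⟩ : ∃ m : ℕ, ∀ i j k, abv (Algebra.leftMulMatrix bS (bS i) j k) ≤ m := by
    refine ⟨∑ i, ∑ j, ∑ k, (abv (Algebra.leftMulMatrix bS (bS i) j k)).toNat, fun i j k => ?_⟩
    rw [← Int.toNat_of_nonneg (abv.nonneg _), Int.ofNat_le]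
    refine le_trans ?_ (Finset.single_le_sum (f := fun i => ∑ j, ∑ k,
      (abv (Algebra.leftMulMatrix bS (bS i) j k)).toNat) (fun _ _ => Nat.zero_le _)
      (Finset.mem_univ i))
    refine le_trans ?_ (Finset.single_le_sum (f := fun j => ∑ k,
      (abv (Algebra.leftMulMatrix bS (bS i) j k)).toNat) (fun _ _ => Nat.zero_le _)
      (Finset.mem_univ j))
    exact Finset.single_le_sum (f := fun k =>
      (abv (Algebra.leftMulMatrix bS (bS i) j k)).toNat) (fun _ _ => Nat.zero_le _)
      (Finset.mem_univ k)
  refine ⟨(Fintype.card ι).factorial * (Fintype.card ι * m) ^ Fintype.card ι + 1, by positivity,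
    fun s y hy => ?_⟩
  have h1 : ∀ i, abv (bS.repr s i) ≤ ⌊y⌋ := fun i => Int.le_floor.2 (hy i)
  have h2 := Matrix.det_sum_smul_le Finset.univ (fun i j k => hm i j k) h1
  have h3 : ∑ i, bS.repr s i • Algebra.leftMulMatrix bS (bS i) = Algebra.leftMulMatrix bS s := by
    conv_rhs => rw [← bS.sum_repr s]
    simp only [map_sum, map_smul]
  rw [h3, ← Algebra.norm_eq_matrix_det] at h2
  refine (Int.cast_le (R := ℝ).2 h2).trans ?_
  rcases isEmpty_or_nonempty ι with hι | ⟨⟨i⟩⟩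
  · simp
  have hy0 : (0 : ℝ) ≤ y := le_trans (by exact_mod_cast abv.nonneg _) (hy i)
  have h4 : (0 : ℝ) ≤ ⌊y⌋ := by exact_mod_cast Int.floor_nonneg.2 hy0
  rw [add_mul, one_mul, mul_assoc ((Fintype.card ι).factorial : ℝ), ← mul_pow]
  simp only [nsmul_eq_mul, Finset.card_univ]
  push_cast
  refine le_trans ?_ (le_add_of_nonneg_right (pow_nonneg hy0 _))
  refine mul_le_mul_of_nonneg_left (pow_le_pow_left₀ (by positivity) ?_ _) (by positivity)
  calc (Fintype.card ι : ℝ) * ⌊y⌋ * m = Fintype.card ι * m * ⌊y⌋ := by ring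
    _ ≤ _ := mul_le_mul_of_nonneg_left (Int.floor_le y) (by positivity)

/-- Every element of a finite free algebra without zero divisors divides a nonzero scalar. -/
theorem exists_mul_eq_algebraMap [IsDomain S] [Module.Free Z S] [Module.Finite Z S] {b : S}
    (hb : b ≠ 0) : ∃ x : S, ∃ d : Z, d ≠ 0 ∧ b * x = algebraMap Z S d ∧
      x * b = algebraMap Z S d := by
  classical
  let bS := Module.Free.chooseBasis Z S
  let x : S := bS.equivFun.symm ((Algebra.leftMulMatrix bS b).adjugate.mulVec (bS.repr 1))
  have h1 : b * x = algebraMap Z S (Algebra.norm Z b) := by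
    apply bS.repr.injective
    apply DFunLike.coe_injective
    rw [← Algebra.leftMulMatrix_mulVec_repr]
    have : (bS.repr x : _ → Z) =
        (Algebra.leftMulMatrix bS b).adjugate.mulVec (bS.repr 1) := by
      rw [← Module.Basis.equivFun_apply, LinearEquiv.apply_symm_apply]
    rw [this, Matrix.mulVec_mulVec, Matrix.mul_adjugate, Matrix.smul_mulVec, Matrix.one_mulVec,
      ← Algebra.norm_eq_matrix_det, Algebra.algebraMap_eq_smul_one, map_smul]
    rfl
  refine ⟨x, _, Algebra.norm_ne_zero_iff.2 hb, h1, ?_⟩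
  have h2 : b * (x * b - algebraMap Z S (Algebra.norm Z b)) = 0 := by
    rw [mul_sub, ← mul_assoc, h1, Algebra.commutes, sub_self]
  exact sub_eq_zero.1 ((mul_eq_zero.1 h2).resolve_left hb)

/-- The finiteness theorem of Jordan and Zassenhaus for the right ideals of an order in a division
algebra: up to a bounded scalar every nonzero right ideal is principal.  As in the commutative
case, a generator is an element of the ideal of minimal norm. -/
theorem exists_forall_smul_eq_mul [IsDomain S] [Module.Free Z S] [Module.Finite Z S] [Infinite Z]
    {abv : AbsoluteValue Z ℤ} (adm : abv.IsAdmissible) :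
    ∃ M : Z, M ≠ 0 ∧ ∀ I : AddSubgroup S, (∀ a ∈ I, ∀ r, a * r ∈ I) → I ≠ ⊥ →
      ∃ b ∈ I, b ≠ 0 ∧ ∀ a ∈ I, ∃ c, M • a = b * c := by
  classical
  let bS := Module.Free.chooseBasis Z S
  let n := Fintype.card (Module.Free.ChooseBasisIndex Z S)
  have hn : 0 < n := Fintype.card_pos_iff.2 bS.index_nonempty
  obtain ⟨C, hC, hCb⟩ := exists_abv_norm_le abv bS
  -- a radius `ε` with `C ε ^ n < 1`
  obtain ⟨ε, hε, hεC⟩ : ∃ ε : ℝ, 0 < ε ∧ C * ε ^ n < 1 := by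
    refine ⟨1 / (C + 1), by positivity, ?_⟩
    have h1 : (1 / (C + 1)) ^ n ≤ 1 / (C + 1) :=
      pow_le_of_le_one (by positivity) ((div_le_one (by positivity)).2 (by linarith)) hn.ne'
    calc C * (1 / (C + 1)) ^ n ≤ C * (1 / (C + 1)) := mul_le_mul_of_nonneg_left h1 hC.le
      _ < 1 := by rw [mul_one_div, div_lt_one (by positivity)]; linarith
  let μ : Fin (adm.card ε ^ n).succ ↪ Z := Fin.valEmbedding.trans (Infinite.natEmbedding Z)
  have happrox : ∀ (a : S) (d : Z), d ≠ 0 → ∃ i j, i ≠ j ∧ ∃ q s : S,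
      (μ i - μ j) • a = d • q + s ∧ abv (Algebra.norm Z s) < abv d ^ n := by
    intro a d hd
    obtain ⟨j, i, hij, h⟩ := adm.exists_approx hε hd (fun j k => μ j * bS.repr a k)
    refine ⟨i, j, hij.symm,
      bS.equivFun.symm (fun k => μ i * bS.repr a k / d - μ j * bS.repr a k / d),
      bS.equivFun.symm (fun k => μ i * bS.repr a k % d - μ j * bS.repr a k % d), ?_, ?_⟩
    · apply bS.equivFun.injective
      rw [map_add, map_smul, map_smul, LinearEquiv.apply_symm_apply, LinearEquiv.apply_symm_apply]
      funext k
      have h1 := EuclideanDomain.div_add_mod (μ i * bS.repr a k) d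
      have h2 := EuclideanDomain.div_add_mod (μ j * bS.repr a k) d
      simp only [Pi.smul_apply, Pi.add_apply, smul_eq_mul, Module.Basis.equivFun_apply]
      linear_combination h2 - h1
    · have hdpos : (0 : ℝ) < abv d := by exact_mod_cast abv.pos hd
      have h3 := hCb (bS.equivFun.symm
        (fun k => μ i * bS.repr a k % d - μ j * bS.repr a k % d)) (abv d • ε) (fun k => by
          rw [← Module.Basis.equivFun_apply, LinearEquiv.apply_symm_apply]
          exact (h k).le)
      have h4 : C * (abv d • ε) ^ n < (abv d : ℝ) ^ n := by
        rw [zsmul_eq_mul, mul_pow]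
        calc C * ((abv d : ℝ) ^ n * ε ^ n) = (abv d : ℝ) ^ n * (C * ε ^ n) := by ring
          _ < (abv d : ℝ) ^ n * 1 := mul_lt_mul_of_pos_left hεC (by positivity)
          _ = _ := mul_one _
      exact_mod_cast h3.trans_lt h4
  let F : Finset Z :=
    Finset.univ.image fun p : {p : Fin (adm.card ε ^ n).succ × Fin (adm.card ε ^ n).succ //
      p.1 ≠ p.2} => μ p.1.1 - μ p.1.2
  refine ⟨∏ m ∈ F, m, Finset.prod_ne_zero_iff.2 fun m hm => ?_, fun I hI hI0 => ?_⟩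
  · obtain ⟨p, -, rfl⟩ := Finset.mem_image.1 hm
    exact sub_ne_zero.2 fun h => p.2 (μ.injective h)
  obtain ⟨b0, hb0, hb00⟩ : ∃ b ∈ I, b ≠ 0 := by
    by_contra! h
    exact hI0 ((AddSubgroup.eq_bot_iff_forall I).2 h)
  obtain ⟨b, ⟨hb, hb0⟩, hmin⟩ := (measure fun b : S => (abv (Algebra.norm Z b)).toNat).wf.has_min
    {b | b ∈ I ∧ b ≠ 0} ⟨_, hb0, hb00⟩
  refine ⟨b, hb, hb0, fun a ha => ?_⟩
  obtain ⟨x, d, hd, hbx, hxb⟩ := exists_mul_eq_algebraMap (Z := Z) hb0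
  obtain ⟨i, j, hij, q, s, hqs, hs⟩ := happrox (x * a) d hd
  have hmem : μ i - μ j ∈ F := Finset.mem_image.2 ⟨⟨(i, j), hij⟩, Finset.mem_univ _, rfl⟩
  have h1 : algebraMap Z S d * ((μ i - μ j) • a - b * q) = b * s := by
    have h2 : b * ((μ i - μ j) • (x * a)) = b * (d • q + s) := by rw [hqs]
    rw [mul_smul_comm, ← mul_assoc, hbx, mul_add, mul_smul_comm] at h2
    rw [mul_sub, mul_smul_comm, h2, ← Algebra.smul_def, add_sub_cancel_left]
  have h3 : (μ i - μ j) • a = b * q := by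
    by_contra hne
    have h4 : (μ i - μ j) • a - b * q ∈ I := by
      refine I.sub_mem ?_ (hI b hb q)
      rw [Algebra.smul_def, Algebra.commutes]
      exact hI a ha _
    refine hmin _ ⟨h4, sub_ne_zero.2 hne⟩ ?_
    have h5 : abv d ^ n * abv (Algebra.norm Z ((μ i - μ j) • a - b * q)) =
        abv (Algebra.norm Z b) * abv (Algebra.norm Z s) := by
      rw [← map_mul abv (Algebra.norm Z b), ← map_mul (Algebra.norm Z) b s, ← h1,
        map_mul (Algebra.norm Z), Algebra.norm_algebraMap_of_basis bS, map_mul, map_pow]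
    have h6 : 0 < abv (Algebra.norm Z b) := abv.pos (Algebra.norm_ne_zero_iff.2 hb0)
    have h7 : abv (Algebra.norm Z ((μ i - μ j) • a - b * q)) < abv (Algebra.norm Z b) := by
      have h8 : 0 < abv d ^ n := pow_pos (abv.pos hd) n
      have h9 := mul_lt_mul_of_pos_left hs h6
      rw [← h5, mul_comm (abv (Algebra.norm Z b))] at h9
      exact lt_of_mul_lt_mul_left h9 h8.le
    change (abv _).toNat < (abv _).toNat
    have := abv.nonneg (Algebra.norm Z ((μ i - μ j) • a - b * q))
    omega
  refine ⟨(∏ m ∈ F.erase (μ i - μ j), m) • q, ?_⟩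
  rw [← Finset.mul_prod_erase F _ hmem, mul_comm, mul_smul, h3, mul_smul_comm]

end Approximation

/-! ### Lattices and the finiteness of class numbers -/

section Lattices

variable {k : Type*} {K : Type u} [Field k] [Field K] [Algebra k K]

/-- The class number of `A` is finite, by the theorem for finite extensions of a polynomial ring
over a finite field. Mathlib's version does not assume that the extension is separable. -/
theorem finite_classGroup_regularRing (hK : IsGlobalFunctionField k K) (infty : Place K) :
    haveI := isDedekindDomain_regularRing hK infty
    Finite (ClassGroup (regularRing infty)) := by
  classical
  have := isDedekindDomain_regularRing hK infty
  obtain ⟨ρ, hρ, hfin⟩ := exists_polynomial_finite hK infty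
  let : Algebra (Polynomial k) (regularRing infty) := ρ.toAlgebra
  have : Module.Finite (Polynomial k) (regularRing infty) := hfin
  have : FaithfulSMul (Polynomial k) (regularRing infty) :=
    (faithfulSMul_iff_algebraMap_injective _ _).2 hρ
  have : Module.Free (Polynomial k) (regularRing infty) := Module.free_of_finite_type_torsion_free'
  have := hK.finite_const
  have := Fintype.ofFinite k
  have : Infinite (Polynomial k) := inferInstance
  have : Algebra.IsAlgebraic (Polynomial k) (regularRing infty) :=
    (inferInstance : Algebra.IsIntegral (Polynomial k) (regularRing infty)).isAlgebraic
  exact @Finite.of_fintype _ (ClassGroup.fintypeOfAdmissibleOfAlgebraic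
    (Module.Free.chooseBasis (Polynomial k) (regularRing infty)) Polynomial.cardPowDegreeIsAdmissible)

/-- Since the class group of `A` is finite, there is an element of `A` whose only zero is a given
finite place. -/
theorem exists_vanishing_only_at (hK : IsGlobalFunctionField k K) {infty : Place K}
    (v : FinitePlace infty) : ∃ c : regularRing infty, c ≠ 0 ∧ v.1.1.valuation (c : K) < 1 ∧
      ∀ w : FinitePlace infty, w ≠ v → w.1.1.valuation (c : K) = 1 := by
  have := isDedekindDomain_regularRing hK infty
  have := isFractionRing_regularRing hK infty
  have := finite_classGroup_regularRing hK infty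
  have := Fintype.ofFinite (ClassGroup (regularRing infty))
  obtain ⟨P, hPv, hP⟩ := exists_heightOneSpectrum hK v
  set h := Fintype.card (ClassGroup (regularRing infty))
  have hP0 : P.asIdeal ∈ nonZeroDivisors (Ideal (regularRing infty)) :=
    mem_nonZeroDivisors_of_ne_zero P.ne_bot
  have h1 : ClassGroup.mk0 (⟨P.asIdeal, hP0⟩ ^ h) = 1 := by
    rw [map_pow]; exact pow_card_eq_one
  have h2 : (P.asIdeal ^ h).IsPrincipal :=
    (ClassGroup.mk0_eq_one_iff (pow_mem hP0 h)).1 h1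
  obtain ⟨c, hc⟩ := h2
  have hc' : P.asIdeal ^ h = Ideal.span {c} := hc
  have hh : h ≠ 0 := Fintype.card_ne_zero
  refine ⟨c, ?_, ?_, fun w hw => ?_⟩
  · rintro rfl
    rw [Ideal.span_singleton_eq_bot.2 rfl] at hc'
    exact P.ne_bot (pow_eq_zero_iff hh |>.1 hc')
  · exact (hP c).1 (Ideal.pow_le_self hh (hc' ▸ Ideal.mem_span_singleton_self c))
  · obtain ⟨Q, hQw, hQ⟩ := exists_heightOneSpectrum hK w
    refine le_antisymm ((ValuationSubring.valuation_le_one_iff _ _).2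
      (mem_regularRing.1 c.2 w)) (not_lt.1 fun hlt => ?_)
    have h3 : P.asIdeal ^ h ≤ Q.asIdeal := by
      rw [hc', Ideal.span_singleton_le_iff_mem]
      exact (hQ c).2 hlt
    have h4 : P.asIdeal ≤ Q.asIdeal := Q.isPrime.le_of_pow_le h3
    have h5 : P = Q := IsDedekindDomain.HeightOneSpectrum.ext
      ((P.isPrime.isMaximal P.ne_bot).eq_of_le Q.isPrime.ne_top h4)
    apply hw
    apply Subtype.ext
    apply Subtype.ext
    rw [← hQw, ← hPv, h5]

theorem finite_of_smul_eq_zero {A : Type*} [CommRing A] [Ring.HasFiniteQuotients A] {Q : Type*}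
    [AddCommGroup Q] [Module A Q] [Module.Finite A Q] {c : A} (hc : c ≠ 0)
    (h : ∀ x : Q, c • x = 0) : Finite Q := by
  have h1 : Module.IsTorsionBySet A Q (Ideal.span {c} : Set A) := by
    rw [← Module.isTorsionBySet_iff_is_torsion_by_span, Module.isTorsionBySet_singleton_iff]
    exact h
  let := h1.module
  have : Finite (A ⧸ Ideal.span {c}) := Ring.HasFiniteQuotients.finiteQuotient
    (by simpa using hc)
  have : IsScalarTower A (A ⧸ Ideal.span {c}) Q := h1.isScalarTower
  have : Module.Finite (A ⧸ Ideal.span {c}) Q := Module.Finite.of_restrictScalars_finite A _ _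
  exact Module.finite_of_finite (A ⧸ Ideal.span {c})

/-- There are only finitely many modules between two lattices. -/
theorem finite_setOf_le_and_le {A : Type*} [CommRing A] [Ring.HasFiniteQuotients A] {D : Type*}
    [AddCommGroup D] [Module A D] {N N' : Submodule A D} (hN' : N'.FG) {c : A} (hc : c ≠ 0)
    (h : ∀ x ∈ N', c • x ∈ N) : {J : Submodule A D | N ≤ J ∧ J ≤ N'}.Finite := by
  have : Module.Finite A N' := Module.Finite.iff_fg.2 hN'
  let N₁ := N.comap N'.subtype
  have : Finite (N' ⧸ N₁) := finite_of_smul_eq_zero hc fun x => by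
    obtain ⟨x, rfl⟩ := N₁.mkQ_surjective x
    rw [← map_smul]
    exact (Submodule.Quotient.mk_eq_zero _).2 (h x.1 x.2)
  refine Set.Finite.of_injOn (f := fun J : Submodule A D => (N₁.mkQ '' (J.comap N'.subtype : Set N')))
    (t := Set.univ) (fun _ _ => Set.mem_univ _) ?_ Set.finite_univ
  have key : ∀ J₁ J₂ : Submodule A D, J₁ ≤ N' → N ≤ J₂ →
      N₁.mkQ '' (J₁.comap N'.subtype : Set N') = N₁.mkQ '' (J₂.comap N'.subtype : Set N') →
      J₁ ≤ J₂ := by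
    intro J₁ J₂ h1 h2 he x hx
    have : N₁.mkQ ⟨x, h1 hx⟩ ∈ N₁.mkQ '' (J₂.comap N'.subtype : Set N') :=
      he ▸ ⟨⟨x, h1 hx⟩, hx, rfl⟩
    obtain ⟨y, hy, hyx⟩ := this
    have h3 : (y - ⟨x, h1 hx⟩ : N') ∈ N₁ := (Submodule.Quotient.eq _).1 hyx
    have h4 : (y : D) - x ∈ J₂ := h2 h3
    have := J₂.sub_mem (show (y : D) ∈ J₂ from hy) h4
    rwa [sub_sub_cancel] at this
  intro J₁ h1 J₂ h2 he
  exact le_antisymm (key _ _ h1.2 h2.1 he) (key _ _ h2.2 h1.1 he.symm)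

variable {D : Type w} [Ring D] [Algebra K D]

theorem smul_mem_of_coe {infty : Place K} (I : Submodule (regularRing infty) D)
    (s : regularRing infty) {x : D} (hx : x ∈ I) : (s : K) • x ∈ I :=
  I.smul_mem s hx

theorem exists_smul_mem_of_span_eq_top (hK : IsGlobalFunctionField k K) {infty : Place K}
    {N : Submodule (regularRing infty) D} (hN : Submodule.span K (N : Set D) = ⊤) (x : D) :
    ∃ s : regularRing infty, s ≠ 0 ∧ s • x ∈ N := by
  have := isFractionRing_regularRing hK infty
  have hx : x ∈ Submodule.span K (N : Set D) := hN ▸ Submodule.mem_top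
  induction hx using Submodule.span_induction with
  | mem x hx => exact ⟨1, one_ne_zero, by simpa using hx⟩
  | zero => exact ⟨1, one_ne_zero, by simp⟩
  | add x y _ _ hx hy =>
    obtain ⟨s, hs, hsx⟩ := hx
    obtain ⟨t, ht, hty⟩ := hy
    refine ⟨s * t, mul_ne_zero hs ht, ?_⟩
    rw [smul_add]
    refine N.add_mem ?_ ?_
    · rw [mul_comm, mul_smul]; exact N.smul_mem _ hsx
    · rw [mul_smul]; exact N.smul_mem _ hty
  | smul a x _ hx =>
    obtain ⟨s, hs, hsx⟩ := hx
    obtain ⟨t, ht⟩ := IsLocalization.exist_integer_multiples_of_finset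
      (nonZeroDivisors (regularRing infty)) {a}
    obtain ⟨c, hc⟩ := ht a (Finset.mem_singleton_self a)
    refine ⟨t * s, mul_ne_zero (nonZeroDivisors.ne_zero t.2) hs, ?_⟩
    have : ((t : regularRing infty) * s) • a • x = c • s • x := by
      simp only [mul_smul]
      rw [smul_comm s a x, ← smul_assoc (t : regularRing infty) a, ← hc, algebraMap_smul]
    rw [this]
    exact N.smul_mem _ hsx

theorem exists_forall_smul_mem (hK : IsGlobalFunctionField k K) {infty : Place K}
    {N J : Submodule (regularRing infty) D} (hJ : J.FG)
    (hN : Submodule.span K (N : Set D) = ⊤) :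
    ∃ s : regularRing infty, s ≠ 0 ∧ ∀ x ∈ J, s • x ∈ N := by
  obtain ⟨S, rfl⟩ := hJ
  choose f hf0 hf using exists_smul_mem_of_span_eq_top hK hN
  refine ⟨∏ x ∈ S, f x, Finset.prod_ne_zero_iff.2 fun x _ => hf0 x, fun x hx => ?_⟩
  have h : Submodule.span (regularRing infty) (S : Set D) ≤
      N.comap (LinearMap.lsmul (regularRing infty) D (∏ x ∈ S, f x)) := by
    refine Submodule.span_le.2 fun x hx => ?_
    classical
    change (∏ x ∈ S, f x) • x ∈ N
    rw [← Finset.prod_erase_mul S f hx, mul_smul]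
    exact N.smul_mem _ (hf x)
  exact h hx

theorem span_eq_top_of_forall_smul_mem {infty : Place K}
    {N J : Submodule (regularRing infty) D} (hN : Submodule.span K (N : Set D) = ⊤)
    {s : regularRing infty} (hs : s ≠ 0) (h : ∀ x ∈ N, s • x ∈ J) :
    Submodule.span K (J : Set D) = ⊤ := by
  rw [eq_top_iff, ← hN, Submodule.span_le]
  intro x hx
  have h1 : (s : K) ≠ 0 := fun h => hs (Subtype.ext h)
  have h2 : x = (s : K)⁻¹ • (s • x) := by
    rw [Subring.smul_def, smul_smul, inv_mul_cancel₀ h1, one_smul]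
  rw [h2]
  exact Submodule.smul_mem _ _ (Submodule.subset_span (h x hx))

/-- The right ideal `u I`. -/
def RightIdeal.leftMul {infty : Place K} {R : Subalgebra (regularRing infty) D} (u : Dˣ)
    (I : RightIdeal R) : RightIdeal R where
  carrier := I.carrier.map (LinearMap.mulLeft (regularRing infty) (u : D))
  fg := I.fg.map _
  span_eq_top := by
    rw [Submodule.map_coe]
    have h1 : ((LinearMap.mulLeft (regularRing infty) (u : D)) '' (I.carrier : Set D)) =
      (LinearMap.mulLeft K (u : D)) '' (I.carrier : Set D) := rfl
    rw [h1, ← Submodule.map_span, I.span_eq_top, Submodule.map_top, LinearMap.range_eq_top]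
    exact fun x => ⟨(u⁻¹ : Dˣ) * x, Units.mul_inv_cancel_left u x⟩
  mul_mem := by
    rintro _ ⟨x, hx, rfl⟩ r hr
    exact ⟨x * r, I.mul_mem _ hx _ hr, (mul_assoc _ _ _).symm⟩

theorem RightIdeal.mem_leftMul {infty : Place K} {R : Subalgebra (regularRing infty) D} {u : Dˣ}
    {I : RightIdeal R} {x : D} : x ∈ (I.leftMul u).carrier ↔ (u⁻¹ : Dˣ) * x ∈ I.carrier := by
  constructor
  · rintro ⟨y, hy, rfl⟩
    rw [LinearMap.mulLeft_apply, Units.inv_mul_cancel_left]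
    exact hy
  · exact fun h => ⟨_, h, Units.mul_inv_cancel_left u x⟩

variable [FiniteDimensional K D]

/-- A definite algebra is a division algebra, since it is contained in its completion at `infty`. -/
theorem IsDefinite.isUnit {infty : Place K} (hD : IsDefinite D infty) {x : D} (hx : x ≠ 0) :
    IsUnit x := by
  have hinj : Function.Injective (fun x : D => (1 : Compl infty) ⊗ₜ[K] x) :=
    Algebra.TensorProduct.includeRight_injective (algebraMap K (Compl infty)).injective
  have h0 : ∀ y : D, (1 : Compl infty) ⊗ₜ[K] y = 0 → y = 0 := fun y hy => hinj (by simpa using hy)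
  have h1 := hD (1 ⊗ₜ x) fun h => hx (h0 x h)
  have h2 : Function.Injective (LinearMap.mulLeft K x) := by
    rw [← LinearMap.ker_eq_bot, LinearMap.ker_eq_bot']
    intro y hy
    apply h0
    apply h1.mul_right_eq_zero.1
    rw [Algebra.TensorProduct.tmul_mul_tmul, one_mul]
    rw [show x * y = 0 from hy, TensorProduct.tmul_zero]
  obtain ⟨y, hy⟩ := (LinearMap.injective_iff_surjective.1 h2) 1
  have hy' : x * y = 1 := hy
  refine isUnit_iff_exists.2 ⟨y, hy', h2 ?_⟩
  change x * (y * x) = x * 1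
  rw [← mul_assoc, hy', one_mul, mul_one]

theorem IsDefinite.noZeroDivisors {infty : Place K} (hD : IsDefinite D infty) :
    NoZeroDivisors D where
  eq_zero_or_eq_zero_of_mul_eq_zero {a b} h := by
    by_contra! hab
    exact hab.2 ((hD.isUnit hab.1).mul_right_eq_zero.1 h)

/-- Up to a bounded scalar of `A` every nonzero right ideal of an order in a definite algebra is
principal. The scalar is found in a polynomial ring over which `A` is finite. -/
theorem exists_forall_smul_eq_mul_of_isOrder [Nontrivial D] (hK : IsGlobalFunctionField k K) {infty : Place K}
    (hD : IsDefinite D infty) {R : Subalgebra (regularRing infty) D} (hR : IsOrder R) :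
    ∃ c : regularRing infty, c ≠ 0 ∧ ∀ I : AddSubgroup R, (∀ a ∈ I, ∀ r, a * r ∈ I) → I ≠ ⊥ →
      ∃ b ∈ I, b ≠ 0 ∧ ∀ a ∈ I, ∃ d, c • a = b * d := by
  have := hD.noZeroDivisors
  have : IsDomain D := NoZeroDivisors.to_isDomain D
  have := hK.finite_const
  have := Fintype.ofFinite k
  have := hasFiniteQuotients_regularRing hK infty
  obtain ⟨ρ, hρ, hfin⟩ := exists_polynomial_finite hK infty
  let : Algebra (Polynomial k) (regularRing infty) := ρ.toAlgebra
  have : Module.Finite (Polynomial k) (regularRing infty) := hfin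
  let : Algebra (Polynomial k) R := Algebra.compHom R ρ
  have : IsScalarTower (Polynomial k) (regularRing infty) R := ⟨fun a b c => by
    change (ρ a * b) • c = ρ a • (b • c)
    rw [mul_smul]⟩
  have : Module.Finite (regularRing infty) R := Module.Finite.iff_fg.2 hR.fg
  have : Module.Finite (Polynomial k) R := Module.Finite.trans (regularRing infty) R
  have hne : ∀ s : regularRing infty, s ≠ 0 → (s : K) ≠ 0 := fun s hs h => hs (Subtype.ext h)
  have : FaithfulSMul (Polynomial k) R := by
    refine (faithfulSMul_iff_algebraMap_injective _ _).2 ((injective_iff_map_eq_zero _).2 ?_)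
    intro p hp
    by_contra hp0
    have h1 : ρ p ≠ 0 := fun h => hp0 (hρ (by rw [h, map_zero]))
    have h2 : ((ρ p : regularRing infty) : K) • (1 : D) = 0 := by
      rw [Algebra.algebraMap_eq_smul_one] at hp
      exact congrArg (fun r : R => (r : D)) hp
    exact (smul_ne_zero (hne _ h1) one_ne_zero) h2
  have : Module.Free (Polynomial k) R := Module.free_of_finite_type_torsion_free'
  obtain ⟨M, hM0, hM⟩ := exists_forall_smul_eq_mul (Z := Polynomial k) (S := R)
    Polynomial.cardPowDegreeIsAdmissible
  exact ⟨ρ M, fun h => hM0 (hρ (by rw [h, map_zero])), hM⟩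

/-- Every right ideal class contains an ideal between `R` and `c⁻¹ R`, for a fixed nonzero `c`. -/
theorem exists_forall_isLeftMul [Nontrivial D] (hK : IsGlobalFunctionField k K) {infty : Place K}
    (hD : IsDefinite D infty) {R : Subalgebra (regularRing infty) D} (hR : IsOrder R) :
    ∃ c : regularRing infty, c ≠ 0 ∧ ∀ I : RightIdeal R, ∃ J : RightIdeal R,
      (∃ a : Dˣ, IsLeftMul a I.carrier J.carrier) ∧ Subalgebra.toSubmodule R ≤ J.carrier ∧
        ∀ x ∈ J.carrier, c • x ∈ R := by
  have hne : ∀ s : regularRing infty, s ≠ 0 → (s : K) ≠ 0 := fun s hs h => hs (Subtype.ext h)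
  obtain ⟨c, hc, hM⟩ := exists_forall_smul_eq_mul_of_isOrder hK hD hR
  refine ⟨c, hc, fun I => ?_⟩
  obtain ⟨s, hs, hsI⟩ := exists_forall_smul_mem hK I.fg (N := Subalgebra.toSubmodule R)
    hR.span_eq_top
  let I' : AddSubgroup R :=
    { carrier := {x | ∃ y ∈ I.carrier, (x : D) = s • y}
      zero_mem' := ⟨0, I.carrier.zero_mem, by simp⟩
      add_mem' := by
        rintro a b ⟨y, hy, hay⟩ ⟨z, hz, hbz⟩
        exact ⟨y + z, I.carrier.add_mem hy hz, by simp [hay, hbz]⟩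
      neg_mem' := by
        rintro a ⟨y, hy, hay⟩
        exact ⟨-y, I.carrier.neg_mem hy, by simp [hay]⟩ }
  have hs0 := hne s hs
  obtain ⟨y, hy, hy0⟩ : ∃ y ∈ I.carrier, y ≠ 0 := by
    by_contra! h
    have h1 : I.carrier = ⊥ := (Submodule.eq_bot_iff _).2 h
    have h2 := I.span_eq_top
    rw [h1] at h2
    simp at h2
  obtain ⟨b, ⟨b', hb', hbb'⟩, hb0, hbM⟩ := hM I'
    (by
      rintro a ⟨y, hy, hay⟩ r
      exact ⟨y * r, I.mul_mem y hy r r.2, by simp [hay]⟩)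
    (fun h => by
      have h1 : (⟨s • y, hsI y hy⟩ : R) ∈ I' := ⟨y, hy, rfl⟩
      rw [h] at h1
      have h2 : (s : K) • y = 0 := congrArg Subtype.val ((AddSubgroup.mem_bot).1 h1)
      exact smul_ne_zero hs0 hy0 h2)
  have hb0' : b' ≠ 0 := by
    rintro rfl
    exact hb0 (Subtype.ext (by simpa using hbb'))
  obtain ⟨u, rfl⟩ := hD.isUnit hb0'
  have hle : ∀ z ∈ I.carrier, c • (((u⁻¹ : Dˣ) : D) * z) ∈ R := by
    intro z hz
    obtain ⟨d, hd⟩ := hbM ⟨s • z, hsI z hz⟩ ⟨z, hz, rfl⟩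
    have h1 : (c : K) • (s : K) • z = ((s : K) • (u : D)) * d := by
      have h2 := congrArg (fun r : R => (r : D)) hd
      have h3 : ((c • (⟨s • z, hsI z hz⟩ : R) : R) : D) = (c : K) • (s : K) • z := rfl
      simp only [h3] at h2
      rw [h2, MulMemClass.coe_mul, hbb']
      rfl
    have h2 : c • (((u⁻¹ : Dˣ) : D) * z) = d := by
      have h4 : (s : K) • (c : K) • z = (s : K) • ((u : D) * d) := by
        rw [smul_comm, h1, smul_mul_assoc]
      have h5 := (smul_right_injective D hs0) h4
      change (c : K) • (((u⁻¹ : Dˣ) : D) * z) = d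
      rw [← mul_smul_comm, h5, ← mul_assoc, Units.inv_mul, one_mul]
    rw [h2]
    exact d.2
  refine ⟨I.leftMul u⁻¹, ⟨u⁻¹, rfl⟩, fun x hx => ?_, ?_⟩
  · rw [RightIdeal.mem_leftMul, inv_inv]
    exact I.mul_mem _ hb' _ hx
  · rintro _ ⟨x, hx, rfl⟩
    exact hle x hx

/-- The number of right ideal classes of an order is finite. -/
theorem finite_rightIdealClass [Nontrivial D] (hK : IsGlobalFunctionField k K) {infty : Place K}
    (hD : IsDefinite D infty) {R : Subalgebra (regularRing infty) D} (hR : IsOrder R) :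
    Finite (RightIdealClass R) := by
  have := hasFiniteQuotients_regularRing hK infty
  obtain ⟨c, hc, hM⟩ := exists_forall_isLeftMul hK hD hR
  have hc0 : (c : K) ≠ 0 := fun h => hc (Subtype.ext h)
  let N' : Submodule (regularRing infty) D := (Subalgebra.toSubmodule R).map
    (((c : K)⁻¹ • (LinearMap.id : D →ₗ[K] D)).restrictScalars (regularRing infty))
  have hN' : ∀ x, c • x ∈ R → x ∈ N' := fun x hx => ⟨c • x, hx, by
    change (c : K)⁻¹ • (c : K) • x = x
    rw [smul_smul, inv_mul_cancel₀ hc0, one_smul]⟩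
  have hfinite := finite_setOf_le_and_le (N := Subalgebra.toSubmodule R) (hR.fg.map _ : N'.FG) hc
    (by
      rintro _ ⟨y, hy, rfl⟩
      change (c : K) • (c : K)⁻¹ • y ∈ R
      rwa [smul_smul, mul_inv_cancel₀ hc0, one_smul])
  choose f hf hf₁ hf₂ using hM
  have := hfinite.to_subtype
  refine Finite.of_injective (fun q : RightIdealClass R =>
    (⟨(f q.out).carrier, ⟨hf₁ _, fun x hx => hN' x (hf₂ _ x hx)⟩⟩ : {J | Subalgebra.toSubmodule R ≤ J ∧ J ≤ N'})) ?_
  intro q q' h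
  have h1 : (f q.out).carrier = (f q'.out).carrier := congrArg Subtype.val h
  rw [← q.out_eq, ← q'.out_eq]
  obtain ⟨a, ha⟩ := hf q.out
  obtain ⟨b, hb⟩ := hf q'.out
  rw [h1] at ha
  exact Quotient.sound ⟨_, ha.trans hb.symm⟩

end Lattices

/-! ### Completions at the finite places -/

section HenselianBase

/-- The properties of the valuation ring `O` of a local field `F` on which the local theory rests.
The condition `coeff_mem` is the form of Hensel's lemma that makes the valuation of `F` extend
to finite-dimensional division algebras. -/
structure IsLocalFieldBase {F : Type*} [Field F] (O : Subring F) : Prop where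
  mem_or_inv_mem : ∀ x : F, x ∈ O ∨ x⁻¹ ∈ O
  coeff_mem : ∀ p : Polynomial F, p.Monic → Irreducible p → p.coeff 0 ∈ O → ∀ i, p.coeff i ∈ O
  hasFiniteQuotients : Ring.HasFiniteQuotients O
  exists_pow_mul_mem : ∃ ϖ ∈ O, ϖ ≠ 0 ∧ ϖ⁻¹ ∉ O ∧ ∀ x : F, ∃ n : ℕ, ϖ ^ n * x ∈ O

end HenselianBase

section Completion

variable {K : Type u} [Field K]

theorem valued_algebraMap (v : Place K) (x : K) :
    Valued.v (algebraMap K (Compl v) x) = v.1.valuation x := by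
  rw [algebraMap_compl, Valued.valuedCompletion_apply]
  rfl

/-- `K` is dense in its completion. -/
theorem exists_valued_sub_lt (v : Place K) (x : Compl v) {c : Compl v} (hc : c ≠ 0) :
    ∃ y : K, Valued.v (x - algebraMap K (Compl v) y) < Valued.v c := by
  have h1 : IsOpen {z : Compl v | Valued.v (x - z) < Valued.v c} := by
    have h2 := (Valued.isOpen_ball (Compl v) (Γ₀ := v.1.ValueGroup)
      ((Valued.v : Valuation (Compl v) v.1.ValueGroup).restrict c)).preimage
      (continuous_const.sub continuous_id : Continuous fun z : Compl v => x - z)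
    convert h2 using 1
    ext z
    exact ((Valued.v : Valuation (Compl v) v.1.ValueGroup).restrict_lt_iff).symm
  obtain ⟨y, hy⟩ := (UniformSpace.Completion.denseRange_coe
    (α := WithVal v.1.valuation)).exists_mem_open h1 ⟨x, by
      change Valued.v (x - x) < Valued.v c
      rw [sub_self, map_zero]
      exact zero_lt_iff.2 ((Valuation.ne_zero_iff _).2 hc)⟩
  exact ⟨WithVal.ofVal y, hy⟩

theorem exists_valued_eq (v : Place K) (x : Compl v) : ∃ y : K, v.1.valuation y = Valued.v x := by
  rcases eq_or_ne x 0 with rfl | hx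
  · exact ⟨0, by simp⟩
  obtain ⟨y, hy⟩ := exists_valued_sub_lt v x hx
  refine ⟨y, ?_⟩
  rw [← valued_algebraMap, ← Valuation.map_sub_eq_of_lt_left _ hy, sub_sub_cancel]

theorem algebraMap_mem_complInt {v : Place K} {x : K} :
    algebraMap K (Compl v) x ∈ complInt v ↔ x ∈ v.1 := by
  rw [Valuation.mem_integer_iff, valued_algebraMap, ValuationSubring.valuation_le_one_iff]

variable {k : Type*} [Field k] [Algebra k K]

theorem exists_pow_mul_mem_complInt (hK : IsGlobalFunctionField k K) {infty : Place K}
    (v : FinitePlace infty) {y : K} (hy : v.1.1.valuation y < 1) (x : Compl v.1) :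
    ∃ d : ℕ, ∀ e ≥ d, algebraMap K (Compl v.1) y ^ e * x ∈ complInt v.1 := by
  obtain ⟨z, hz⟩ := exists_valued_eq v.1 x
  obtain ⟨d, hd⟩ := exists_pow_mul_mem hK v hy z
  refine ⟨d, fun e he => ?_⟩
  rw [Valuation.mem_integer_iff, map_mul, ← hz, ← map_pow, valued_algebraMap, ← map_mul,
    ValuationSubring.valuation_le_one_iff]
  exact hd e he

/-- `A` is dense in `O_v`. -/
theorem exists_regularRing_sub_eq_mul (hK : IsGlobalFunctionField k K) {infty : Place K}
    (v : FinitePlace infty) {x : Compl v.1} (hx : x ∈ complInt v.1) {c : Compl v.1} (hc : c ≠ 0) :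
    ∃ a : regularRing infty, ∃ z ∈ complInt v.1, x - algebraMap K (Compl v.1) a = c * z := by
  -- it suffices to find `a` with `v (x - a) ≤ v (c)`
  suffices h : ∃ a : regularRing infty, Valued.v (x - algebraMap K (Compl v.1) a) ≤ Valued.v c by
    obtain ⟨a, ha⟩ := h
    refine ⟨a, c⁻¹ * (x - algebraMap K (Compl v.1) a), ?_, by rw [mul_inv_cancel_left₀ hc]⟩
    rw [Valuation.mem_integer_iff, map_mul, map_inv₀]
    exact inv_mul_le_one_of_le₀ ha zero_le
  wlog hc1 : Valued.v c ≤ 1 generalizing c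
  · obtain ⟨a, ha⟩ := this one_ne_zero (by rw [map_one])
    exact ⟨a, ha.trans (by rw [map_one]; exact (not_le.1 hc1).le)⟩
  obtain ⟨y, hy⟩ := exists_valued_sub_lt v.1 x hc
  have hyv : y ∈ v.1.1 := by
    rw [← algebraMap_mem_complInt, ← sub_sub_cancel x (algebraMap K (Compl v.1) y)]
    exact Subring.sub_mem _ hx (hy.le.trans hc1)
  obtain ⟨s, hs, hys⟩ := exists_mul_mem_regularRing hK v hyv
  obtain ⟨ϖ, hϖ0, hϖ, hϖw⟩ := exists_vanishing_only_at hK v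
  obtain ⟨d, hd⟩ := exists_pow_mul_mem_complInt hK v hϖ c⁻¹
  have h1 : (1 : regularRing infty) ∈ Ideal.span {s, ϖ ^ d} := by
    refine one_mem_of_forall_exists_valuation_eq_one hK _ fun w => ?_
    rcases eq_or_ne w v with rfl | hw
    · exact ⟨s, Ideal.subset_span (by simp), hs⟩
    · exact ⟨ϖ ^ d, Ideal.subset_span (by simp), by simp [hϖw w hw]⟩
  obtain ⟨t, u, htu⟩ := Ideal.mem_span_pair.1 h1
  have h2 : (t : K) * s + u * (ϖ : K) ^ d = 1 := by exact_mod_cast congrArg Subtype.val htu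
  refine ⟨⟨y * s, hys⟩ * t, ?_⟩
  have h3 : x - algebraMap K (Compl v.1) (y * s * t) =
      (x - algebraMap K (Compl v.1) y) + algebraMap K (Compl v.1) (y * u * (ϖ : K) ^ d) := by
    rw [sub_add, ← map_sub]
    congr 2
    linear_combination y * h2
  change Valued.v (x - algebraMap K (Compl v.1) (y * s * t)) ≤ _
  rw [h3]
  refine Valuation.map_add_le _ hy.le ?_
  have h4 : Valued.v (algebraMap K (Compl v.1) ϖ ^ d * c⁻¹) ≤ 1 := hd d le_rfl
  rw [map_mul, map_inv₀, mul_inv_le_iff₀ (zero_lt_iff.2 ((Valuation.ne_zero_iff _).2 hc)),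
    one_mul] at h4
  rw [map_mul, map_mul, map_pow]
  refine (mul_le_of_le_one_left' ?_).trans h4
  rw [valued_algebraMap, ValuationSubring.valuation_le_one_iff]
  exact mul_mem hyv (mem_regularRing.1 u.2 v)

/-- The quotients of `O_v` are quotients of `A`, because `A` is dense. -/
theorem hasFiniteQuotients_complInt (hK : IsGlobalFunctionField k K) {infty : Place K}
    (v : FinitePlace infty) : Ring.HasFiniteQuotients (complInt v.1) where
  finiteQuotient {I} hI := by
    obtain ⟨c, hcI, hc⟩ := Submodule.exists_mem_ne_zero_of_ne_bot hI
    have hc' : (c : Compl v.1) ≠ 0 := fun h => hc (Subtype.ext h)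
    have := hasFiniteQuotients_regularRing hK infty
    let f : regularRing infty →+* complInt v.1 ⧸ I := (Ideal.Quotient.mk I).comp
      (((algebraMap K (Compl v.1)).comp (regularRing infty).subtype).codRestrict (complInt v.1)
        fun a => algebraMap_mem_complInt.2 (mem_regularRing.1 a.2 v))
    have hf : Function.Surjective f := by
      intro q
      obtain ⟨x, rfl⟩ := Ideal.Quotient.mk_surjective q
      obtain ⟨a, z, hz, ha⟩ := exists_regularRing_sub_eq_mul hK v x.2 hc'
      refine ⟨a, (Ideal.Quotient.eq.2 ?_).symm⟩
      have h1 : x - (((algebraMap K (Compl v.1)).comp (regularRing infty).subtype).codRestrict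
        (complInt v.1) fun a => algebraMap_mem_complInt.2 (mem_regularRing.1 a.2 v)) a =
          c * ⟨z, hz⟩ := Subtype.ext ha
      rw [h1]
      exact I.mul_mem_right _ hcI
    have hker : RingHom.ker f ≠ ⊥ := by
      obtain ⟨ϖ, hϖ0, hϖ, -⟩ := exists_vanishing_only_at hK v
      obtain ⟨d, hd⟩ := exists_pow_mul_mem_complInt hK v hϖ (c : Compl v.1)⁻¹
      refine (Submodule.ne_bot_iff _).2 ⟨ϖ ^ d, ?_, pow_ne_zero d hϖ0⟩
      refine Ideal.Quotient.eq_zero_iff_mem.2 ?_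
      have h1 : (((algebraMap K (Compl v.1)).comp (regularRing infty).subtype).codRestrict
        (complInt v.1) fun a => algebraMap_mem_complInt.2 (mem_regularRing.1 a.2 v)) (ϖ ^ d) =
          c * ⟨_, hd d le_rfl⟩ := by
        apply Subtype.ext
        change algebraMap K (Compl v.1) (((ϖ ^ d : regularRing infty) : K)) =
          c * (algebraMap K (Compl v.1) ϖ ^ d * (c : Compl v.1)⁻¹)
        rw [mul_left_comm, mul_inv_cancel₀ hc', mul_one, ← map_pow]
        rfl
      rw [h1]
      exact I.mul_mem_right _ hcI
    have := Ring.HasFiniteQuotients.finiteQuotient hker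
    exact Finite.of_equiv _ (RingHom.quotientKerEquivOfSurjective hf).toEquiv

theorem mulArchimedean_valueGroup (hK : IsGlobalFunctionField k K) {infty : Place K}
    (v : FinitePlace infty) : MulArchimedean v.1.1.ValueGroup where
  arch x y hy := by
    obtain ⟨a, rfl⟩ := v.1.1.valuation_surjective x
    obtain ⟨b, rfl⟩ := v.1.1.valuation_surjective y
    have hb : 0 < v.1.1.valuation b := zero_lt_one.trans hy
    have h1 : v.1.1.valuation b⁻¹ < 1 := by rw [map_inv₀]; exact inv_lt_one_of_one_lt₀ hy
    obtain ⟨d, hd⟩ := exists_pow_mul_mem hK v h1 a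
    refine ⟨d, ?_⟩
    have h2 := (ValuationSubring.valuation_le_one_iff _ _).2 (hd d le_rfl)
    rw [map_mul, map_pow, map_inv₀, inv_pow, inv_mul_le_one₀ (pow_pos hb d)] at h2
    exact h2

theorem nonempty_rankOne (hK : IsGlobalFunctionField k K) {infty : Place K}
    (v : FinitePlace infty) : Nonempty (Valued.v : Valuation (Compl v.1) _).RankOne := by
  have := mulArchimedean_valueGroup hK v
  obtain ⟨ϖ, hϖ0, hϖ, -⟩ := exists_vanishing_only_at hK v
  have : (Valued.v : Valuation (Compl v.1) v.1.1.ValueGroup).IsNontrivial := by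
    refine ⟨⟨algebraMap K (Compl v.1) ϖ, ?_, ?_⟩⟩
    · rw [valued_algebraMap]
      exact (Valuation.ne_zero_iff _).2 fun h => hϖ0 (Subtype.ext h)
    · rw [valued_algebraMap]
      exact hϖ.ne
  rw [Valuation.nonempty_rankOne_iff_mulArchimedean]
  exact MulArchimedean.comap (MonoidWithZeroHom.ValueGroup₀.embedding
    (f := .ofClass (Valued.v : Valuation (Compl v.1) v.1.1.ValueGroup))).toMonoidHom
    MonoidWithZeroHom.ValueGroup₀.embedding_strictMono

/-- A monic irreducible polynomial over a complete field has integral coefficients as soon as its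
constant coefficient is integral: its spectral norm is a power of the norm of that coefficient. -/
theorem coeff_mem_complInt (hK : IsGlobalFunctionField k K) {infty : Place K}
    (v : FinitePlace infty) {p : Polynomial (Compl v.1)} (hp : p.Monic) (hirr : Irreducible p)
    (h0 : p.coeff 0 ∈ complInt v.1) (i : ℕ) : p.coeff i ∈ complInt v.1 := by
  obtain ⟨hrank⟩ := nonempty_rankOne hK v
  let _ : NontriviallyNormedField (Compl v.1) :=
    Valued.toNontriviallyNormedField (L := Compl v.1) (Γ₀ := v.1.1.ValueGroup)
  have : IsUltrametricDist (Compl v.1) := inferInstance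
  have : CompleteSpace (Compl v.1) := inferInstance
  have hle : ∀ x : Compl v.1, x ∈ complInt v.1 ↔ ‖x‖ ≤ 1 := fun x =>
    (Valued.toNormedField.norm_le_one_iff (L := Compl v.1) (Γ₀ := v.1.1.ValueGroup)
      (x := x)).symm
  have : Fact (Irreducible p) := ⟨hirr⟩
  have h1 : minpoly (Compl v.1) (AdjoinRoot.root p) = p := by
    rw [AdjoinRoot.minpoly_root hirr.ne_zero, hp.leadingCoeff]
    simp
  have : FiniteDimensional (Compl v.1) (AdjoinRoot p) :=
    (AdjoinRoot.powerBasis hirr.ne_zero).finite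
  have h2 := spectralNorm.spectralNorm_eq_norm_coeff_zero_rpow (Compl v.1) (AdjoinRoot p)
    (AdjoinRoot.root p)
  have h3 : spectralNorm (Compl v.1) (AdjoinRoot p) (AdjoinRoot.root p) ≤ 1 := by
    rw [h2, h1]
    exact Real.rpow_le_one (norm_nonneg _) ((hle _).1 h0) (by positivity)
  rw [spectralNorm, h1, spectralValue_le_one_iff hp] at h3
  exact (hle _).2 (h3 i)

theorem isLocalFieldBase_complInt (hK : IsGlobalFunctionField k K) {infty : Place K}
    (v : FinitePlace infty) : IsLocalFieldBase (complInt v.1) where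
  mem_or_inv_mem x := by
    rw [Valuation.mem_integer_iff, Valuation.mem_integer_iff]
    exact Valuation.val_le_one_or_val_inv_le_one _ x
  coeff_mem p hp hirr h0 i := coeff_mem_complInt hK v hp hirr h0 i
  hasFiniteQuotients := hasFiniteQuotients_complInt hK v
  exists_pow_mul_mem := by
    obtain ⟨ϖ, hϖ0, hϖ, -⟩ := exists_vanishing_only_at hK v
    have h0 : (ϖ : K) ≠ 0 := fun h => hϖ0 (Subtype.ext h)
    refine ⟨algebraMap K (Compl v.1) ϖ, algebraMap_mem_complInt.2 (mem_regularRing.1 ϖ.2 v),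
      fun h => h0 ((algebraMap K (Compl v.1)).injective (by rw [h, map_zero])), ?_, fun x => ?_⟩
    · rw [← map_inv₀, algebraMap_mem_complInt, ← ValuationSubring.valuation_le_one_iff, map_inv₀,
        not_le]
      exact (one_lt_inv₀ (zero_lt_iff.2 ((Valuation.ne_zero_iff _).2 h0))).2 hϖ
    · obtain ⟨d, hd⟩ := exists_pow_mul_mem_complInt hK v hϖ x
      exact ⟨d, hd d le_rfl⟩

end Completion

/-! ### Division algebras over local fields -/

section DivisionAlgebra

variable {F : Type*} [Field F] {O : Subring F}

theorem IsLocalFieldBase.mem_of_isIntegral (hO : IsLocalFieldBase O) {x : F} (hx : IsIntegral O x) :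
    x ∈ O := by
  let O' : ValuationSubring F := { O with mem_or_inv_mem' := hO.mem_or_inv_mem }
  have h : IsIntegral O' x := hx
  obtain ⟨y, hy⟩ := IsIntegrallyClosed.isIntegral_iff.1 h
  exact hy ▸ y.2

variable {Δ : Type*} [DivisionRing Δ] [Algebra F Δ]

theorem isIntegral_one_add {x : Δ} (hx : IsIntegral O x) : IsIntegral O (1 + x) := by
  obtain ⟨p, hp, h⟩ := hx
  refine ⟨p.comp (Polynomial.X - Polynomial.C 1), hp.comp (Polynomial.monic_X_sub_C 1)
    (by rw [Polynomial.natDegree_X_sub_C]; exact one_ne_zero), ?_⟩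
  rw [← Polynomial.aeval_def] at h ⊢
  rw [Polynomial.aeval_comp]
  simpa using h

/-- An integral element whose inverse stabilises a module stabilises it as well. -/
theorem inv_smul_mem_of_isIntegral {M : Type*} [AddCommGroup M] [Module Δ M] [Module O M]
    [IsScalarTower O Δ M] {N : Submodule O M} {w : Δ} (hw : w ≠ 0) (hint : IsIntegral O w⁻¹)
    (h : ∀ x ∈ N, w • x ∈ N) : ∀ x ∈ N, w⁻¹ • x ∈ N := by
  obtain ⟨p, hp, h0⟩ := hint
  set n := p.natDegree
  rcases Nat.eq_zero_or_pos n with hn | hn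
  · rw [Polynomial.eq_one_of_monic_natDegree_zero hp hn] at h0
    simp at h0
  have hpow : ∀ m : ℕ, ∀ x ∈ N, w ^ m • x ∈ N := by
    intro m
    induction m with
    | zero => intro x hx; simpa using hx
    | succ m ih => intro x hx; rw [pow_succ', mul_smul]; exact h _ (ih x hx)
  -- multiply the equation of `w⁻¹` by `w ^ (n - 1)`
  have h1 : w⁻¹ = - ∑ i ∈ Finset.range n, p.coeff i • w ^ (n - 1 - i) := by
    rw [Polynomial.eval₂_eq_sum_range, Finset.sum_range_succ, hp.coeff_natDegree, map_one,
      one_mul] at h0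
    have h2 : w⁻¹ = w⁻¹ ^ n * w ^ (n - 1) := by
      obtain ⟨m, hm⟩ := Nat.exists_eq_succ_of_ne_zero hn.ne'
      rw [hm, Nat.succ_sub_one, pow_succ', mul_assoc, ← (Commute.refl w).inv_left₀.mul_pow,
        inv_mul_cancel₀ hw, one_pow, mul_one]
    have h3 : w⁻¹ ^ n = - ∑ i ∈ Finset.range n, algebraMap O Δ (p.coeff i) * w⁻¹ ^ i :=
      eq_neg_of_add_eq_zero_right h0
    rw [h2, h3, neg_mul, Finset.sum_mul]
    congr 1
    refine Finset.sum_congr rfl fun i hi => ?_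
    have hi' : i ≤ n - 1 := Nat.le_sub_one_of_lt (Finset.mem_range.1 hi)
    rw [Algebra.smul_def, mul_assoc]
    congr 1
    conv_lhs => rw [← Nat.add_sub_cancel' hi', pow_add, ← mul_assoc,
      ← (Commute.refl w).inv_left₀.mul_pow, inv_mul_cancel₀ hw, one_pow, one_mul]
  intro x hx
  rw [h1, neg_smul, Finset.sum_smul]
  refine N.neg_mem (N.sum_mem fun i _ => ?_)
  rw [smul_assoc]
  exact N.smul_mem _ (hpow _ x hx)

/-- An element that stabilises a nonzero finitely generated module is integral. -/
theorem isIntegral_of_forall_smul_mem {M : Type*} [AddCommGroup M]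
    [Module Δ M] [Module O M]
    [IsScalarTower O Δ M] {N : Submodule O M} (hN : N.FG) (hN0 : N ≠ ⊥) {w : Δ}
    (h : ∀ x ∈ N, w • x ∈ N) : IsIntegral O w := by
  obtain ⟨y, hy, hy0⟩ := (Submodule.ne_bot_iff N).1 hN0
  have : Module.Finite O N := Module.Finite.iff_fg.2 hN
  let f : Module.End O N :=
    { toFun := fun x => ⟨w • x, h x x.2⟩
      map_add' := fun a b => Subtype.ext (smul_add w (a : M) b)
      map_smul' := fun c a => Subtype.ext (by
        change w • c • (a : M) = c • w • (a : M)
        rw [← algebraMap_smul Δ c (a : M), ← algebraMap_smul Δ c (w • (a : M)), smul_smul,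
          smul_smul, Algebra.commutes]) }
  obtain ⟨p, hp, hp0⟩ := LinearMap.exists_monic_and_aeval_eq_zero O f
  refine ⟨p, hp, ?_⟩
  have hpow : ∀ (n : ℕ) (x : N), ((f ^ n) x : M) = w ^ n • (x : M) := by
    intro n
    induction n with
    | zero => simp
    | succ n ih =>
      intro x
      rw [pow_succ', pow_succ', mul_smul, ← ih]
      rfl
  have hf : ∀ (q : Polynomial O) (x : N), ((Polynomial.aeval f q x : N) : M) =
      Polynomial.aeval w q • (x : M) := by
    intro q x
    induction q using Polynomial.induction_on with
    | C a => simp [Module.algebraMap_end_apply]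
    | add p q hp hq => simp [hp, hq, add_smul]
    | monomial n a ih => simp [hpow, Module.algebraMap_end_apply, mul_smul]
  have h1 := hf p ⟨y, hy⟩
  rw [hp0] at h1
  have h2 : Polynomial.aeval w p • y = 0 := h1.symm
  exact (smul_eq_zero.1 h2).resolve_right hy0

theorem IsLocalFieldBase.isIntegral_algebraMap_iff (hO : IsLocalFieldBase O) {c : F} :
    IsIntegral O (algebraMap F Δ c) ↔ c ∈ O := by
  refine ⟨fun h => ?_, fun h => isIntegral_algebraMap (R := O) (A := Δ) (x := ⟨c, h⟩)⟩
  obtain ⟨p, hp, h⟩ := h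
  refine hO.mem_of_isIntegral ⟨p, hp, (algebraMap F Δ).injective ?_⟩
  rw [map_zero, ← h, Polynomial.hom_eval₂]
  rfl

variable [FiniteDimensional F Δ]

/-- The norm of `x` is, up to sign, a power of the constant coefficient of its minimal
polynomial, and for integral `x` this coefficient is integral. Both facts are seen in the commutative
field generated by `x`. -/
theorem exists_norm_eq_coeff_zero_pow (x : Δ) : ∃ m : ℕ, m ≠ 0 ∧
    (Algebra.norm F x = (minpoly F x).coeff 0 ^ m ∨
      Algebra.norm F x = - (minpoly F x).coeff 0 ^ m) ∧
    (IsIntegral O x → IsIntegral O ((minpoly F x).coeff 0)) := by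
  have hx : IsIntegral F x := Algebra.IsIntegral.isIntegral x
  have hirr := minpoly.irreducible hx
  have hmon := minpoly.monic hx
  set p := minpoly F x
  have : Fact (Irreducible p) := ⟨hirr⟩
  let φ : AdjoinRoot p →+* Δ := Ideal.Quotient.lift (Ideal.span {p}) (Polynomial.aeval x).toRingHom
    (fun a ha => by
      obtain ⟨b, rfl⟩ := Ideal.mem_span_singleton.1 ha
      change Polynomial.aeval x (p * b) = 0
      rw [map_mul, minpoly.aeval, zero_mul])
  have hφ : φ (AdjoinRoot.root p) = x := by
    change Polynomial.aeval x Polynomial.X = x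
    exact Polynomial.aeval_X x
  have hφF : ∀ c : F, φ (algebraMap F _ c) = algebraMap F Δ c := fun c => by
    change Polynomial.aeval x (Polynomial.C c) = _
    exact Polynomial.aeval_C x c
  let _ : Module (AdjoinRoot p) Δ := Module.compHom Δ φ
  have : IsScalarTower F (AdjoinRoot p) Δ := ⟨fun a b c => by
    change φ (a • b) * c = a • (φ b * c)
    rw [Algebra.smul_def, map_mul, hφF, mul_assoc, ← Algebra.smul_def]⟩
  let pb := AdjoinRoot.powerBasis hirr.ne_zero
  have : FiniteDimensional F (AdjoinRoot p) := pb.finite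
  have : FiniteDimensional (AdjoinRoot p) Δ := Module.Finite.right F _ _
  have h1 : minpoly F (AdjoinRoot.root p) = p := by
    rw [AdjoinRoot.minpoly_root hirr.ne_zero, hmon.leadingCoeff]
    simp
  have h2 : Algebra.norm F x =
      Algebra.norm F (AdjoinRoot.root p) ^ Module.finrank (AdjoinRoot p) Δ := by
    have h3 := LinearMap.det_restrictScalars (R := F) (S := AdjoinRoot p)
      (f := AdjoinRoot.root p • (LinearMap.id : Δ →ₗ[AdjoinRoot p] Δ))
    rw [LinearMap.det_smul, LinearMap.det_id, mul_one, map_pow] at h3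
    rw [← h3, Algebra.norm_apply]
    congr 1
    ext y
    change x * y = φ (AdjoinRoot.root p) * y
    rw [hφ]
  have h4 : Algebra.norm F (AdjoinRoot.root p) = (-1) ^ pb.dim * p.coeff 0 := by
    have h5 := Algebra.PowerBasis.norm_gen_eq_coeff_zero_minpoly pb
    rwa [AdjoinRoot.powerBasis_gen, h1] at h5
  refine ⟨Module.finrank (AdjoinRoot p) Δ, Module.finrank_pos.ne', ?_, fun h => ?_⟩
  · rw [h2, h4, mul_pow, ← pow_mul]
    rcases neg_one_pow_eq_or F (pb.dim * Module.finrank (AdjoinRoot p) Δ) with h | h <;> rw [h]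
    · left; ring
    · right; ring
  · have h5 : IsIntegral O (AdjoinRoot.root p) := by
      rw [← hφ] at h
      obtain ⟨q, hq, hq0⟩ := h
      refine ⟨q, hq, φ.injective ?_⟩
      rw [map_zero, ← hq0, Polynomial.hom_eval₂]
      congr 1
      ext c
      exact hφF c
    have h6 := Algebra.isIntegral_norm F h5
    rw [h4] at h6
    have h7 : p.coeff 0 = (-1) ^ pb.dim * ((-1) ^ pb.dim * p.coeff 0) := by
      rw [← mul_assoc, ← mul_pow]; simp
    rw [h7]
    exact (((isIntegral_one (R := O) (B := F)).neg).pow _).mul h6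

theorem IsLocalFieldBase.isIntegral_of_coeff_zero_mem (hO : IsLocalFieldBase O) {x : Δ}
    (h : (minpoly F x).coeff 0 ∈ O) : IsIntegral O x := by
  have hx : IsIntegral F x := Algebra.IsIntegral.isIntegral x
  have h1 := hO.coeff_mem _ (minpoly.monic hx) (minpoly.irreducible hx) h
  have h2 : (↑(minpoly F x).coeffs : Set F) ⊆ O := by
    intro c hc
    obtain ⟨i, -, rfl⟩ := Polynomial.mem_coeffs_iff.1 hc
    exact h1 i
  refine ⟨(minpoly F x).toSubring O h2, (Polynomial.monic_toSubring _ _ h2).2 (minpoly.monic hx), ?_⟩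
  have h3 := minpoly.aeval F x
  rw [Polynomial.aeval_def] at h3
  conv at h3 => lhs; rw [← Polynomial.map_toSubring (minpoly F x) O h2]
  rw [Polynomial.eval₂_map] at h3
  exact h3

/-- The valuation of `F` extends to `Δ` through the norm. -/
theorem IsLocalFieldBase.isIntegral_iff_norm_mem (hO : IsLocalFieldBase O) {x : Δ} :
    IsIntegral O x ↔ Algebra.norm F x ∈ O := by
  obtain ⟨m, hm, hnorm, hint⟩ := exists_norm_eq_coeff_zero_pow (O := O) (F := F) x
  have h1 : Algebra.norm F x ∈ O ↔ (minpoly F x).coeff 0 ^ m ∈ O := by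
    rcases hnorm with h | h <;> rw [h]
    exact neg_mem_iff
  have h2 : (minpoly F x).coeff 0 ^ m ∈ O ↔ (minpoly F x).coeff 0 ∈ O := by
    refine ⟨fun h => ?_, fun h => pow_mem h m⟩
    rcases hO.mem_or_inv_mem ((minpoly F x).coeff 0) with h' | h'
    · exact h'
    · rcases eq_or_ne ((minpoly F x).coeff 0) 0 with h0 | h0
      · rw [h0]; exact O.zero_mem
      obtain ⟨n, rfl⟩ := Nat.exists_eq_succ_of_ne_zero hm
      have h3 : (minpoly F x).coeff 0 =
          (minpoly F x).coeff 0 ^ (n + 1) * ((minpoly F x).coeff 0)⁻¹ ^ n := by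
        rw [pow_succ', mul_assoc, ← mul_pow, mul_inv_cancel₀ h0, one_pow, mul_one]
      rw [h3]
      exact O.mul_mem h (pow_mem h' n)
  rw [h1, h2]
  exact ⟨fun h => hO.mem_of_isIntegral (hint h), hO.isIntegral_of_coeff_zero_mem⟩

theorem IsLocalFieldBase.isIntegral_or_inv (hO : IsLocalFieldBase O) (x : Δ) :
    IsIntegral O x ∨ IsIntegral O x⁻¹ := by
  rcases eq_or_ne x 0 with rfl | hx
  · exact Or.inl isIntegral_zero
  rw [hO.isIntegral_iff_norm_mem, hO.isIntegral_iff_norm_mem]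
  have h : Algebra.norm F x⁻¹ = (Algebra.norm F x)⁻¹ := by
    refine eq_inv_of_mul_eq_one_left ?_
    rw [← map_mul, inv_mul_cancel₀ hx, map_one]
  rw [h]
  exact hO.mem_or_inv_mem _

theorem IsLocalFieldBase.isIntegral_mul (hO : IsLocalFieldBase O) {x y : Δ} (hx : IsIntegral O x)
    (hy : IsIntegral O y) : IsIntegral O (x * y) := by
  rw [hO.isIntegral_iff_norm_mem] at *
  rw [map_mul]
  exact O.mul_mem hx hy

/-- Sums of integral elements are integral although `Δ` need not be commutative: one of `x⁻¹ y` and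
`y⁻¹ x` is integral, and a sum with `1` stays integral. -/
theorem IsLocalFieldBase.isIntegral_add (hO : IsLocalFieldBase O) {x y : Δ} (hx : IsIntegral O x)
    (hy : IsIntegral O y) : IsIntegral O (x + y) := by
  rcases eq_or_ne x 0 with rfl | hx0
  · rwa [zero_add]
  rcases eq_or_ne y 0 with rfl | hy0
  · rwa [add_zero]
  rcases hO.isIntegral_or_inv (x⁻¹ * y) with h | h
  · have := hO.isIntegral_mul hx (isIntegral_one_add h)
    rwa [mul_add, mul_one, mul_inv_cancel_left₀ hx0] at this
  · rw [mul_inv_rev, inv_inv] at h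
    have := hO.isIntegral_mul hy (isIntegral_one_add h)
    rwa [mul_add, mul_one, mul_inv_cancel_left₀ hy0, add_comm] at this

theorem IsLocalFieldBase.isIntegral_conj (hO : IsLocalFieldBase O) {u : Δ} (hu : u ≠ 0) {x : Δ} :
    IsIntegral O (u * x * u⁻¹) ↔ IsIntegral O x := by
  rw [hO.isIntegral_iff_norm_mem, hO.isIntegral_iff_norm_mem, map_mul, map_mul, mul_right_comm,
    ← map_mul, mul_inv_cancel₀ hu, map_one, one_mul]

variable (Δ) in
/-- The maximal order of `Δ` as a subring. -/
def IsLocalFieldBase.intRing (hO : IsLocalFieldBase O) : Subring Δ where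
  carrier := maxOrder O Δ
  mul_mem' := hO.isIntegral_mul
  one_mem' := isIntegral_one
  add_mem' := hO.isIntegral_add
  zero_mem' := isIntegral_zero
  neg_mem' := IsIntegral.neg

theorem IsLocalFieldBase.mem_maxIdeal (hO : IsLocalFieldBase O) {x : Δ} :
    x ∈ maxIdeal O Δ ↔ x = 0 ∨ ¬ IsIntegral O x⁻¹ := by
  refine ⟨fun h => h.2, fun h => ⟨?_, h⟩⟩
  rcases h with rfl | h
  · exact isIntegral_zero
  · exact (hO.isIntegral_or_inv x).resolve_right h

theorem zero_mem_maxIdeal {O Δ : Type*} [CommRing O] [DivisionRing Δ] [Algebra O Δ] :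
    (0 : Δ) ∈ maxIdeal O Δ := ⟨isIntegral_zero, Or.inl rfl⟩

theorem one_notMem_maxIdeal {O Δ : Type*} [CommRing O] [DivisionRing Δ] [Algebra O Δ] :
    (1 : Δ) ∉ maxIdeal O Δ := fun h =>
  h.2.elim one_ne_zero fun h => h (by rw [inv_one]; exact isIntegral_one)

theorem ne_zero_of_notMem_maxIdeal {O Δ : Type*} [CommRing O] [DivisionRing Δ] [Algebra O Δ]
    {x : Δ} (hx : x ∉ maxIdeal O Δ) : x ≠ 0 := fun h => hx (h ▸ zero_mem_maxIdeal)

theorem IsLocalFieldBase.isIntegral_inv_of_notMem (hO : IsLocalFieldBase O) {x : Δ}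
    (hx : x ∉ maxIdeal O Δ) : IsIntegral O x⁻¹ := by
  rw [hO.mem_maxIdeal] at hx
  push Not at hx
  exact hx.2

theorem IsLocalFieldBase.mul_mem_maxIdeal_left (hO : IsLocalFieldBase O) {x y : Δ}
    (hx : IsIntegral O x) (hy : y ∈ maxIdeal O Δ) : x * y ∈ maxIdeal O Δ := by
  by_contra h
  have h0 := mul_ne_zero_iff.1 (ne_zero_of_notMem_maxIdeal h)
  have h1 := hO.isIntegral_mul (hO.isIntegral_inv_of_notMem h) hx
  rw [mul_inv_rev, inv_mul_cancel_right₀ h0.1] at h1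
  exact (hO.mem_maxIdeal.1 hy).elim h0.2 fun h => h h1

theorem IsLocalFieldBase.mul_mem_maxIdeal_right (hO : IsLocalFieldBase O) {x y : Δ}
    (hx : x ∈ maxIdeal O Δ) (hy : IsIntegral O y) : x * y ∈ maxIdeal O Δ := by
  by_contra h
  have h0 := mul_ne_zero_iff.1 (ne_zero_of_notMem_maxIdeal h)
  have h1 := hO.isIntegral_mul hy (hO.isIntegral_inv_of_notMem h)
  rw [mul_inv_rev, mul_inv_cancel_left₀ h0.2] at h1
  exact (hO.mem_maxIdeal.1 hx).elim h0.1 fun h => h h1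

theorem neg_mem_maxIdeal {O Δ : Type*} [CommRing O] [DivisionRing Δ] [Algebra O Δ]
    {x : Δ} (hx : x ∈ maxIdeal O Δ) : -x ∈ maxIdeal O Δ :=
  ⟨hx.1.neg, hx.2.imp (fun h => by rw [h, neg_zero]) fun h h' => h (by
    rw [inv_neg] at h'
    rw [← neg_neg x⁻¹]
    exact h'.neg)⟩

theorem IsLocalFieldBase.add_mem_maxIdeal (hO : IsLocalFieldBase O) {x y : Δ}
    (hx : x ∈ maxIdeal O Δ) (hy : y ∈ maxIdeal O Δ) : x + y ∈ maxIdeal O Δ := by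
  rcases eq_or_ne x 0 with rfl | hx0
  · rwa [zero_add]
  rcases eq_or_ne y 0 with rfl | hy0
  · rwa [add_zero]
  rcases hO.isIntegral_or_inv (x⁻¹ * y) with h | h
  · have := hO.mul_mem_maxIdeal_right hx (isIntegral_one_add h)
    rwa [mul_add, mul_one, mul_inv_cancel_left₀ hx0] at this
  · rw [mul_inv_rev, inv_inv] at h
    have := hO.mul_mem_maxIdeal_right hy (isIntegral_one_add h)
    rwa [mul_add, mul_one, mul_inv_cancel_left₀ hy0, add_comm] at this

theorem IsLocalFieldBase.isIntegral_sum (hO : IsLocalFieldBase O) {ι : Type*} {s : Finset ι}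
    {f : ι → Δ} (h : ∀ i ∈ s, IsIntegral O (f i)) : IsIntegral O (∑ i ∈ s, f i) :=
  sum_mem (S := hO.intRing Δ) h

theorem IsLocalFieldBase.sum_mem_maxIdeal (hO : IsLocalFieldBase O) {ι : Type*} {s : Finset ι}
    {f : ι → Δ} (h : ∀ i ∈ s, f i ∈ maxIdeal O Δ) : ∑ i ∈ s, f i ∈ maxIdeal O Δ :=
  Finset.sum_induction f (· ∈ maxIdeal O Δ) (fun _ _ => hO.add_mem_maxIdeal) zero_mem_maxIdeal h

end DivisionAlgebra

/-! ### Lattices of row vectors -/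

section FullLattices

variable {A M : Type*} [CommRing A] [AddCommGroup M] [Module A M]

/-- A finitely generated submodule that contains a nonzero multiple of every vector: a lattice
in a vector space over the field of fractions of `A`. -/
structure IsFullLattice (N : Submodule A M) : Prop where
  fg : N.FG
  full : ∀ x : M, ∃ c : A, c ≠ 0 ∧ c • x ∈ N

theorem IsFullLattice.of_le [IsNoetherianRing A] {N N' L : Submodule A M} (hN : IsFullLattice N)
    (hL : IsFullLattice L) (h : N ≤ N') (h' : N' ≤ L) : IsFullLattice N' where
  fg := hL.fg.of_le h'
  full x := (hN.full x).imp fun _ hc => ⟨hc.1, h hc.2⟩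

theorem IsFullLattice.sup {N N' : Submodule A M} (hN : IsFullLattice N)
    (hN' : IsFullLattice N') : IsFullLattice (N ⊔ N') where
  fg := hN.fg.sup hN'.fg
  full x := (hN.full x).imp fun _ hc => ⟨hc.1, (le_sup_left : N ≤ N ⊔ N') hc.2⟩

theorem IsFullLattice.map {M' : Type*} [AddCommGroup M'] [Module A M'] {N : Submodule A M}
    (hN : IsFullLattice N) {f : M →ₗ[A] M'} (hf : Function.Surjective f) :
    IsFullLattice (N.map f) where
  fg := hN.fg.map f
  full x := by
    obtain ⟨y, rfl⟩ := hf x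
    obtain ⟨c, hc, hy⟩ := hN.full y
    exact ⟨c, hc, c • y, hy, map_smul f c y⟩

theorem IsFullLattice.pi [IsDomain A] {ι : Type*} [Finite ι] {N : ι → Submodule A M}
    (hN : ∀ i, IsFullLattice (N i)) : IsFullLattice (Submodule.pi Set.univ N) where
  fg := Submodule.fg_pi fun i => (hN i).fg
  full x := by
    classical
    have := Fintype.ofFinite ι
    choose c hc hx using fun i => (hN i).full (x i)
    refine ⟨∏ i, c i, Finset.prod_ne_zero_iff.2 fun i _ => hc i, Submodule.mem_pi.2 fun i _ => ?_⟩
    rw [Pi.smul_apply, ← Finset.prod_erase_mul _ _ (Finset.mem_univ i), mul_smul]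
    exact (N i).smul_mem _ (hx i)

theorem IsFullLattice.ne_bot [Nontrivial M] [IsDomain A] [Module.IsTorsionFree A M]
    {N : Submodule A M} (hN : IsFullLattice N) : N ≠ ⊥ := by
  rintro rfl
  obtain ⟨x, hx⟩ := exists_ne (0 : M)
  obtain ⟨c, hc, h⟩ := hN.full x
  exact smul_ne_zero hc hx h

variable {B : Type*} [Ring B] [Algebra A B]

/-- The set of all `d` with `d J ⊆ L`. -/
def transporter (J L : Submodule A B) : Submodule A B where
  carrier := {d | ∀ y ∈ J, d * y ∈ L}
  add_mem' ha hb y hy := by rw [add_mul]; exact L.add_mem (ha y hy) (hb y hy)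
  zero_mem' y _ := by rw [zero_mul]; exact L.zero_mem
  smul_mem' c a ha y hy := by rw [smul_mul_assoc]; exact L.smul_mem c (ha y hy)

theorem mem_transporter {J L : Submodule A B} {d : B} :
    d ∈ transporter J L ↔ ∀ y ∈ J, d * y ∈ L := Iff.rfl

/-- All full right lattices over `Λ` have a dual basis; this expresses that `Λ` is
hereditary. -/
def HasDualBases (Λ : Subalgebra A B) : Prop :=
  ∀ J : Submodule A B, IsFullLattice J → (∀ x ∈ J, ∀ r ∈ Λ, x * r ∈ J) →
    (1 : B) ∈ J * transporter J (Subalgebra.toSubmodule Λ)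

end FullLattices

section RowLattices

variable {F : Type*} [Field F] {O : Subring F} {Δ : Type*} [DivisionRing Δ] [Algebra F Δ]
  {ι : Type*}

/-- The matrices whose rows lie in given sets. -/
def rowsIn (N : ι → Submodule O (ι → Δ)) : Submodule O (Matrix ι ι Δ) :=
  Submodule.pi Set.univ N

theorem mem_rowsIn {N : ι → Submodule O (ι → Δ)} {Y : Matrix ι ι Δ} :
    Y ∈ rowsIn N ↔ ∀ a, Y a ∈ N a := by
  rw [rowsIn]
  exact Submodule.mem_pi.trans (by simp)

theorem vecMulVec_single_mem_rowsIn [DecidableEq ι] {N : ι → Submodule O (ι → Δ)} {a : ι} {y : ι → Δ}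
    (hy : y ∈ N a) : Matrix.vecMulVec (Pi.single a 1) y ∈ rowsIn N := by
  refine mem_rowsIn.2 fun b => ?_
  rcases eq_or_ne b a with rfl | h
  · convert hy using 1
    funext c
    simp [Matrix.vecMulVec_apply]
  · convert (N b).zero_mem using 1
    funext c
    simp [Matrix.vecMulVec_apply, h]

/-- The row module `c N`. -/
def smulRow (c : Δ) (N : Submodule O (ι → Δ)) : Submodule O (ι → Δ) :=
  N.map (LinearMap.pi fun i => (LinearMap.mulLeft O c).comp (LinearMap.proj i))

theorem mem_smulRow {c : Δ} (hc : c ≠ 0) {N : Submodule O (ι → Δ)} {y : ι → Δ} :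
    y ∈ smulRow c N ↔ c⁻¹ • y ∈ N := by
  constructor
  · rintro ⟨x, hx, rfl⟩
    have h : c⁻¹ • (fun i => c * x i) = x := funext fun i => inv_mul_cancel_left₀ hc (x i)
    change c⁻¹ • (fun i => c * x i) ∈ N
    rwa [h]
  · intro h
    refine ⟨_, h, ?_⟩
    funext i
    exact mul_inv_cancel_left₀ hc (y i)

variable [Fintype ι] [DecidableEq ι]

/-- A lattice of row vectors which is a right module over the ring of matrices `Λ`. -/
structure IsRowLattice (Λ : Subalgebra O (Matrix ι ι Δ)) (N : Submodule O (ι → Δ)) : Prop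
    extends IsFullLattice N where
  vecMul_mem : ∀ y ∈ N, ∀ X ∈ Λ, Matrix.vecMul y X ∈ N

variable {Λ : Subalgebra O (Matrix ι ι Δ)}

theorem isFullLattice_rowsIn {N : ι → Submodule O (ι → Δ)} (hN : ∀ a, IsRowLattice Λ (N a)) :
    IsFullLattice (rowsIn N) :=
  IsFullLattice.pi fun a => (hN a).toIsFullLattice

theorem rowsIn_mul_mem {N : ι → Submodule O (ι → Δ)} (hN : ∀ a, IsRowLattice Λ (N a))
    {Y : Matrix ι ι Δ} (hY : Y ∈ rowsIn N) {X : Matrix ι ι Δ} (hX : X ∈ Λ) : Y * X ∈ rowsIn N :=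
  mem_rowsIn.2 fun a => (hN a).vecMul_mem _ (mem_rowsIn.1 hY a) _ hX

theorem IsRowLattice.sup {N N' : Submodule O (ι → Δ)} (hN : IsRowLattice Λ N)
    (hN' : IsRowLattice Λ N') : IsRowLattice Λ (N ⊔ N') where
  toIsFullLattice := hN.toIsFullLattice.sup hN'.toIsFullLattice
  vecMul_mem y hy X hX := by
    obtain ⟨n, hn, n', hn', rfl⟩ := Submodule.mem_sup.1 hy
    rw [Matrix.add_vecMul]
    exact Submodule.add_mem_sup (hN.vecMul_mem n hn X hX) (hN'.vecMul_mem n' hn' X hX)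

/-- If `(d e_a) ⊗ y` lies in `Λ` for all `y` in `N`, then `r d e_a` maps `N` to any row module
that contains `r`. -/
theorem dotProduct_smul_mem {N P : Submodule O (ι → Δ)} (hP : IsRowLattice Λ P) {a : ι}
    {d : Matrix ι ι Δ}
    (hd : d ∈ transporter (rowsIn fun _ : ι => N) (Subalgebra.toSubmodule Λ)) {r : ι → Δ}
    (hr : r ∈ P) {y : ι → Δ} (hy : y ∈ N) : (r ⬝ᵥ fun c => d c a) • y ∈ P := by
  have h1 := hd _ (vecMulVec_single_mem_rowsIn (N := fun _ : ι => N) (a := a) hy)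
  rw [Matrix.mul_vecMulVec, Matrix.mulVec_single_one] at h1
  have h2 := hP.vecMul_mem r hr _ h1
  rwa [Matrix.vecMul_vecMulVec] at h2

/-- The projection of a right lattice to a row splits; the splitting has the form
`y ↦ u ⊗ y` for a column `u`. -/
theorem exists_forall_vecMulVec_mem (hΛ : HasDualBases Λ) {L : Submodule O (Matrix ι ι Δ)}
    (hL : ∀ Y ∈ L, ∀ X ∈ Λ, Y * X ∈ L) (a : ι) {N : Submodule O (ι → Δ)} (hN : IsRowLattice Λ N)
    (hNL : ∀ y ∈ N, ∃ Y ∈ L, Y a = y) :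
    ∃ u : ι → Δ, u a = 1 ∧ ∀ y ∈ N, Matrix.vecMulVec u y ∈ L := by
  have key : ∀ z ∈ (rowsIn fun _ : ι => N) *
      transporter (rowsIn fun _ : ι => N) (Subalgebra.toSubmodule Λ),
      ∃ u : ι → Δ, u a = z a a ∧ ∀ y ∈ N, Matrix.vecMulVec u y ∈ L := by
    intro z hz
    induction hz using Submodule.mul_induction_on' with
    | mem_mul_mem x hx d hd =>
      obtain ⟨l, hl, hla⟩ := hNL _ (mem_rowsIn.1 hx a)
      refine ⟨l.mulVec (d.col a), ?_, fun y hy => ?_⟩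
      · rw [Matrix.mulVec, hla]
        rfl
      · have h1 := hL l hl _ (hd _ (vecMulVec_single_mem_rowsIn (N := fun _ : ι => N) (a := a) hy))
        rwa [Matrix.mul_vecMulVec, Matrix.mul_vecMulVec, Matrix.mulVec_single_one] at h1
    | add x _ y _ hx hy =>
      obtain ⟨b, h, hb⟩ := hx
      obtain ⟨c, h', hc⟩ := hy
      refine ⟨b + c, ?_, fun y hy => ?_⟩
      · rw [Matrix.add_apply, Pi.add_apply, h, h']
      · rw [Matrix.add_vecMulVec]; exact L.add_mem (hb y hy) (hc y hy)
  obtain ⟨u, h1, hu⟩ := key 1 (hΛ _ (isFullLattice_rowsIn fun _ => hN)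
    fun _ hx _ hr => rowsIn_mul_mem (fun _ => hN) hx hr)
  rw [Matrix.one_apply_eq] at h1
  exact ⟨u, h1, hu⟩

/-- A right lattice supported in a set of rows is a direct sum of row lattices. -/
theorem exists_mem_iff_eq_sum_vecMulVec [IsNoetherianRing O] (hΛ : HasDualBases Λ) (s : Finset ι) :
    ∀ L : Submodule O (Matrix ι ι Δ), (∀ Y ∈ L, ∀ X ∈ Λ, Y * X ∈ L) →
      (∀ Y ∈ L, ∀ a ∉ s, Y a = 0) → L.FG →
      (∀ Y : Matrix ι ι Δ, (∀ a ∉ s, Y a = 0) → ∃ c : O, c ≠ 0 ∧ c • Y ∈ L) →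
      ∃ (u : ι → ι → Δ) (N : ι → Submodule O (ι → Δ)), (∀ a ∈ s, IsRowLattice Λ (N a)) ∧
        ∀ Y, Y ∈ L ↔ ∃ y : ι → ι → Δ, (∀ a ∈ s, y a ∈ N a) ∧
          Y = ∑ a ∈ s, Matrix.vecMulVec (u a) (y a) := by
  induction s using Finset.induction_on with
  | empty =>
    intro L _ h0 _ _
    refine ⟨0, fun _ => ⊥, by simp, fun Y => ⟨fun hY => ⟨0, by simp, ?_⟩, ?_⟩⟩
    · rw [Finset.sum_empty]
      exact funext fun a => h0 Y hY a (by simp)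
    · rintro ⟨y, -, rfl⟩
      rw [Finset.sum_empty]
      exact L.zero_mem
  | insert a s has ih =>
    intro L hL h0 hfg hfull
    let row : Matrix ι ι Δ →ₗ[O] (ι → Δ) := LinearMap.proj a
    have hN : IsRowLattice Λ (L.map row) :=
      { fg := hfg.map row
        full := fun y => by
          obtain ⟨c, hc, h⟩ := hfull (Matrix.vecMulVec (Pi.single a 1) y) (fun b hb => by
            have hba : b ≠ a := fun h => hb (by simp [h])
            funext i
            simp [Matrix.vecMulVec_apply, hba])
          refine ⟨c, hc, _, h, ?_⟩
          funext i
          change c • (Pi.single (M := fun _ => Δ) a 1 a * y i) = c • y i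
          rw [Pi.single_eq_same, one_mul]
        vecMul_mem := by
          rintro _ ⟨Y, hY, rfl⟩ X hX
          exact ⟨Y * X, hL Y hY X hX, rfl⟩ }
    obtain ⟨v, hv1, hv⟩ := exists_forall_vecMulVec_mem hΛ hL a hN fun y ⟨Y, hY, hYy⟩ => ⟨Y, hY, hYy⟩
    obtain ⟨u, N, hN', huN⟩ := ih (L ⊓ LinearMap.ker row)
      (fun Y hY X hX => ⟨hL Y hY.1 X hX, by
        have h : Y a = 0 := hY.2
        change Matrix.vecMul (Y a) X = 0
        rw [h, Matrix.zero_vecMul]⟩)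
      (fun Y hY b hb => by
        rcases eq_or_ne b a with rfl | hba
        · exact hY.2
        · exact h0 Y hY.1 b (by simp [hb, hba]))
      (hfg.of_le inf_le_left)
      (fun Y hY => by
        obtain ⟨c, hc, h⟩ := hfull Y fun b hb => hY b (fun h => hb (Finset.mem_insert_of_mem h))
        refine ⟨c, hc, h, ?_⟩
        change c • Y a = 0
        rw [hY a has, smul_zero])
    refine ⟨Function.update u a v, Function.update N a (L.map row), fun b hb => ?_, fun Y => ?_⟩
    · rcases eq_or_ne b a with rfl | hba
      · simpa using hN
      · rw [Function.update_of_ne hba]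
        exact hN' b (Finset.mem_of_mem_insert_of_ne hb hba)
    have hne : ∀ b ∈ s, b ≠ a := fun b hb h => has (h ▸ hb)
    have hsum : ∀ y : ι → ι → Δ, ∑ b ∈ s, Matrix.vecMulVec (Function.update u a v b) (y b) =
        ∑ b ∈ s, Matrix.vecMulVec (u b) (y b) := fun y => Finset.sum_congr rfl fun b hb => by
      rw [Function.update_of_ne (hne b hb)]
    constructor
    · intro hY
      have h1 : Y - Matrix.vecMulVec v (Y a) ∈ L ⊓ LinearMap.ker row := by
        refine ⟨L.sub_mem hY (hv _ ⟨Y, hY, rfl⟩), ?_⟩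
        change Y a - Matrix.vecMulVec v (Y a) a = 0
        rw [sub_eq_zero]
        funext i
        rw [Matrix.vecMulVec_apply, hv1, one_mul]
      obtain ⟨y, hy, hYy⟩ := (huN _).1 h1
      refine ⟨Function.update y a (Y a), fun b hb => ?_, ?_⟩
      · rcases eq_or_ne b a with rfl | hba
        · simpa using ⟨Y, hY, rfl⟩
        · rw [Function.update_of_ne hba, Function.update_of_ne hba]
          exact hy b (Finset.mem_of_mem_insert_of_ne hb hba)
      · rw [Finset.sum_insert has, Function.update_self, Function.update_self, hsum,
          ← sub_eq_iff_eq_add', hYy]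
        exact Finset.sum_congr rfl fun b hb => by
          rw [Function.update_of_ne (hne b hb)]
    · rintro ⟨y, hy, rfl⟩
      rw [Finset.sum_insert has, Function.update_self, hsum]
      refine L.add_mem (hv _ ?_) ?_
      · simpa using hy a (Finset.mem_insert_self a s)
      · refine ((huN _).2 ⟨y, fun b hb => ?_, rfl⟩).1
        have := hy b (Finset.mem_insert_of_mem hb)
        rwa [Function.update_of_ne (hne b hb)] at this

/-- Every right lattice is, up to left multiplication by a unit, the lattice of all matrices whose
rows lie in given row lattices. -/
theorem exists_unit_forall_mem_iff [IsNoetherianRing O] (hΛ : HasDualBases Λ)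
    {L : Submodule O (Matrix ι ι Δ)} (hL : IsFullLattice L)
    (hLΛ : ∀ Y ∈ L, ∀ X ∈ Λ, Y * X ∈ L) :
    ∃ (α : (Matrix ι ι Δ)ˣ) (N : ι → Submodule O (ι → Δ)), (∀ a, IsRowLattice Λ (N a)) ∧
      ∀ Y : Matrix ι ι Δ, (α : Matrix ι ι Δ) * Y ∈ L ↔ Y ∈ rowsIn N := by
  obtain ⟨u, N, hN, huN⟩ := exists_mem_iff_eq_sum_vecMulVec hΛ Finset.univ L hLΛ (by simp) hL.fg
    fun Y _ => hL.full Y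
  have h1 : ∀ y : ι → ι → Δ, ∑ a, Matrix.vecMulVec (u a) (y a) =
      (Matrix.of u).transpose * Matrix.of y := by
    intro y
    ext i j
    simp [Matrix.sum_apply, Matrix.mul_apply, Matrix.vecMulVec_apply]
  obtain ⟨c, hc, hc1⟩ := hL.full 1
  obtain ⟨y, -, hy⟩ := (huN _).1 hc1
  have hc' : (c : F) ≠ 0 := fun h => hc (Subtype.ext h)
  have h2 : (Matrix.of u).transpose * ((c : F)⁻¹ • Matrix.of y) = 1 := by
    rw [Matrix.mul_smul, ← h1, ← hy]
    change (c : F)⁻¹ • (c : F) • (1 : Matrix ι ι Δ) = 1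
    rw [smul_smul, inv_mul_cancel₀ hc', one_smul]
  have h3 : ((c : F)⁻¹ • Matrix.of y) * (Matrix.of u).transpose = 1 := mul_eq_one_symm h2
  let α : (Matrix ι ι Δ)ˣ := ⟨_, _, h2, h3⟩
  refine ⟨α, N, fun a => hN a (Finset.mem_univ a), fun Y => ?_⟩
  rw [huN, mem_rowsIn]
  constructor
  · rintro ⟨y, hy, h⟩
    rw [h1] at h
    have h4 : Y = Matrix.of y := α.isUnit.mul_left_cancel h
    rw [h4]
    exact fun a => hy a (Finset.mem_univ a)
  · exact fun h => ⟨Y, fun a _ => h a, (h1 Y).symm⟩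

theorem IsRowLattice.smulRow {N : Submodule O (ι → Δ)} (hN : IsRowLattice Λ N) {c : Δ}
    (hc : c ≠ 0) : IsRowLattice Λ (smulRow c N) where
  toIsFullLattice := hN.toIsFullLattice.map fun y => ⟨c⁻¹ • y, funext fun i =>
    mul_inv_cancel_left₀ hc (y i)⟩
  vecMul_mem y hy X hX := by
    rw [mem_smulRow hc] at *
    rw [← Matrix.smul_vecMul]
    exact hN.vecMul_mem _ hy X hX

variable [FiniteDimensional F Δ]

/-- The row lattices over a hereditary order form a chain. A dual basis of `N + N'` writes `1` as `b
+ b'`, where `b` maps `N + N'` into `N` and `b'` maps it into `N'`; one of the two is a unit of the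
maximal order. -/
theorem IsLocalFieldBase.isRowLattice_le_or_le (hO : IsLocalFieldBase O) (hΛ : HasDualBases Λ)
    {N N' : Submodule O (ι → Δ)} (hN : IsRowLattice Λ N) (hN' : IsRowLattice Λ N') :
    N ≤ N' ∨ N' ≤ N := by
  rcases isEmpty_or_nonempty ι with h | ⟨⟨a⟩⟩
  · exact Or.inl fun x _ => by rw [Subsingleton.elim x 0]; exact N'.zero_mem
  have : Nonempty ι := ⟨a⟩
  have := hO.hasFiniteQuotients
  have hsup := hN.sup hN'
  have key : ∀ z ∈ (rowsIn fun _ : ι => N ⊔ N') *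
      transporter (rowsIn fun _ : ι => N ⊔ N') (Subalgebra.toSubmodule Λ),
      ∃ b b' : Δ, z a a = b + b' ∧ (∀ y ∈ N ⊔ N', b • y ∈ N) ∧ (∀ y ∈ N ⊔ N', b' • y ∈ N') := by
    intro z hz
    induction hz using Submodule.mul_induction_on' with
    | mem_mul_mem x hx d hd =>
      obtain ⟨n, hn, n', hn', h⟩ := Submodule.mem_sup.1 (mem_rowsIn.1 hx a)
      refine ⟨n ⬝ᵥ fun c => d c a, n' ⬝ᵥ fun c => d c a, ?_,
        fun y hy => dotProduct_smul_mem hN hd hn hy, fun y hy => dotProduct_smul_mem hN' hd hn' hy⟩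
      rw [← add_dotProduct, h]
      rfl
    | add x _ y _ hx hy =>
      obtain ⟨b, b', h, hb, hb'⟩ := hx
      obtain ⟨c, c', h', hc, hc'⟩ := hy
      refine ⟨b + c, b' + c', ?_, fun y hy => ?_, fun y hy => ?_⟩
      · rw [Matrix.add_apply, h, h']; abel
      · rw [add_smul]; exact N.add_mem (hb y hy) (hc y hy)
      · rw [add_smul]; exact N'.add_mem (hb' y hy) (hc' y hy)
  obtain ⟨b, b', h1, hb, hb'⟩ := key 1 (hΛ _ (isFullLattice_rowsIn fun _ => hsup)
    fun _ hx _ hr => rowsIn_mul_mem (fun _ => hsup) hx hr)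
  rw [Matrix.one_apply_eq] at h1
  have hle : N ≤ N ⊔ N' := le_sup_left
  have hle' : N' ≤ N ⊔ N' := le_sup_right
  have hbint : IsIntegral O b := isIntegral_of_forall_smul_mem hsup.fg hsup.toIsFullLattice.ne_bot
    fun x hx => hle (hb x hx)
  have hbint' : IsIntegral O b' := isIntegral_of_forall_smul_mem hsup.fg hsup.toIsFullLattice.ne_bot
    fun x hx => hle' (hb' x hx)
  -- one of `b`, `b'` is a unit of the maximal order, since their sum is `1`
  have hunit : ∀ (P : Submodule O (ι → Δ)), P ≤ N ⊔ N' → ∀ c : Δ, (∀ y ∈ N ⊔ N', c • y ∈ P) →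
      c ∉ maxIdeal O Δ → N ⊔ N' ≤ P := by
    intro P hP c hc hcP y hy
    have hc0 := ne_zero_of_notMem_maxIdeal hcP
    have h2 := inv_smul_mem_of_isIntegral hc0 (hO.isIntegral_inv_of_notMem hcP)
      (fun x hx => hc x (hP hx)) _ (hc y hy)
    rwa [smul_smul, inv_mul_cancel₀ hc0, one_smul] at h2
  by_cases hbP : b ∈ maxIdeal O Δ
  · have hbP' : b' ∉ maxIdeal O Δ := fun h => one_notMem_maxIdeal (O := O) (Δ := Δ)
      (h1 ▸ hO.add_mem_maxIdeal hbP h)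
    exact Or.inl (hle.trans (hunit N' hle' b' hb' hbP'))
  · exact Or.inr (hle'.trans (hunit N hle b hb hbP))

/-- Right lattices over a hereditary order are stable under the maximal order of `Δ`. -/
theorem IsLocalFieldBase.smul_mem_isRowLattice (hO : IsLocalFieldBase O) (hΛ : HasDualBases Λ)
    {N : Submodule O (ι → Δ)} (hN : IsRowLattice Λ N) {c : Δ} (hc : IsIntegral O c)
    {y : ι → Δ} (hy : y ∈ N) : c • y ∈ N := by
  have hunit : ∀ c : Δ, c ∉ maxIdeal O Δ → IsIntegral O c → ∀ y ∈ N, c • y ∈ N := by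
    intro c hcP hc y hy
    have hc0 := ne_zero_of_notMem_maxIdeal hcP
    rcases hO.isRowLattice_le_or_le hΛ hN (hN.smulRow hc0) with h | h
    · have h1 := inv_smul_mem_of_isIntegral (inv_ne_zero hc0) (N := N) (by rwa [inv_inv])
        (fun x hx => (mem_smulRow hc0).1 (h hx)) y hy
      rwa [inv_inv] at h1
    · apply h
      rwa [mem_smulRow hc0, smul_smul, inv_mul_cancel₀ hc0, one_smul]
  -- the sum of `1` and an element of the maximal ideal is a unit
  by_cases hcP : c ∈ maxIdeal O Δ
  · have h1 : 1 + c ∉ maxIdeal O Δ := fun h => one_notMem_maxIdeal (O := O) (Δ := Δ) (by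
      have := hO.add_mem_maxIdeal h (neg_mem_maxIdeal hcP)
      rwa [add_neg_cancel_right] at this)
    have h2 := N.sub_mem (hunit _ h1 (isIntegral_one_add hc) y hy) hy
    rwa [add_smul, one_smul, add_sub_cancel_left] at h2
  · exact hunit c hcP hc y hy

end RowLattices

/-! ### The structure of local hereditary orders -/

section Transport

variable {A B B' : Type*} [CommRing A] [Ring B] [Algebra A B] [Ring B'] [Algebra A B']

/-- The existence of dual bases is preserved by isomorphisms. -/
theorem HasDualBases.map {Λ : Subalgebra A B} (h : HasDualBases Λ) (e : B ≃ₐ[A] B') :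
    HasDualBases (Λ.map (e : B →ₐ[A] B')) := by
  intro J hJ hJΛ
  have h1 := h (J.map (e.symm : B' →ₐ[A] B).toLinearMap)
    (hJ.map e.symm.surjective) (by
      rintro _ ⟨x, hx, rfl⟩ r hr
      refine ⟨x * e r, hJΛ x hx _ ⟨r, hr, rfl⟩, ?_⟩
      change e.symm (x * e r) = e.symm x * r
      rw [map_mul, e.symm_apply_apply])
  have key : ∀ z ∈ J.map (e.symm : B' →ₐ[A] B).toLinearMap *
      transporter (J.map (e.symm : B' →ₐ[A] B).toLinearMap) (Subalgebra.toSubmodule Λ),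
      e z ∈ J * transporter J (Subalgebra.toSubmodule (Λ.map (e : B →ₐ[A] B'))) := by
    intro z hz
    induction hz using Submodule.mul_induction_on' with
    | mem_mul_mem x hx d hd =>
      obtain ⟨x, hx, rfl⟩ := hx
      rw [map_mul]
      refine Submodule.mul_mem_mul ?_ fun y hy => ⟨d * e.symm y, hd _ ⟨y, hy, rfl⟩, ?_⟩
      · change e (e.symm x) ∈ J
        rwa [e.apply_symm_apply]
      · change e (d * e.symm y) = e d * y
        rw [map_mul, e.apply_symm_apply]
    | add x _ y _ hx hy => rw [map_add]; exact Submodule.add_mem _ hx hy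
  have h2 := key 1 h1
  rwa [map_one] at h2

theorem IsFullLattice.map_subalgebra {Λ : Subalgebra A B}
    (h : IsFullLattice (Subalgebra.toSubmodule Λ)) (e : B ≃ₐ[A] B') :
    IsFullLattice (Subalgebra.toSubmodule (Λ.map (e : B →ₐ[A] B'))) :=
  IsFullLattice.map h (f := (e : B →ₐ[A] B').toLinearMap) e.surjective

/-- Conjugation `x ↦ u⁻¹ x u`. -/
def conjEquiv (u : Bˣ) : B ≃ₐ[A] B :=
  AlgEquiv.ofAlgHom
    { toFun := fun x => (u⁻¹ : Bˣ) * x * u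
      map_one' := by simp
      map_mul' := fun x y => by simp [mul_assoc]
      map_zero' := by simp
      map_add' := fun x y => by simp [mul_add, add_mul]
      commutes' := fun c => by rw [mul_assoc, Algebra.commutes, ← mul_assoc]; simp }
    { toFun := fun x => u * x * (u⁻¹ : Bˣ)
      map_one' := by simp
      map_mul' := fun x y => by simp [mul_assoc]
      map_zero' := by simp
      map_add' := fun x y => by simp [mul_add, add_mul]
      commutes' := fun c => by rw [mul_assoc, Algebra.commutes, ← mul_assoc]; simp }
    (by ext x; simp [mul_assoc]) (by ext x; simp [mul_assoc])

theorem conjEquiv_apply (u : Bˣ) (x : B) : conjEquiv (A := A) u x = (u⁻¹ : Bˣ) * x * u := rfl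

theorem mem_map_conjEquiv {u : Bˣ} {Λ : Subalgebra A B} {x : B} :
    x ∈ Λ.map ((conjEquiv u : B ≃ₐ[A] B) : B →ₐ[A] B) ↔ u * x * (u⁻¹ : Bˣ) ∈ Λ := by
  constructor
  · rintro ⟨y, hy, rfl⟩
    change u * ((u⁻¹ : Bˣ) * y * u) * (u⁻¹ : Bˣ) ∈ Λ
    simpa [mul_assoc] using hy
  · exact fun h => ⟨_, h, by
      change (u⁻¹ : Bˣ) * (u * x * (u⁻¹ : Bˣ)) * u = x
      simp [mul_assoc]⟩

end Transport

section Blocks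

theorem card_blockIndex (l : List ℕ) : Fintype.card (BlockIndex l) = l.sum := by
  rw [Fintype.card_sigma]
  simp only [Fintype.card_fin]
  exact (Fin.sum_univ_def _).trans (by simp)

theorem sum_filter_ne_zero (l : List ℕ) : (l.filter (fun k => k ≠ 0)).sum = l.sum := by
  induction l with
  | nil => rfl
  | cons a l ih =>
    rcases eq_or_ne a 0 with rfl | h
    · simpa using ih
    · rw [List.filter_cons_of_pos (by simpa using h), List.sum_cons, List.sum_cons, ih]

/-- Omitting the empty blocks does not change the positions or their order. -/
theorem exists_blockIndex_filter_equiv (l : List ℕ) :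
    ∃ e : BlockIndex (l.filter (fun k => k ≠ 0)) ≃ BlockIndex l,
      ∀ a b, (e a).1 ≤ (e b).1 ↔ a.1 ≤ b.1 := by
  obtain ⟨f, hf⟩ := List.sublist_iff_exists_fin_orderEmbedding_get_eq.1
    (List.filter_sublist (p := fun k => decide (k ≠ 0)) (l := l))
  let e : BlockIndex (l.filter (fun k => k ≠ 0)) → BlockIndex l :=
    fun a => ⟨f a.1, Fin.cast (hf a.1) a.2⟩
  have hinj : Function.Injective e := by
    rintro ⟨i, x⟩ ⟨j, y⟩ h
    have h1 : f i = f j := congrArg Sigma.fst h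
    obtain rfl := f.injective h1
    have h2 := eq_of_heq (Sigma.mk.inj h).2
    have h3 := congrArg Fin.val h2
    have h4 : x = y := Fin.ext h3
    rw [h4]
  have hcard : Fintype.card (BlockIndex (l.filter (fun k => k ≠ 0))) =
      Fintype.card (BlockIndex l) := by
    rw [card_blockIndex, card_blockIndex, sum_filter_ne_zero]
  refine ⟨Equiv.ofBijective e ((Fintype.bijective_iff_injective_and_card e).2 ⟨hinj, hcard⟩),
    fun a b => f.le_iff_le⟩

/-- The positions sorted into blocks of sizes `g`, empty blocks being omitted. -/
theorem exists_sigma_equiv_blockIndex {n : ℕ} (g : Fin n → ℕ) :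
    ∃ e : (Σ i, Fin (g i)) ≃ BlockIndex ((List.ofFn g).filter (fun k => k ≠ 0)),
      ∀ a b, (e a).1 ≤ (e b).1 ↔ a.1 ≤ b.1 := by
  obtain ⟨e, he⟩ := exists_blockIndex_filter_equiv (List.ofFn g)
  have hlen : n = (List.ofFn g).length := (List.length_ofFn).symm
  let e' : (Σ i, Fin (g i)) ≃ BlockIndex (List.ofFn g) :=
    (finCongr hlen).sigmaCongr fun i => finCongr (by simp)
  refine ⟨e'.trans e.symm, fun a b => ?_⟩
  rw [← he, Equiv.trans_apply, Equiv.trans_apply, Equiv.apply_symm_apply, Equiv.apply_symm_apply]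
  exact Iff.rfl

/-- A finite set with a rank function is a set of positions, sorted into one block for each rank
that occurs. -/
theorem exists_equiv_blockIndex {ι : Type*} [Fintype ι] {n : ℕ} (t : ι → Fin n) :
    ∃ e : ι ≃ BlockIndex ((List.ofFn fun i => Nat.card {a // t a = i}).filter (fun k => k ≠ 0)),
      ∀ a b, (e a).1 ≤ (e b).1 ↔ t a ≤ t b := by
  obtain ⟨e, he⟩ := exists_sigma_equiv_blockIndex fun i => Nat.card {a // t a = i}
  let e' : ι ≃ Σ i, Fin (Nat.card {a // t a = i}) :=
    (Equiv.sigmaFiberEquiv t).symm.trans (Equiv.sigmaCongrRight fun i => Finite.equivFin _)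
  exact ⟨e'.trans e, fun a b => he _ _⟩

end Blocks

section Structure

variable {F : Type*} [Field F] {O : Subring F} {Δ : Type*} [DivisionRing Δ] [Algebra F Δ]
  {ι : Type*} [Fintype ι] [DecidableEq ι] {Λ : Subalgebra O (Matrix ι ι Δ)}

/-- A hereditary order is conjugate to one that contains the diagonal matrix units, since it splits
into row lattices. -/
theorem exists_conj_single_mem [IsNoetherianRing O] (hΛ : HasDualBases Λ)
    (hfull : IsFullLattice (Subalgebra.toSubmodule Λ)) :
    ∃ u : (Matrix ι ι Δ)ˣ, ∀ a : ι, (Matrix.single a a 1 : Matrix ι ι Δ) ∈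
      Λ.map ((conjEquiv u : Matrix ι ι Δ ≃ₐ[O] Matrix ι ι Δ) : Matrix ι ι Δ →ₐ[O] Matrix ι ι Δ) := by
  obtain ⟨α, N, -, h⟩ := exists_unit_forall_mem_iff hΛ hfull fun Y hY X hX => Λ.mul_mem hY hX
  refine ⟨α, fun a => mem_map_conjEquiv.2 ?_⟩
  have h1 : ((α⁻¹ : (Matrix ι ι Δ)ˣ) : Matrix ι ι Δ) ∈ rowsIn N :=
    (h _).1 (by rw [Units.mul_inv]; exact Λ.one_mem)
  rw [mul_assoc]
  refine (h _).2 (mem_rowsIn.2 fun b => ?_)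
  rcases eq_or_ne b a with rfl | hb
  · convert mem_rowsIn.1 h1 b using 1
    funext j
    simp
  · convert (N b).zero_mem using 1
    funext j
    simp [Matrix.single_mul_apply_of_ne, hb]

/-- The row vectors that occur as `a`-th rows in `Λ`. -/
def rowModule (Λ : Subalgebra O (Matrix ι ι Δ)) (a : ι) : Submodule O (ι → Δ) :=
  (Subalgebra.toSubmodule Λ).map (LinearMap.proj a : (ι → ι → Δ) →ₗ[O] ι → Δ)

theorem isRowLattice_rowModule (hfull : IsFullLattice (Subalgebra.toSubmodule Λ)) (a : ι) :
    IsRowLattice Λ (rowModule Λ a) where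
  toIsFullLattice := hfull.map fun y => ⟨fun _ => y, rfl⟩
  vecMul_mem := by
    rintro _ ⟨Y, hY, rfl⟩ X hX
    exact ⟨Matrix.of Y * X, Λ.mul_mem hY hX, rfl⟩

theorem single_mem_of_mem (hE : ∀ a : ι, (Matrix.single a a 1 : Matrix ι ι Δ) ∈ Λ)
    {Y : Matrix ι ι Δ} (hY : Y ∈ Λ) (a b : ι) : Matrix.single a b (Y a b) ∈ Λ := by
  have h := Λ.mul_mem (Λ.mul_mem (hE a) hY) (hE b)
  rwa [Matrix.single_mul_mul_single, one_mul, mul_one] at h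

theorem mem_iff_forall_single_mem (hE : ∀ a : ι, (Matrix.single a a 1 : Matrix ι ι Δ) ∈ Λ)
    {Y : Matrix ι ι Δ} : Y ∈ Λ ↔ ∀ a b, Matrix.single a b (Y a b) ∈ Λ := by
  refine ⟨fun hY a b => single_mem_of_mem hE hY a b, fun h => ?_⟩
  rw [Matrix.matrix_eq_sum_single Y]
  exact Λ.sum_mem fun a _ => Λ.sum_mem fun b _ => h a b

theorem mem_rowModule (hE : ∀ a : ι, (Matrix.single a a 1 : Matrix ι ι Δ) ∈ Λ) {a : ι}
    {y : ι → Δ} : y ∈ rowModule Λ a ↔ ∀ b, Matrix.single a b (y b) ∈ Λ := by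
  constructor
  · rintro ⟨Y, hY, rfl⟩ b
    exact single_mem_of_mem hE hY a b
  · intro h
    refine ⟨∑ b, Matrix.single a b (y b), Λ.sum_mem fun b _ => h b, ?_⟩
    funext j
    change (∑ b, Matrix.single a b (y b)) a j = y j
    rw [Matrix.sum_apply, Finset.sum_eq_single j]
    · rw [Matrix.single_apply_same]
    · intro b _ hb
      exact Matrix.single_apply_of_col_ne _ _ hb _
    · simp

theorem pi_single_mem_rowModule (hE : ∀ a : ι, (Matrix.single a a 1 : Matrix ι ι Δ) ∈ Λ) {a b : ι}
    {x : Δ} : Pi.single b x ∈ rowModule Λ a ↔ Matrix.single a b x ∈ Λ := by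
  rw [mem_rowModule hE]
  refine ⟨fun h => by simpa using h b, fun h c => ?_⟩
  rcases eq_or_ne c b with rfl | hc
  · simpa using h
  · rw [Pi.single_eq_of_ne hc, Matrix.single_zero]
    exact Λ.zero_mem

theorem single_mul_mem {a b c : ι} {x y : Δ} (hx : Matrix.single a b x ∈ Λ)
    (hy : Matrix.single b c y ∈ Λ) : Matrix.single a c (x * y) ∈ Λ := by
  have := Λ.mul_mem hx hy
  rwa [Matrix.single_mul_single_same] at this

theorem isIntegral_of_single_mem (hfull : IsFullLattice (Subalgebra.toSubmodule Λ))
    (hE : ∀ a : ι, (Matrix.single a a 1 : Matrix ι ι Δ) ∈ Λ) {a : ι} {x : Δ}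
    (hx : Matrix.single a a x ∈ Λ) : IsIntegral O x := by
  have h1 := isRowLattice_rowModule hfull a
  let f : (ι → Δ) →ₗ[O] Δ := LinearMap.proj a
  refine isIntegral_of_forall_smul_mem (N := (rowModule Λ a).map f) (h1.fg.map f) ?_ ?_
  · refine (Submodule.ne_bot_iff _).2 ⟨1, ⟨Pi.single a 1, (pi_single_mem_rowModule hE).2 (hE a), ?_⟩,
      one_ne_zero⟩
    exact Pi.single_eq_same (M := fun _ => Δ) a 1
  · rintro _ ⟨y, hy, rfl⟩
    refine ⟨Pi.single a (x * y a), (pi_single_mem_rowModule hE).2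
      (single_mul_mem hx ((mem_rowModule hE).1 hy a)), ?_⟩
    exact Pi.single_eq_same (M := fun _ => Δ) a _

variable [FiniteDimensional F Δ]

/-- A finitely generated module over the maximal order in `Δ` is generated by one element. -/
theorem IsLocalFieldBase.exists_generator (hO : IsLocalFieldBase O) {X : Submodule O Δ}
    (hX : X.FG) (hX0 : X ≠ ⊥) :
    ∃ c ∈ X, c ≠ 0 ∧ ∀ x ∈ X, IsIntegral O (x * c⁻¹) := by
  obtain ⟨S, rfl⟩ := hX
  have key : ∀ S : Finset Δ, (∀ x ∈ S, x = 0) ∨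
      ∃ c ∈ S, c ≠ 0 ∧ ∀ x ∈ S, IsIntegral O (x * c⁻¹) := by
    classical
    intro S
    induction S using Finset.induction_on with
    | empty => exact Or.inl (by simp)
    | insert a S _ ih =>
      rcases eq_or_ne a 0 with rfl | ha
      · rcases ih with h | ⟨c, hc, hc0, h⟩
        · exact Or.inl (by simpa using h)
        · exact Or.inr ⟨c, Finset.mem_insert_of_mem hc, hc0, by
            simpa [isIntegral_zero] using h⟩
      right
      have haa : IsIntegral O (a * a⁻¹) := by rw [mul_inv_cancel₀ ha]; exact isIntegral_one
      rcases ih with h | ⟨c, hc, hc0, h⟩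
      · refine ⟨a, Finset.mem_insert_self a S, ha, fun x hx => ?_⟩
        rcases Finset.mem_insert.1 hx with rfl | hx
        · exact haa
        · rw [h x hx, zero_mul]; exact isIntegral_zero
      · rcases hO.isIntegral_or_inv (a * c⁻¹) with h1 | h1
        · refine ⟨c, Finset.mem_insert_of_mem hc, hc0, fun x hx => ?_⟩
          rcases Finset.mem_insert.1 hx with rfl | hx
          · exact h1
          · exact h x hx
        · refine ⟨a, Finset.mem_insert_self a S, ha, fun x hx => ?_⟩
          rcases Finset.mem_insert.1 hx with rfl | hx
          · exact haa
          · have h2 := hO.isIntegral_mul (h x hx) h1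
            rwa [mul_inv_rev, inv_inv, mul_assoc, inv_mul_cancel_left₀ hc0] at h2
  rcases key S with h | ⟨c, hc, hc0, h⟩
  · exact absurd (Submodule.span_eq_bot.2 h) hX0
  · refine ⟨c, Submodule.subset_span hc, hc0, fun x hx => ?_⟩
    induction hx using Submodule.span_induction with
    | mem x hx => exact h x hx
    | zero => rw [zero_mul]; exact isIntegral_zero
    | add x y _ _ hx hy => rw [add_mul]; exact hO.isIntegral_add hx hy
    | smul a x _ hx => rw [smul_mul_assoc]; exact hx.smul a

/-- The set of the possible `(a, b)` entries is a left module over the maximal order. -/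
theorem IsLocalFieldBase.single_smul_mem (hO : IsLocalFieldBase O) (hΛ : HasDualBases Λ)
    (hfull : IsFullLattice (Subalgebra.toSubmodule Λ))
    (hE : ∀ a : ι, (Matrix.single a a 1 : Matrix ι ι Δ) ∈ Λ) {a b : ι} {w x : Δ}
    (hw : IsIntegral O w) (hx : Matrix.single a b x ∈ Λ) : Matrix.single a b (w * x) ∈ Λ := by
  rw [← pi_single_mem_rowModule hE] at hx ⊢
  have h := hO.smul_mem_isRowLattice hΛ (isRowLattice_rowModule hfull a) hw hx
  rwa [← Pi.single_smul, smul_eq_mul] at h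

/-- After rescaling the coordinates, a given row of `Λ` consists of all vectors over the maximal
order. -/
theorem IsLocalFieldBase.exists_conj_row_eq (hO : IsLocalFieldBase O) (hΛ : HasDualBases Λ)
    (hfull : IsFullLattice (Subalgebra.toSubmodule Λ))
    (hE : ∀ a : ι, (Matrix.single a a 1 : Matrix ι ι Δ) ∈ Λ) (a₀ : ι) :
    ∃ u : (Matrix ι ι Δ)ˣ, (∀ a : ι, (Matrix.single a a 1 : Matrix ι ι Δ) ∈
      Λ.map ((conjEquiv u : Matrix ι ι Δ ≃ₐ[O] Matrix ι ι Δ) : Matrix ι ι Δ →ₐ[O] Matrix ι ι Δ)) ∧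
      ∀ b x, (Matrix.single a₀ b x : Matrix ι ι Δ) ∈ Λ.map ((conjEquiv u :
        Matrix ι ι Δ ≃ₐ[O] Matrix ι ι Δ) : Matrix ι ι Δ →ₐ[O] Matrix ι ι Δ) ↔ IsIntegral O x := by
  have h1 : ∀ b, ∃ c : Δ, c ≠ 0 ∧ ∀ x, Matrix.single a₀ b x ∈ Λ ↔ IsIntegral O (x * c⁻¹) := by
    intro b
    let f : (ι → Δ) →ₗ[O] Δ := LinearMap.proj b
    have hX := ((isRowLattice_rowModule hfull a₀).toIsFullLattice).map (f := f)
      (fun x => ⟨fun _ => x, rfl⟩)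
    obtain ⟨c, ⟨y, hy, hyc⟩, hc0, hc⟩ := hO.exists_generator hX.fg hX.ne_bot
    refine ⟨c, hc0, fun x => ⟨fun hx => hc x ?_, fun hx => ?_⟩⟩
    · exact ⟨Pi.single b x, (pi_single_mem_rowModule hE).2 hx,
        Pi.single_eq_same (M := fun _ => Δ) b x⟩
    · have h2 : Matrix.single a₀ b c ∈ Λ := by
        rw [← hyc]
        exact (mem_rowModule hE).1 hy b
      have h3 := hO.single_smul_mem hΛ hfull hE hx h2
      rwa [inv_mul_cancel_right₀ hc0] at h3
  choose c hc0 hc using h1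
  -- the generator of the diagonal entry is a unit of the maximal order
  have hca : IsIntegral O (c a₀) ∧ IsIntegral O (c a₀)⁻¹ := by
    refine ⟨isIntegral_of_single_mem hfull hE ((hc a₀ _).2 ?_), ?_⟩
    · rw [mul_inv_cancel₀ (hc0 a₀)]; exact isIntegral_one
    · have := (hc a₀ 1).1 (hE a₀)
      rwa [one_mul] at this
  let u : (Matrix ι ι Δ)ˣ := ⟨Matrix.diagonal fun b => (c b)⁻¹, Matrix.diagonal c,
    by rw [Matrix.diagonal_mul_diagonal]; simp [hc0],
    by rw [Matrix.diagonal_mul_diagonal]; simp [hc0]⟩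
  have hu : ∀ a b x, (u : Matrix ι ι Δ) * Matrix.single a b x * ((u⁻¹ : (Matrix ι ι Δ)ˣ) :
      Matrix ι ι Δ) = Matrix.single a b ((c a)⁻¹ * x * c b) := by
    intro a b x
    change Matrix.diagonal (fun b => (c b)⁻¹) * Matrix.single a b x * Matrix.diagonal c = _
    ext i j
    rw [Matrix.mul_diagonal, Matrix.diagonal_mul, Matrix.single_apply, Matrix.single_apply]
    split_ifs with h
    · rw [h.1, h.2]
    · simp
  refine ⟨u, fun a => mem_map_conjEquiv.2 ?_, fun b x => ?_⟩
  · rw [hu, mul_one, inv_mul_cancel₀ (hc0 a)]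
    exact hE a
  · rw [mem_map_conjEquiv, hu, hc, mul_inv_cancel_right₀ (hc0 b)]
    refine ⟨fun h => ?_, fun h => hO.isIntegral_mul hca.2 h⟩
    have := hO.isIntegral_mul hca.1 h
    rwa [mul_inv_cancel_left₀ (hc0 a₀)] at this

/-- Each entry of `Λ` runs through the maximal order or through its maximal ideal, and which of
the two occurs is described by a total preorder on the indices. -/
theorem IsLocalFieldBase.exists_rank (hO : IsLocalFieldBase O) (hΛ : HasDualBases Λ)
    (hfull : IsFullLattice (Subalgebra.toSubmodule Λ))
    (hE : ∀ a : ι, (Matrix.single a a 1 : Matrix ι ι Δ) ∈ Λ) {a₀ : ι}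
    (ha₀ : ∀ b x, (Matrix.single a₀ b x : Matrix ι ι Δ) ∈ Λ ↔ IsIntegral O x) :
    ∃ t : ι → Fin (Fintype.card ι + 1), ∀ Y, Y ∈ Λ ↔ ∀ a b,
      (t a ≤ t b → Y a b ∈ maxOrder O Δ) ∧ (t b < t a → Y a b ∈ maxIdeal O Δ) := by
  have hint : ∀ a b x, Matrix.single a b x ∈ Λ → IsIntegral O x := fun a b x hx => by
    have := single_mul_mem ((ha₀ a 1).2 isIntegral_one) hx
    rwa [one_mul, ha₀] at this
  have hcomp : ∀ a b, Matrix.single a b (1 : Δ) ∈ Λ ∨ Matrix.single b a (1 : Δ) ∈ Λ := by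
    intro a b
    rcases hO.isRowLattice_le_or_le hΛ (isRowLattice_rowModule hfull a)
      (isRowLattice_rowModule hfull b) with h | h
    · exact Or.inr ((pi_single_mem_rowModule hE).1 (h ((pi_single_mem_rowModule hE).2 (hE a))))
    · exact Or.inl ((pi_single_mem_rowModule hE).1 (h ((pi_single_mem_rowModule hE).2 (hE b))))
  have hP : ∀ a b x, x ∈ maxIdeal O Δ → Matrix.single a b x ∈ Λ := by
    intro a b x hx
    rcases eq_or_ne x 0 with rfl | hx0
    · rw [Matrix.single_zero]; exact Λ.zero_mem
    have hx' : ¬ IsIntegral O x⁻¹ := (hO.mem_maxIdeal.1 hx).resolve_left hx0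
    rcases hO.isRowLattice_le_or_le hΛ (isRowLattice_rowModule hfull a)
      ((isRowLattice_rowModule hfull a₀).smulRow hx0) with h | h
    · have h1 := (mem_smulRow hx0).1 (h ((pi_single_mem_rowModule hE).2 (hE a)))
      rw [← Pi.single_smul, pi_single_mem_rowModule hE, ha₀, smul_eq_mul, mul_one] at h1
      exact absurd h1 hx'
    · rw [← pi_single_mem_rowModule hE]
      apply h
      rw [mem_smulRow hx0, ← Pi.single_smul, pi_single_mem_rowModule hE, ha₀, smul_eq_mul,
        inv_mul_cancel₀ hx0]
      exact isIntegral_one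
  have hone : ∀ a b, Matrix.single a b (1 : Δ) ∈ Λ → ∀ x, Matrix.single a b x ∈ Λ ↔
      x ∈ maxOrder O Δ := fun a b h x => ⟨hint a b x, fun hx => by
    have := hO.single_smul_mem hΛ hfull hE hx h
    rwa [mul_one] at this⟩
  have hzero : ∀ a b, Matrix.single a b (1 : Δ) ∉ Λ → ∀ x, Matrix.single a b x ∈ Λ ↔
      x ∈ maxIdeal O Δ := fun a b h x => ⟨fun hx => by
    by_contra hxP
    have := hO.single_smul_mem hΛ hfull hE (hO.isIntegral_inv_of_notMem hxP) hx
    rw [inv_mul_cancel₀ (ne_zero_of_notMem_maxIdeal hxP)] at this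
    exact h this, hP a b x⟩
  have htrans : ∀ a b c, Matrix.single a b (1 : Δ) ∈ Λ → Matrix.single b c (1 : Δ) ∈ Λ →
      Matrix.single a c (1 : Δ) ∈ Λ := fun a b c h h' => by
    have := single_mul_mem h h'
    rwa [one_mul] at this
  classical
  -- the rank of `a` is the number of its predecessors
  let t : ι → ℕ := fun a => (Finset.univ.filter fun b => Matrix.single b a (1 : Δ) ∈ Λ).card
  have ht : ∀ a b, t a ≤ t b ↔ Matrix.single a b (1 : Δ) ∈ Λ := by
    intro a b
    constructor
    · intro h
      by_contra hab
      have hba := (hcomp a b).resolve_left hab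
      refine absurd h (not_le.2 (Finset.card_lt_card ⟨fun c hc => ?_, fun h' => ?_⟩))
      · rw [Finset.mem_filter] at hc ⊢
        exact ⟨hc.1, htrans _ _ _ hc.2 hba⟩
      · have := h' (Finset.mem_filter.2 ⟨Finset.mem_univ a, hE a⟩)
        exact hab (Finset.mem_filter.1 this).2
    · intro h
      refine Finset.card_le_card fun c hc => ?_
      rw [Finset.mem_filter] at hc ⊢
      exact ⟨hc.1, htrans _ _ _ hc.2 h⟩
  refine ⟨fun a => ⟨t a, Nat.lt_succ_of_le (Finset.card_le_univ _)⟩, fun Y => ?_⟩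
  rw [mem_iff_forall_single_mem hE]
  refine forall_congr' fun a => forall_congr' fun b => ?_
  simp only [Fin.mk_le_mk, ← not_le, ht]
  by_cases hab : Matrix.single a b (1 : Δ) ∈ Λ
  · rw [hone a b hab]
    exact ⟨fun h => ⟨fun _ => h, fun h' => absurd hab h'⟩, fun h => h.1 hab⟩
  · rw [hzero a b hab]
    exact ⟨fun h => ⟨fun h' => absurd h' hab, fun _ => h⟩, fun h => h.2 hab⟩

/-- A local hereditary order is isomorphic to a standard order of block matrices. After conjugation it
contains the diagonal matrix units and one of its rows consists of all vectors over the maximal order;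
the remaining entries are then described by a total preorder, whose classes are the blocks. -/
theorem IsLocalFieldBase.exists_image_eq_standardOrder [Nonempty ι] (hO : IsLocalFieldBase O)
    (hΛ : HasDualBases Λ) (hfull : IsFullLattice (Subalgebra.toSubmodule Λ)) :
    ∃ f : List ℕ, (∀ k ∈ f, 0 < k) ∧
      ∃ ψ : Matrix ι ι Δ ≃ₐ[F] Matrix (BlockIndex f) (BlockIndex f) Δ,
        ψ '' (Λ : Set (Matrix ι ι Δ)) = standardOrder O Δ f := by
  have := hO.hasFiniteQuotients
  obtain ⟨u, hu⟩ := exists_conj_single_mem hΛ hfull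
  set Λ₁ := Λ.map ((conjEquiv u : Matrix ι ι Δ ≃ₐ[O] Matrix ι ι Δ) :
    Matrix ι ι Δ →ₐ[O] Matrix ι ι Δ) with hΛ₁
  have hfull₁ : IsFullLattice (Subalgebra.toSubmodule Λ₁) :=
    hfull.map_subalgebra _
  have hdual₁ : HasDualBases Λ₁ := hΛ.map _
  obtain ⟨w, hw, hw'⟩ := hO.exists_conj_row_eq hdual₁ hfull₁ hu (Classical.arbitrary ι)
  set Λ₂ := Λ₁.map ((conjEquiv w : Matrix ι ι Δ ≃ₐ[O] Matrix ι ι Δ) :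
    Matrix ι ι Δ →ₐ[O] Matrix ι ι Δ) with hΛ₂
  have hfull₂ : IsFullLattice (Subalgebra.toSubmodule Λ₂) :=
    hfull₁.map_subalgebra _
  obtain ⟨t, ht⟩ := hO.exists_rank (hdual₁.map _ : HasDualBases Λ₂) hfull₂ hw hw'
  obtain ⟨e, he⟩ := exists_equiv_blockIndex t
  refine ⟨_, fun k hk => Nat.pos_of_ne_zero (by simpa using (List.mem_filter.1 hk).2),
    ((conjEquiv u).trans (conjEquiv w)).trans (Matrix.reindexAlgEquiv F Δ e), ?_⟩
  ext Z
  have h1 : Z ∈ standardOrder O Δ _ ↔ (Matrix.reindexAlgEquiv F Δ e).symm Z ∈ Λ₂ := by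
    rw [ht]
    constructor
    · intro h a b
      simp only [← he, ← not_le] at h ⊢
      exact ⟨fun h' => (h (e a) (e b)).1 h', fun h' => (h (e a) (e b)).2 (not_le.1 h')⟩
    · intro h a b
      have h2 := h (e.symm a) (e.symm b)
      rw [← not_le, ← he, Equiv.apply_symm_apply, Equiv.apply_symm_apply, not_le] at h2
      have h3 : (Matrix.reindexAlgEquiv F Δ e).symm Z (e.symm a) (e.symm b) = Z a b := by
        simp
      rwa [h3] at h2
  rw [h1]
  constructor
  · rintro ⟨Y, hY, rfl⟩
    rw [AlgEquiv.trans_apply, AlgEquiv.symm_apply_apply]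
    exact ⟨_, ⟨Y, hY, rfl⟩, rfl⟩
  · rintro ⟨_, ⟨Y, hY, rfl⟩, hYZ⟩
    refine ⟨Y, hY, ?_⟩
    rw [AlgEquiv.trans_apply, ← AlgEquiv.eq_symm_apply]
    exact hYZ

end Structure

/-! ### Lattices over standard orders -/

section StandardRows

variable {F : Type*} [Field F] {O : Subring F} {Δ : Type*} [DivisionRing Δ] [Algebra F Δ]

variable {f : List ℕ}

theorem single_mem_standardOrder {a b : BlockIndex f} {x : Δ} :
    Matrix.single a b x ∈ standardOrder O Δ f ↔
      (a.1 ≤ b.1 → x ∈ maxOrder O Δ) ∧ (b.1 < a.1 → x ∈ maxIdeal O Δ) := by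
  constructor
  · intro h
    simpa using h a b
  · intro h i j
    by_cases hij : a = i ∧ b = j
    · obtain ⟨rfl, rfl⟩ := hij
      simpa using h
    · rw [Matrix.single_apply_of_ne _ _ _ _ _ hij]
      exact ⟨fun _ => isIntegral_zero, fun _ => zero_mem_maxIdeal⟩

theorem vecMul_single_one {ι : Type*} [Fintype ι] [DecidableEq ι] (y : ι → Δ) (a b : ι) (x : Δ) :
    Matrix.vecMul y (Matrix.single a b x) = Pi.single b (y a * x) := by
  funext j
  rw [Matrix.vecMul, dotProduct, Finset.sum_eq_single a]
  · rcases eq_or_ne j b with rfl | h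
    · simp
    · rw [Matrix.single_apply_of_col_ne _ _ h.symm, mul_zero, Pi.single_eq_of_ne h]
  · intro c _ hc
    rw [Matrix.single_apply_of_row_ne hc.symm, mul_zero]
  · simp

variable [FiniteDimensional F Δ]

variable (Δ) in
/-- The row vectors over the maximal order whose entries in the first `i` blocks lie in the
maximal ideal. -/
def IsLocalFieldBase.stdRow (hO : IsLocalFieldBase O) (f : List ℕ) (i : ℕ) :
    Submodule O (BlockIndex f → Δ) where
  carrier := {y | ∀ b : BlockIndex f, ((b.1 : ℕ) < i → y b ∈ maxIdeal O Δ) ∧ IsIntegral O (y b)}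
  zero_mem' b := ⟨fun _ => zero_mem_maxIdeal, isIntegral_zero⟩
  add_mem' hx hy b := ⟨fun h => hO.add_mem_maxIdeal ((hx b).1 h) ((hy b).1 h),
    hO.isIntegral_add (hx b).2 (hy b).2⟩
  smul_mem' c y hy b := by
    have hc : IsIntegral O (algebraMap O Δ c) := isIntegral_algebraMap
    refine ⟨fun h => ?_, ?_⟩
    · rw [Pi.smul_apply, Algebra.smul_def]
      exact hO.mul_mem_maxIdeal_left hc ((hy b).1 h)
    · rw [Pi.smul_apply, Algebra.smul_def]
      exact hO.isIntegral_mul hc (hy b).2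

theorem IsLocalFieldBase.mem_stdRow (hO : IsLocalFieldBase O) {f : List ℕ} {i : ℕ}
    {y : BlockIndex f → Δ} : y ∈ hO.stdRow Δ f i ↔
      ∀ b : BlockIndex f, ((b.1 : ℕ) < i → y b ∈ maxIdeal O Δ) ∧ IsIntegral O (y b) := Iff.rfl

theorem IsLocalFieldBase.pi_single_mem_stdRow (hO : IsLocalFieldBase O) {f : List ℕ} {i : ℕ}
    {b : BlockIndex f} {x : Δ} : Pi.single b x ∈ hO.stdRow Δ f i ↔
      ((b.1 : ℕ) < i → x ∈ maxIdeal O Δ) ∧ IsIntegral O x := by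
  refine ⟨fun h => by simpa using h b, fun h c => ?_⟩
  rcases eq_or_ne c b with rfl | hc
  · simpa using h
  · rw [Pi.single_eq_of_ne hc]
    exact ⟨fun _ => zero_mem_maxIdeal, isIntegral_zero⟩

theorem IsLocalFieldBase.smul_mem_stdRow (hO : IsLocalFieldBase O) {f : List ℕ} {i j : ℕ}
    {y : BlockIndex f → Δ} (hy : y ∈ hO.stdRow Δ f j) {x : Δ} (hx : IsIntegral O x)
    (hij : j < i → x ∈ maxIdeal O Δ) : x • y ∈ hO.stdRow Δ f i := by
  refine fun b => ⟨fun hb => ?_, hO.isIntegral_mul hx (hy b).2⟩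
  rcases lt_or_ge (b.1 : ℕ) j with h | h
  · exact hO.mul_mem_maxIdeal_left hx ((hy b).1 h)
  · exact hO.mul_mem_maxIdeal_right (hij (h.trans_lt hb)) (hy b).2

variable {Λ : Subalgebra O (Matrix (BlockIndex f) (BlockIndex f) Δ)}

/-- The row lattices over a standard order are, up to scaling, the standard ones. -/
theorem IsLocalFieldBase.exists_smul_stdRow (hO : IsLocalFieldBase O) [Nonempty (BlockIndex f)]
    (hstd : (Λ : Set (Matrix (BlockIndex f) (BlockIndex f) Δ)) = standardOrder O Δ f)
    (hΛ : HasDualBases Λ) {N : Submodule O (BlockIndex f → Δ)} (hN : IsRowLattice Λ N) :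
    ∃ c : Δ, c ≠ 0 ∧ ∃ i : Fin f.length, ∀ y, c • y ∈ N ↔ y ∈ hO.stdRow Δ f i := by
  have hΛmem : ∀ a b x, Matrix.single a b x ∈ Λ ↔
      (a.1 ≤ b.1 → x ∈ maxOrder O Δ) ∧ (b.1 < a.1 → x ∈ maxIdeal O Δ) := fun a b x => by
    rw [← single_mem_standardOrder, ← hstd]; rfl
  obtain ⟨m, hm⟩ := Finite.exists_max (fun b : BlockIndex f => b.1)
  -- rescale so that the entries in the last block form the maximal order
  let p : (BlockIndex f → Δ) →ₗ[O] Δ := LinearMap.proj m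
  have hX := hN.toIsFullLattice.map (f := p) fun x => ⟨fun _ => x, rfl⟩
  obtain ⟨c, ⟨y₀, hy₀, hyc⟩, hc0, hc⟩ := hO.exists_generator hX.fg hX.ne_bot
  have hM : IsRowLattice Λ (smulRow c⁻¹ N) := hN.smulRow (inv_ne_zero hc0)
  set M := smulRow c⁻¹ N with hMdef
  have hMN : ∀ y, y ∈ M ↔ c • y ∈ N := fun y => by rw [mem_smulRow (inv_ne_zero hc0), inv_inv]
  have hmove : ∀ y ∈ M, ∀ a b x, Matrix.single a b x ∈ Λ → Pi.single b (y a * x) ∈ M := by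
    intro y hy a b x hx
    rw [← vecMul_single_one]
    exact hM.vecMul_mem y hy _ hx
  have hone : ∀ a b : BlockIndex f, a.1 ≤ b.1 → Matrix.single a b (1 : Δ) ∈ Λ := fun a b h =>
    (hΛmem a b 1).2 ⟨fun _ => isIntegral_one, fun h' => absurd h (not_le.2 h')⟩
  have hint : ∀ y ∈ M, ∀ b, IsIntegral O (y b) := by
    intro y hy b
    have h1 := hmove y hy b m 1 (hone b m (hm b))
    rw [mul_one, hMN] at h1
    have h2 := hc _ ⟨_, h1, rfl⟩
    have h3 : p (c • Pi.single m (y b)) = c * y b := by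
      change c * Pi.single (M := fun _ => Δ) m (y b) m = c * y b
      rw [Pi.single_eq_same]
    rwa [h3, hO.isIntegral_conj hc0] at h2
  have hmm : Pi.single m 1 ∈ M := by
    have h1 : c⁻¹ • y₀ ∈ M := by rwa [hMN, smul_smul, mul_inv_cancel₀ hc0, one_smul]
    have h2 := hmove _ h1 m m 1 (hone m m le_rfl)
    have h3 : y₀ m = c := hyc
    rwa [Pi.smul_apply, h3, smul_eq_mul, inv_mul_cancel₀ hc0, one_mul] at h2
  have hP : ∀ b, ∀ x ∈ maxIdeal O Δ, Pi.single b x ∈ M := by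
    intro b x hx
    have h1 := hmove _ hmm m b x ((hΛmem m b x).2 ⟨fun _ => hx.1, fun _ => hx⟩)
    rwa [Pi.single_eq_same, one_mul] at h1
  have hW : ∀ b, Pi.single b 1 ∈ M → ∀ x, IsIntegral O x → Pi.single b x ∈ M := by
    intro b hb x hx
    have := hO.smul_mem_isRowLattice hΛ hM hx hb
    rwa [← Pi.single_smul, smul_eq_mul, mul_one] at this
  have hmemM : ∀ y, y ∈ M ↔ ∀ b, Pi.single b (y b) ∈ M := by
    intro y
    refine ⟨fun hy b => ?_, fun h => ?_⟩
    · have := hmove y hy b b 1 (hone b b le_rfl)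
      rwa [mul_one] at this
    · rw [← Finset.univ_sum_single y]
      exact M.sum_mem fun b _ => h b
  -- `b₀` lies in the first block whose entries are not confined to the maximal ideal
  obtain ⟨b₀, hb₀, hmin⟩ := Set.exists_min_image
    {b : BlockIndex f | (Pi.single b 1 : BlockIndex f → Δ) ∈ M} (fun b => b.1)
    (Set.toFinite _) ⟨m, hmm⟩
  refine ⟨c, hc0, b₀.1, fun y => ?_⟩
  rw [← hMN, hmemM, hO.mem_stdRow]
  refine forall_congr' fun b => ⟨fun h => ⟨fun hb => ?_, ?_⟩, fun h => ?_⟩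
  · by_contra hyP
    have h1 := hO.smul_mem_isRowLattice hΛ hM (hO.isIntegral_inv_of_notMem hyP) h
    rw [← Pi.single_smul, smul_eq_mul, inv_mul_cancel₀ (ne_zero_of_notMem_maxIdeal hyP)] at h1
    exact absurd (hmin b h1) (not_le.2 hb)
  · have := hint _ h b
    rwa [Pi.single_eq_same] at this
  · rcases lt_or_ge (b.1 : ℕ) b₀.1 with hb | hb
    · exact hP b _ (h.1 hb)
    · have h1 := hmove _ hb₀ b₀ b 1 (hone b₀ b hb)
      rw [Pi.single_eq_same, one_mul] at h1
      exact hW b h1 _ h.2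

/-- The matrices whose `a`-th row lies in the standard module with index `t a`. -/
def IsLocalFieldBase.stdLattice (hO : IsLocalFieldBase O) (t : BlockIndex f → Fin f.length) :
    Submodule O (Matrix (BlockIndex f) (BlockIndex f) Δ) :=
  rowsIn fun a => hO.stdRow Δ f (t a)

/-- Every right lattice over a standard order is isomorphic to a direct sum of standard row
modules. -/
theorem IsLocalFieldBase.exists_unit_mul_mem_iff (hO : IsLocalFieldBase O)
    [Nonempty (BlockIndex f)]
    (hstd : (Λ : Set (Matrix (BlockIndex f) (BlockIndex f) Δ)) = standardOrder O Δ f)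
    (hΛ : HasDualBases Λ) {L : Submodule O (Matrix (BlockIndex f) (BlockIndex f) Δ)}
    (hL : IsFullLattice L) (hLΛ : ∀ Y ∈ L, ∀ X ∈ Λ, Y * X ∈ L) :
    ∃ (α : (Matrix (BlockIndex f) (BlockIndex f) Δ)ˣ) (t : BlockIndex f → Fin f.length),
      ∀ Y : Matrix (BlockIndex f) (BlockIndex f) Δ,
        (α : Matrix (BlockIndex f) (BlockIndex f) Δ) * Y ∈ L ↔ Y ∈ hO.stdLattice t := by
  have := hO.hasFiniteQuotients
  obtain ⟨α, N, hN, h⟩ := exists_unit_forall_mem_iff hΛ hL hLΛ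
  choose c hc0 t ht using fun a => hO.exists_smul_stdRow hstd hΛ (hN a)
  let δ : (Matrix (BlockIndex f) (BlockIndex f) Δ)ˣ := ⟨Matrix.diagonal c,
    Matrix.diagonal fun b => (c b)⁻¹,
    by rw [Matrix.diagonal_mul_diagonal]; simp [hc0],
    by rw [Matrix.diagonal_mul_diagonal]; simp [hc0]⟩
  refine ⟨α * δ, t, fun Y => ?_⟩
  rw [Units.val_mul, mul_assoc, h, mem_rowsIn, stdLattice, mem_rowsIn]
  refine forall_congr' fun a => ?_
  rw [← ht]
  have h1 : ((δ : Matrix (BlockIndex f) (BlockIndex f) Δ) * Y) a = c a • Y a := by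
    funext j
    change (Matrix.diagonal c * Y) a j = c a * Y a j
    rw [Matrix.diagonal_mul]
  rw [h1]

theorem exists_block_eq (hf : ∀ k ∈ f, 0 < k) (i : Fin f.length) : ∃ b : BlockIndex f, b.1 = i :=
  ⟨⟨i, ⟨0, hf _ (List.get_mem f i)⟩⟩, rfl⟩

/-- The left order of a direct sum of standard row modules. -/
theorem IsLocalFieldBase.mem_transporter_stdLattice (hO : IsLocalFieldBase O)
    (hf : ∀ k ∈ f, 0 < k) {t : BlockIndex f → Fin f.length}
    {X : Matrix (BlockIndex f) (BlockIndex f) Δ} :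
    X ∈ transporter (hO.stdLattice (Δ := Δ) t) (hO.stdLattice t) ↔
      ∀ a b, (t a ≤ t b → X a b ∈ maxOrder O Δ) ∧ (t b < t a → X a b ∈ maxIdeal O Δ) := by
  constructor
  · intro h a b
    obtain ⟨c, hc⟩ := exists_block_eq hf (t b)
    have h1 : Pi.single c 1 ∈ hO.stdRow Δ f (t b) := by
      rw [hO.pi_single_mem_stdRow, hc]
      exact ⟨fun h => absurd h (lt_irrefl _), isIntegral_one⟩
    have h2 := mem_rowsIn.1 (h _ (vecMulVec_single_mem_rowsIn
      (N := fun a => hO.stdRow Δ f (t a)) (a := b) h1)) a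
    rw [Matrix.mul_vecMulVec, Matrix.mulVec_single_one] at h2
    have h3 : Matrix.vecMulVec (X.col b) (Pi.single c 1) a c = X a b := by
      rw [Matrix.vecMulVec_apply, Pi.single_eq_same, mul_one]
      rfl
    have h4 := h2 c
    rw [h3, hc] at h4
    exact ⟨fun _ => h4.2, fun h => h4.1 h⟩
  · intro h Y hY
    refine mem_rowsIn.2 fun a => ?_
    have h1 : (X * Y) a = ∑ b, X a b • Y b := by
      funext j
      rw [Matrix.mul_apply, Finset.sum_apply]
      rfl
    rw [h1]
    refine Submodule.sum_mem _ fun b _ => ?_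
    refine hO.smul_mem_stdRow (mem_rowsIn.1 hY b) ?_ fun h' => (h a b).2 h'
    rcases le_or_gt (t a) (t b) with h' | h'
    · exact (h a b).1 h'
    · exact ((h a b).2 h').1

end StandardRows

/-! ### The radical of a standard order -/

section Radical

variable {F : Type*} [Field F] {O : Subring F} {Δ : Type*} [DivisionRing Δ] [Algebra F Δ]
  [FiniteDimensional F Δ] {f : List ℕ} {C : Type*} [Ring C]
  {ψ : C →+* Matrix (BlockIndex f) (BlockIndex f) Δ}

/-- The entries on and below the block diagonal of an element of the radical of a standard order
are not units. -/
theorem IsLocalFieldBase.mem_maxIdeal_of_mem_jacobson (hO : IsLocalFieldBase O)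
    (hψ : Set.range ψ = standardOrder O Δ f) {ρ : C} (hρ : ρ ∈ Ring.jacobson C)
    {a b : BlockIndex f} (hab : b.1 ≤ a.1) : ψ ρ a b ∈ maxIdeal O Δ := by
  have hstd : ψ ρ ∈ standardOrder O Δ f := hψ ▸ Set.mem_range_self ρ
  rcases hab.lt_or_eq with hlt | heq
  · exact (hstd a b).2 hlt
  by_contra hx
  -- otherwise a left multiple of `ρ` is a nonzero idempotent
  have hx0 := ne_zero_of_notMem_maxIdeal hx
  obtain ⟨y, hy⟩ : ∃ y, ψ y = Matrix.single b a (-(ψ ρ a b)⁻¹) := by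
    have h1 : Matrix.single b a (-(ψ ρ a b)⁻¹) ∈ standardOrder O Δ f :=
      single_mem_standardOrder.2 ⟨fun _ => (hO.isIntegral_inv_of_notMem hx).neg,
        fun h => absurd h (not_lt.2 heq.le)⟩
    rwa [← hψ] at h1
  rw [← Ideal.jacobson_bot, Ideal.mem_jacobson_iff] at hρ
  obtain ⟨z, hz⟩ := hρ y
  rw [Ideal.mem_bot] at hz
  have hT : ψ (y * ρ) * ψ (y * ρ) = -ψ (y * ρ) := by
    rw [map_mul, hy, ← mul_assoc, Matrix.single_mul_mul_single, neg_mul, inv_mul_cancel₀ hx0,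
      neg_one_mul, neg_neg]
    ext i j
    rcases eq_or_ne b i with rfl | hi
    · simp
    · rw [Matrix.neg_apply, Matrix.single_mul_apply_of_ne _ _ _ _ _ hi.symm,
        Matrix.single_mul_apply_of_ne _ _ _ _ _ hi.symm, neg_zero]
  have h1 : ψ z * ψ (y * ρ) + ψ z - 1 = 0 := by
    rw [← map_mul, ← mul_assoc, ← map_add, ← map_one ψ, ← map_sub, hz, map_zero]
  have h2 : ψ (y * ρ) = 0 := by
    have h3 := congrArg (· * ψ (y * ρ)) h1
    simp only [sub_mul, add_mul, mul_assoc, hT, one_mul, zero_mul, mul_neg, neg_add_cancel,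
      zero_sub, neg_eq_zero] at h3
    exact h3
  have h3 := congrFun (congrFun h2 b) b
  rw [map_mul, hy, Matrix.single_mul_apply_same, Matrix.zero_apply, neg_mul,
    inv_mul_cancel₀ hx0] at h3
  exact one_ne_zero (neg_eq_zero.1 h3)

/-- An element of the standard order with a single nonzero entry lies in the radical if this entry
is above the block diagonal or in the maximal ideal. -/
theorem IsLocalFieldBase.mem_jacobson_of_eq_single (hO : IsLocalFieldBase O)
    (hinj : Function.Injective ψ) (hψ : Set.range ψ = standardOrder O Δ f) {ρ : C}
    {a b : BlockIndex f} {c : Δ} (hρ : ψ ρ = Matrix.single a b c)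
    (hc : b.1 ≤ a.1 → c ∈ maxIdeal O Δ) : ρ ∈ Ring.jacobson C := by
  have hstd : ∀ y, ψ y ∈ standardOrder O Δ f := fun y => hψ ▸ Set.mem_range_self y
  have hcint : IsIntegral O c := by
    rcases le_or_gt b.1 a.1 with h | h
    · exact (hc h).1
    · exact (single_mem_standardOrder.1 (hρ ▸ hstd ρ)).1 h.le
  rw [← Ideal.jacobson_bot, Ideal.mem_jacobson_iff]
  intro y
  have hu : ψ y b a * c ∈ maxIdeal O Δ := by
    rcases le_or_gt b.1 a.1 with h | h
    · exact hO.mul_mem_maxIdeal_left ((hstd y b a).1 h) (hc h)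
    · exact hO.mul_mem_maxIdeal_right ((hstd y b a).2 h) hcint
  have hv : 1 + ψ y b a * c ∉ maxIdeal O Δ := fun h => one_notMem_maxIdeal (O := O) (Δ := Δ) (by
    simpa using hO.add_mem_maxIdeal h (neg_mem_maxIdeal hu))
  obtain ⟨w, hw⟩ : ∃ w, ψ w = Matrix.single b b (1 + ψ y b a * c)⁻¹ := by
    have h1 : Matrix.single b b (1 + ψ y b a * c)⁻¹ ∈ standardOrder O Δ f :=
      single_mem_standardOrder.2 ⟨fun _ => hO.isIntegral_inv_of_notMem hv,
        fun h => absurd h (lt_irrefl _)⟩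
    rwa [← hψ] at h1
  refine ⟨1 - y * ρ * w, ?_⟩
  rw [Ideal.mem_bot]
  apply hinj
  have h1 : ψ w * (ψ y * ψ ρ) + ψ w = Matrix.single b b 1 := by
    rw [hw, hρ, ← mul_assoc, Matrix.single_mul_mul_single, ← Matrix.single_add, mul_assoc,
      ← mul_add_one, add_comm _ (1 : Δ), inv_mul_cancel₀ (ne_zero_of_notMem_maxIdeal hv)]
  have h2 : ψ ρ * Matrix.single b b 1 = ψ ρ := by
    rw [hρ, Matrix.single_mul_single_same, mul_one]
  have h3 : (1 - y * ρ * w) * y * ρ + (1 - y * ρ * w) - 1 =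
      y * ρ - y * ρ * (w * (y * ρ) + w) := by noncomm_ring
  rw [h3, map_sub, map_mul ψ (y * ρ), map_add, map_mul ψ w, map_mul ψ y, h1, mul_assoc, h2,
    sub_self, map_zero]

end Radical

section Residue

variable {F : Type*} [Field F] {O : Subring F} {Δ : Type*} [DivisionRing Δ] [Algebra F Δ]
  [FiniteDimensional F Δ]

variable (Δ) in
/-- The maximal order of `Δ` as a module over `O`. -/
def IsLocalFieldBase.intModule (hO : IsLocalFieldBase O) : Submodule O Δ where
  carrier := maxOrder O Δ
  zero_mem' := isIntegral_zero
  add_mem' hx hy := hO.isIntegral_add hx hy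
  smul_mem' c y hy := by
    have hc : IsIntegral O (algebraMap O Δ c) := isIntegral_algebraMap
    rw [Algebra.smul_def]
    exact hO.isIntegral_mul hc hy

variable (Δ) in
/-- The maximal ideal as a submodule of the maximal order. -/
def IsLocalFieldBase.maxSubmodule (hO : IsLocalFieldBase O) :
    Submodule O (hO.intModule Δ) where
  carrier := {x | (x : Δ) ∈ maxIdeal O Δ}
  zero_mem' := zero_mem_maxIdeal
  add_mem' hx hy := hO.add_mem_maxIdeal hx hy
  smul_mem' c y hy := by
    have hc : IsIntegral O (algebraMap O Δ c) := isIntegral_algebraMap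
    have h : ((c • y : hO.intModule Δ) : Δ) = algebraMap O Δ c * y := Algebra.smul_def _ _
    change ((c • y : hO.intModule Δ) : Δ) ∈ maxIdeal O Δ
    rw [h]
    exact hO.mul_mem_maxIdeal_left hc hy

theorem IsLocalFieldBase.nontrivial_residue (hO : IsLocalFieldBase O) :
    Nontrivial (hO.intModule Δ ⧸ hO.maxSubmodule Δ) := by
  refine Submodule.Quotient.nontrivial_iff.2 fun h => ?_
  have h1 : (⟨1, isIntegral_one⟩ : hO.intModule Δ) ∈ hO.maxSubmodule Δ := h ▸ Submodule.mem_top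
  exact one_notMem_maxIdeal h1

theorem IsLocalFieldBase.finite_residue (hO : IsLocalFieldBase O) (h : (hO.intModule Δ).FG) :
    Finite (hO.intModule Δ ⧸ hO.maxSubmodule Δ) := by
  have := hO.hasFiniteQuotients
  obtain ⟨ϖ, hϖ, hϖ0, hϖinv, -⟩ := hO.exists_pow_mul_mem
  have : Module.Finite O (hO.intModule Δ) := Module.Finite.iff_fg.2 h
  refine finite_of_smul_eq_zero (c := (⟨ϖ, hϖ⟩ : O)) (fun h => hϖ0 (congrArg Subtype.val h)) ?_
  intro x
  obtain ⟨y, rfl⟩ := Submodule.Quotient.mk_surjective _ x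
  rw [← Submodule.Quotient.mk_smul, Submodule.Quotient.mk_eq_zero]
  have h1 : (((⟨ϖ, hϖ⟩ : O) • y : hO.intModule Δ) : Δ) = algebraMap F Δ ϖ * y :=
    Algebra.smul_def _ _
  change (((⟨ϖ, hϖ⟩ : O) • y : hO.intModule Δ) : Δ) ∈ maxIdeal O Δ
  rw [h1]
  refine hO.mul_mem_maxIdeal_right (hO.mem_maxIdeal.2 (Or.inr fun h => hϖinv ?_)) y.2
  rwa [← map_inv₀, hO.isIntegral_algebraMap_iff] at h

/-- The maximal order is a finite module, because it occurs as a diagonal entry of a finite one. -/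
theorem IsLocalFieldBase.fg_intModule (hO : IsLocalFieldBase O) {f : List ℕ}
    [Nonempty (BlockIndex f)] {Λ : Subalgebra O (Matrix (BlockIndex f) (BlockIndex f) Δ)}
    (hstd : (Λ : Set (Matrix (BlockIndex f) (BlockIndex f) Δ)) = standardOrder O Δ f)
    (hfg : (Subalgebra.toSubmodule Λ).FG) : (hO.intModule Δ).FG := by
  obtain ⟨b⟩ := ‹Nonempty (BlockIndex f)›
  let p : Matrix (BlockIndex f) (BlockIndex f) Δ →ₗ[O] Δ :=
    { toFun := fun X => X b b
      map_add' := fun _ _ => rfl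
      map_smul' := fun _ _ => rfl }
  have h : (Subalgebra.toSubmodule Λ).map p = hO.intModule Δ := by
    ext x
    constructor
    · rintro ⟨X, hX, rfl⟩
      have h1 : X ∈ standardOrder O Δ f := hstd ▸ hX
      exact (h1 b b).1 le_rfl
    · intro hx
      refine ⟨Matrix.single b b x, ?_, Matrix.single_apply_same ..⟩
      have h1 : Matrix.single b b x ∈ standardOrder O Δ f :=
        single_mem_standardOrder.2 ⟨fun _ => hx, fun h => absurd h (lt_irrefl _)⟩
      rwa [← hstd] at h1
  rw [← h]
  exact hfg.map p

end Residue

namespace LocalDescription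

variable {K : Type u} [Field K] {D : Type w} [Ring D] [Algebra K D] {infty : Place K}
  {R : Subalgebra (regularRing infty) D} {v : FinitePlace infty}

/-- The completed order inside the matrix algebra of a local description. -/
def matrixOrder (S : LocalDescription R v) :
    Subalgebra (complInt v.1) (Matrix (BlockIndex S.f) (BlockIndex S.f) S.Δ) :=
  (completeOrder R v).map ((S.φ.restrictScalars (complInt v.1) : _ ≃ₐ[complInt v.1] _) :
    AlgCompl D v.1 →ₐ[complInt v.1] Matrix (BlockIndex S.f) (BlockIndex S.f) S.Δ)

theorem coe_matrixOrder (S : LocalDescription R v) :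
    (S.matrixOrder : Set (Matrix (BlockIndex S.f) (BlockIndex S.f) S.Δ)) =
      standardOrder (complInt v.1) S.Δ S.f := S.image_φ

theorem apply_mem_matrixOrder (S : LocalDescription R v) {x : AlgCompl D v.1} :
    S.φ x ∈ S.matrixOrder ↔ x ∈ completeOrder R v := by
  constructor
  · rintro ⟨y, hy, hyx⟩
    exact S.φ.injective hyx ▸ hy
  · exact fun h => ⟨x, h, rfl⟩

/-- The indecomposable modules of a local description are the standard row modules: multiplication by
the radical moves the entries of the `i`-th block into the maximal ideal and keeps the others. -/
theorem coe_indec (S : LocalDescription R v) [FiniteDimensional (Compl v.1) S.Δ]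
    (hO : IsLocalFieldBase (complInt v.1)) : ∀ i < S.period,
      S.indec i = (hO.stdRow S.Δ S.f i).toAddSubgroup := by
  intro i
  induction i with
  | zero =>
    intro _
    have h : {y : BlockIndex S.f → S.Δ | ∀ a, y a ∈ maxOrder (complInt v.1) S.Δ} =
        ((hO.stdRow S.Δ S.f 0).toAddSubgroup : Set (BlockIndex S.f → S.Δ)) := by
      ext y
      exact ⟨fun h b => ⟨fun hb => absurd hb (Nat.not_lt_zero _), h b⟩, fun h b => (h b).2⟩
    rw [indec, h, AddSubgroup.closure_eq]
  | succ i ih =>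
    intro hi
    rw [indec, ih (Nat.lt_of_succ_lt hi)]
    let _ : Ring ↥(completeOrder R v) := (completeOrder R v).toRing
    let ψ : ↥(completeOrder R v) →+* Matrix (BlockIndex S.f) (BlockIndex S.f) S.Δ :=
      (S.φ : AlgCompl D v.1 →+* _).comp (completeOrder R v).val.toRingHom
    have hinj : Function.Injective ψ := S.φ.injective.comp Subtype.val_injective
    have hψ : Set.range ψ = standardOrder (complInt v.1) S.Δ S.f := by
      rw [← S.image_φ]
      ext X
      constructor
      · rintro ⟨x, rfl⟩
        exact ⟨x, x.2, rfl⟩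
      · rintro ⟨x, hx, rfl⟩
        exact ⟨⟨x, hx⟩, rfl⟩
    refine le_antisymm ((AddSubgroup.closure_le _).2 ?_) fun z hz => ?_
    · rintro _ ⟨y, hy, ρ, hρ, rfl⟩ b
      have hint : ∀ a, IsIntegral (complInt v.1) (S.φ ρ a b) := fun a => by
        have h : S.φ ρ ∈ standardOrder (complInt v.1) S.Δ S.f := hψ ▸ ⟨ρ, rfl⟩
        rcases le_or_gt a.1 b.1 with h' | h'
        · exact (h a b).1 h'
        · exact ((h a b).2 h').1
      refine ⟨fun hb => hO.sum_mem_maxIdeal fun a _ => ?_,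
        hO.isIntegral_sum fun a _ => hO.isIntegral_mul (hy a).2 (hint a)⟩
      rcases lt_or_ge (a.1 : ℕ) i with h | h
      · exact hO.mul_mem_maxIdeal_right ((hy a).1 h) (hint a)
      · exact hO.mul_mem_maxIdeal_left (hy a).2
          (hO.mem_maxIdeal_of_mem_jacobson hψ hρ ((Nat.lt_succ_iff.1 hb).trans h))
    · obtain ⟨a, ha⟩ := exists_block_eq S.f_pos ⟨i, Nat.lt_of_succ_lt hi⟩
      have ha' : (a.1 : ℕ) = i := congrArg Fin.val ha
      rw [← Finset.univ_sum_single z]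
      refine AddSubgroup.sum_mem _ fun b _ => AddSubgroup.subset_closure ?_
      have hzb := hz b
      have h1 : Matrix.single a b (z b) ∈ Set.range ψ := hψ ▸ single_mem_standardOrder.2
        ⟨fun _ => hzb.2, fun h => hzb.1 (by rw [← ha']; exact Nat.lt_succ_of_lt h)⟩
      obtain ⟨ρ, hρ⟩ := h1
      refine ⟨Pi.single a 1, hO.pi_single_mem_stdRow.2
        ⟨fun h => absurd h (by rw [ha']; exact lt_irrefl _), isIntegral_one⟩, ρ,
        hO.mem_jacobson_of_eq_single (C := ↥(completeOrder R v)) (ψ := ψ) hinj hψ hρ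
          fun h => hzb.1 (by rw [← ha']; exact Nat.lt_succ_of_le h), ?_⟩
      have h2 : S.φ ρ = Matrix.single a b (z b) := hρ
      rw [h2, vecMul_single_one, Pi.single_eq_same, one_mul]

end LocalDescription

/-! ### Local types of right ideals -/

section Types

/-- The elements `x` of `L` such that `x p` is of the form `y q` with `y` in `L`. -/
def mulSubgroup {A B : Type*} [CommRing A] [Ring B] [Algebra A B] (L : Submodule A B) (p q : B) :
    AddSubgroup L where
  carrier := {x | ∃ y : L, (x : B) * p = y * q}
  zero_mem' := ⟨0, by simp⟩
  add_mem' := by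
    rintro x₁ x₂ ⟨y₁, h₁⟩ ⟨y₂, h₂⟩
    refine ⟨y₁ + y₂, ?_⟩
    rw [Submodule.coe_add, Submodule.coe_add, add_mul, add_mul, h₁, h₂]
  neg_mem' := by
    rintro x ⟨y, h⟩
    refine ⟨-y, ?_⟩
    rw [Submodule.coe_neg, Submodule.coe_neg, neg_mul, neg_mul, h]

theorem mem_mulSubgroup {A B : Type*} [CommRing A] [Ring B] [Algebra A B] {L : Submodule A B}
    {p q : B} {x : L} : x ∈ mulSubgroup L p q ↔ ∃ y : L, (x : B) * p = y * q := Iff.rfl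

/-- A subgroup cut out by the condition that `n` independent integral coordinates lie in the
maximal ideal has the index of `n` copies of the residue ring. -/
theorem IsLocalFieldBase.card_quotient_eq_pow {F : Type*} [Field F] {O : Subring F} {Δ : Type*}
    [DivisionRing Δ] [Algebra F Δ] [FiniteDimensional F Δ] (hO : IsLocalFieldBase O) {L : Type*}
    [AddCommGroup L] {P : AddSubgroup L} {n : ℕ} (c : L → Fin n → Δ)
    (hadd : ∀ x y k, c (x + y) k = c x k + c y k) (hint : ∀ x k, IsIntegral O (c x k))
    (hsurj : ∀ w : Fin n → Δ, (∀ k, IsIntegral O (w k)) → ∃ x, ∀ k, c x k = w k)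
    (hP : ∀ x, x ∈ P ↔ ∀ k, c x k ∈ maxIdeal O Δ) :
    Nat.card (L ⧸ P) = Nat.card (hO.intModule Δ ⧸ hO.maxSubmodule Δ) ^ n := by
  let Ψ : L →+ (Fin n → hO.intModule Δ ⧸ hO.maxSubmodule Δ) :=
    AddMonoidHom.mk' (fun x k => (hO.maxSubmodule Δ).mkQ ⟨c x k, hint x k⟩) fun x y => by
      funext k
      have h1 : (⟨c (x + y) k, hint (x + y) k⟩ : hO.intModule Δ) =
        ⟨c x k, hint x k⟩ + ⟨c y k, hint y k⟩ := Subtype.ext (hadd x y k)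
      rw [h1, map_add]
      rfl
  have hker : Ψ.ker = P := by
    ext x
    rw [hP, AddMonoidHom.mem_ker, funext_iff]
    exact forall_congr' fun k => Submodule.Quotient.mk_eq_zero _
  have hΨ : Function.Surjective Ψ := by
    intro q
    choose w hw using fun k => (hO.maxSubmodule Δ).mkQ_surjective (q k)
    obtain ⟨x, hx⟩ := hsurj (fun k => w k) fun k => (w k).2
    refine ⟨x, funext fun k => ?_⟩
    rw [← hw]
    exact congrArg (hO.maxSubmodule Δ).mkQ (Subtype.ext (hx k))
  rw [← hker, Nat.card_congr (QuotientAddGroup.quotientKerEquivOfSurjective Ψ hΨ).toEquiv,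
    Nat.card_fun, Nat.card_eq_fintype_card (α := Fin _), Fintype.card_fin]

/-- Suppose that `L` is a direct sum of standard row modules, `b` lies in the `j`-th block and
`b'` in the preceding one, and `p`, `q` act like the matrix units `e_{bb}`, `e_{b'b}`. Then the
index of the subgroup of the `x` in `L` with `x p` in `L q` is a power of the order of the residue
ring. The exponent is the multiplicity of the `j`-th standard module. -/
theorem IsLocalFieldBase.card_quotient_mulSubgroup {F : Type*} [Field F] {O : Subring F}
    {Δ : Type*} [DivisionRing Δ] [Algebra F Δ] [FiniteDimensional F Δ] (hO : IsLocalFieldBase O)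
    {B : Type*} [Ring B] [Algebra O B] {L : Submodule O B} {f : List ℕ}
    {M : ℕ → AddSubgroup (BlockIndex f → Δ)}
    (hM : ∀ (i : Fin f.length) y, y ∈ M i ↔ y ∈ hO.stdRow Δ f i) {g : Fin f.length → ℕ}
    (e : L ≃+ ((a : Σ i : Fin f.length, Fin (g i)) → M a.1)) {b' b : BlockIndex f}
    (hb : (b.1 : ℕ) = b'.1 + 1) {p q : B}
    (hp : ∀ x : L, ∃ y : L, (y : B) = x * p ∧
      ∀ a, (e y a : BlockIndex f → Δ) = Pi.single b ((e x a : BlockIndex f → Δ) b))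
    (hq : ∀ x : L, ∃ y : L, (y : B) = x * q ∧
      ∀ a, (e y a : BlockIndex f → Δ) = Pi.single b ((e x a : BlockIndex f → Δ) b')) :
    Nat.card (L ⧸ mulSubgroup L p q) =
      Nat.card (hO.intModule Δ ⧸ hO.maxSubmodule Δ) ^ g b.1 := by
  have hmem : ∀ x a, (e x a : BlockIndex f → Δ) ∈ hO.stdRow Δ f a.1 := fun x a =>
    (hM a.1 _).1 (e x a).2
  refine hO.card_quotient_eq_pow (fun x k => (e x ⟨b.1, k⟩ : BlockIndex f → Δ) b)
    (fun x y k => by rw [e.map_add x y]; rfl) (fun x k => (hmem x _ b).2) ?_ ?_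
  · intro w hw
    let z : (a : Σ i : Fin f.length, Fin (g i)) → M a.1 := fun a =>
      if h : a.1 = b.1 then ⟨Pi.single b (w (h ▸ a.2)), by
        rw [hM a.1, hO.pi_single_mem_stdRow]
        exact ⟨fun h' => absurd h' (by rw [h]; exact lt_irrefl _), hw _⟩⟩ else 0
    refine ⟨e.symm z, fun k => ?_⟩
    rw [e.apply_symm_apply]
    simp only [z, dif_pos, Pi.single_eq_same]
  · intro x
    rw [mem_mulSubgroup]
    constructor
    · rintro ⟨y, hy⟩ k
      obtain ⟨x₁, hx₁, hx₁e⟩ := hp x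
      obtain ⟨y₁, hy₁, hy₁e⟩ := hq y
      have h1 : x₁ = y₁ := Subtype.ext (by rw [hx₁, hy₁, hy])
      have h2 := congrFun ((hx₁e ⟨b.1, k⟩).symm.trans (h1 ▸ hy₁e ⟨b.1, k⟩)) b
      rw [Pi.single_eq_same, Pi.single_eq_same] at h2
      rw [h2]
      exact (hmem y ⟨b.1, k⟩ b').1 (by change (b'.1 : ℕ) < b.1; rw [hb]; exact Nat.lt_succ_self _)
    · intro hx
      let z : (a : Σ i : Fin f.length, Fin (g i)) → M a.1 := fun a =>
        ⟨Pi.single b' ((e x a : BlockIndex f → Δ) b), by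
          rw [hM a.1, hO.pi_single_mem_stdRow]
          refine ⟨fun ha => ?_, (hmem x a b).2⟩
          rcases lt_or_ge (b.1 : ℕ) a.1 with h1 | h1
          · exact (hmem x a b).1 h1
          · obtain ⟨i, k⟩ := a
            have h2 : i = b.1 := Fin.ext (le_antisymm h1 (by rw [hb]; exact ha))
            subst h2
            exact hx k⟩
      obtain ⟨x₁, hx₁, hx₁e⟩ := hp x
      obtain ⟨y₁, hy₁, hy₁e⟩ := hq (e.symm z)
      have h1 : e x₁ = e y₁ := by
        funext a
        refine Subtype.ext ?_
        rw [hx₁e, hy₁e, e.apply_symm_apply]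
        change _ = (Pi.single b ((Pi.single b' ((e x a : BlockIndex f → Δ) b) :
          BlockIndex f → Δ) b') : BlockIndex f → Δ)
        rw [Pi.single_eq_same]
      have h2 : x₁ = y₁ := e.injective h1
      refine ⟨e.symm z, ?_⟩
      rw [← hx₁, ← hy₁, h2]

variable {K : Type u} [Field K] {D : Type w} [Ring D] [Algebra K D] {infty : Place K}
  {R : Subalgebra (regularRing infty) D} {v : FinitePlace infty}

theorem RightIdeal.mul_mem_completeModule (I : RightIdeal R) {x ρ : AlgCompl D v.1}
    (hx : x ∈ completeModule I.carrier v) (hρ : ρ ∈ completeOrder R v) :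
    x * ρ ∈ completeModule I.carrier v := by
  have h1 : ρ ∈ completeModule (Subalgebra.toSubmodule R) v := by
    rw [← completeOrder_toSubmodule]
    exact hρ
  have h2 := Submodule.mul_mem_mul hx h1
  rw [completeModule, completeModule, Submodule.span_mul_span] at h2
  refine Submodule.span_mono ?_ h2
  rintro _ ⟨_, ⟨a, ha, rfl⟩, _, ⟨r, hr, rfl⟩, rfl⟩
  refine ⟨a * r, I.mul_mem a ha r hr, ?_⟩
  change (1 : Compl v.1) ⊗ₜ[K] (a * r) = (1 ⊗ₜ[K] a) * (1 ⊗ₜ[K] r)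
  rw [Algebra.TensorProduct.tmul_mul_tmul, one_mul]

namespace LocalDescription

/-- The matrix algebra of a local description. -/
abbrev Mat (S : LocalDescription R v) : Type (max u w) :=
  Matrix (BlockIndex S.f) (BlockIndex S.f) S.Δ

/-- The type index counting the rows of each kind. -/
theorem exists_typeIndex {S : LocalDescription R v} (t : BlockIndex S.f → Fin S.period) :
    ∃ g : S.TypeIndex, ∀ i, g.1 i = Nat.card {a // t a = i} := by
  refine ⟨⟨fun i => Nat.card {a // t a = i}, ?_⟩, fun _ => rfl⟩
  rw [← Nat.card_sigma, Nat.card_congr (Equiv.sigmaFiberEquiv t), Nat.card_eq_fintype_card,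
    card_blockIndex]

variable (S : LocalDescription R v)

theorem mem_indec [FiniteDimensional (Compl v.1) S.Δ] (hO : IsLocalFieldBase (complInt v.1))
    (i : Fin S.period) {y : BlockIndex S.f → S.Δ} :
    y ∈ S.indec i ↔ y ∈ hO.stdRow S.Δ S.f i := by
  rw [S.coe_indec hO i i.2]
  rfl

/-- Through the local description and the left multiplication by `α⁻¹`, the completion of the
right ideal `I` becomes the lattice of matrices whose `a`-th row lies in the standard module with
index `t a`. -/
def HasRowType [FiniteDimensional (Compl v.1) S.Δ] (hO : IsLocalFieldBase (complInt v.1))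
    (I : RightIdeal R) (α : S.Matˣ)
    (t : BlockIndex S.f → Fin S.period) : Prop :=
  ∀ Y : S.Mat, S.φ.symm ((α : S.Mat) * Y) ∈ completeModule I.carrier v ↔ Y ∈ hO.stdLattice (Δ := S.Δ) t

variable {S} [FiniteDimensional (Compl v.1) S.Δ] {hO : IsLocalFieldBase (complInt v.1)}
  {I : RightIdeal R} {α : S.Matˣ}
  {t : BlockIndex S.f → Fin S.period}

theorem HasRowType.mem_iff (h : S.HasRowType hO I α t) {x : AlgCompl D v.1} :
    x ∈ completeModule I.carrier v ↔
      ∀ a, (((α⁻¹ : S.Matˣ) :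
        S.Mat) * S.φ x) a ∈ S.indec (t a) := by
  have h1 := h ((α⁻¹ : S.Matˣ) * S.φ x : S.Mat)
  rw [← mul_assoc, Units.mul_inv, one_mul, AlgEquiv.symm_apply_apply] at h1
  rw [h1, IsLocalFieldBase.stdLattice, mem_rowsIn]
  exact forall_congr' fun a => (S.mem_indec hO (t a)).symm

theorem HasRowType.hasLocalType (h : S.HasRowType hO I α t) {g : S.TypeIndex}
    (hg : ∀ i, g.1 i = Nat.card {a // t a = i}) : S.HasLocalType I g := by
  obtain ⟨E, hE⟩ : ∃ E : (Σ i, Fin (g.1 i)) ≃ BlockIndex S.f, ∀ c, t (E c) = c.1 := by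
    refine ⟨(Equiv.sigmaCongrRight fun i => (Fin.castOrderIso (hg i)).toEquiv.trans
      (Finite.equivFin _).symm).trans (Equiv.sigmaFiberEquiv t), fun c => ?_⟩
    exact ((Finite.equivFin {a // t a = c.1}).symm ((Fin.castOrderIso (hg c.1)) c.2)).2
  let β := (α⁻¹ : S.Matˣ)
  let e : completeModule I.carrier v ≃+ ((a : Σ i : Fin S.period, Fin (g.1 i)) → S.indec a.1) :=
    { toFun := fun x c => ⟨((β : S.Mat) * S.φ x) (E c), by
        rw [← hE c]
        exact h.mem_iff.1 x.2 (E c)⟩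
      invFun := fun y => ⟨S.φ.symm ((α : S.Mat) *
          (Matrix.of fun b => (y (E.symm b) : BlockIndex S.f → S.Δ) : S.Mat)), h.mem_iff.2 fun a => by
        have h1 : (t a : ℕ) = (E.symm a).1 := by rw [← hE, E.apply_symm_apply]
        rw [AlgEquiv.apply_symm_apply, ← mul_assoc, Units.inv_mul, one_mul, h1]
        exact (y (E.symm a)).2⟩
      left_inv := fun x => by
        refine Subtype.ext (S.φ.injective ?_)
        simp only [Equiv.apply_symm_apply, AlgEquiv.apply_symm_apply]
        change (α : S.Mat) *
          ((β : S.Mat) * S.φ x) = S.φ x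
        rw [← mul_assoc, Units.mul_inv, one_mul]
      right_inv := fun y => by
        funext c
        refine Subtype.ext ?_
        simp only [AlgEquiv.apply_symm_apply]
        rw [← mul_assoc, Units.inv_mul, one_mul]
        have h1 : ∀ c', c' = c → (y c' : BlockIndex S.f → S.Δ) = y c := by
          rintro _ rfl
          rfl
        exact h1 _ (E.symm_apply_apply c)
      map_add' := fun x y => by
        funext c
        refine Subtype.ext ?_
        change ((β : S.Mat) * S.φ (x + y)) (E c) = _
        rw [map_add, mul_add]
        rfl }
  refine ⟨e, fun x y ρ _ hy c => ?_⟩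
  change ((β : S.Mat) * S.φ y) (E c) =
    Matrix.vecMul (((β : S.Mat) * S.φ x) (E c)) (S.φ ρ)
  rw [hy, map_mul, ← mul_assoc, Matrix.mul_apply_eq_vecMul]

/-- Right ideals with the same numbers of rows of each kind are locally equivalent. -/
theorem HasRowType.exists_isLeftMul (h : S.HasRowType hO I α t) {J : RightIdeal R}
    {α' : S.Matˣ} {t' : BlockIndex S.f → Fin S.period}
    (h' : S.HasRowType hO J α' t')
    (htt' : ∀ i, Nat.card {a // t a = i} = Nat.card {a // t' a = i}) :
    ∃ a : (AlgCompl D v.1)ˣ,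
      IsLeftMul a (completeModule I.carrier v) (completeModule J.carrier v) := by
  obtain ⟨σ, hσ⟩ : ∃ σ : BlockIndex S.f ≃ BlockIndex S.f, ∀ a, t (σ a) = t' a := by
    let τ := fun i => Classical.choice (Finite.card_eq.1 (htt' i).symm)
    exact ⟨(Equiv.sigmaFiberEquiv t').symm.trans ((Equiv.sigmaCongrRight τ).trans
      (Equiv.sigmaFiberEquiv t)), fun a => (τ (t' a) ⟨a, rfl⟩).2⟩
  have hmul : ∀ (τ : BlockIndex S.f ≃ BlockIndex S.f)
      (Y : S.Mat),
      (τ.toPEquiv.toMatrix : S.Mat) * Y =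
        Y.submatrix τ id := fun τ Y => PEquiv.toMatrix_toPEquiv_mul τ Y
  let P : S.Matˣ :=
    ⟨σ.toPEquiv.toMatrix, σ.symm.toPEquiv.toMatrix,
      by rw [hmul]; ext i j; simp [PEquiv.toMatrix_apply, Matrix.one_apply],
      by rw [hmul]; ext i j; simp [PEquiv.toMatrix_apply, Matrix.one_apply]⟩
  let U : (AlgCompl D v.1)ˣ := Units.map (S.φ.symm : _ →* AlgCompl D v.1) (α' * P * α⁻¹)
  refine ⟨U, ?_⟩
  have key : ∀ x, (U : AlgCompl D v.1) * x ∈ completeModule J.carrier v ↔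
      x ∈ completeModule I.carrier v := by
    intro x
    obtain ⟨Y, rfl⟩ : ∃ Y : S.Mat, x = S.φ.symm ((α : S.Mat) * Y) :=
      ⟨((α⁻¹ : S.Matˣ) : S.Mat) * S.φ x, by
        rw [← mul_assoc, Units.mul_inv, one_mul, AlgEquiv.symm_apply_apply]⟩
    have h1 : (U : AlgCompl D v.1) * S.φ.symm ((α : S.Mat) * Y) = S.φ.symm ((α' : S.Mat) * ((P : S.Mat) * Y)) := by
      change S.φ.symm ↑(α' * P * α⁻¹) * S.φ.symm ((α : S.Mat) * Y) = _
      rw [← map_mul, Units.val_mul, Units.val_mul]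
      congr 1
      simp only [mul_assoc, Units.inv_mul_cancel_left]
    rw [h1, h' ((P : S.Mat) * Y), h Y, IsLocalFieldBase.stdLattice, IsLocalFieldBase.stdLattice,
      mem_rowsIn, mem_rowsIn]
    have h2 : (P : S.Mat) * Y = Y.submatrix σ id := hmul σ Y
    rw [h2]
    constructor
    · intro h3 a
      have h4 := h3 (σ.symm a)
      rw [← hσ, σ.apply_symm_apply] at h4
      have h5 : Y.submatrix σ id (σ.symm a) = Y a := by
        funext b
        rw [Matrix.submatrix_apply, σ.apply_symm_apply, id]
      rwa [h5] at h4
    · intro h3 a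
      rw [← hσ]
      exact h3 (σ a)
  ext x
  constructor
  · intro hx
    refine ⟨(U⁻¹ : (AlgCompl D v.1)ˣ) * x, (key _).1 ?_, ?_⟩
    · rwa [Units.mul_inv_cancel_left]
    · exact Units.mul_inv_cancel_left U x
  · rintro ⟨y, hy, rfl⟩
    exact (key y).2 hy

/-- The elements stabilizing the completion of a right ideal form an order with the invariant
given by the numbers of rows of each kind. -/
theorem HasRowType.exists_image_eq_standardOrder (h : S.HasRowType hO I α t) {g : S.TypeIndex}
    (hg : ∀ i, g.1 i = Nat.card {a // t a = i}) :
    ∃ φ : AlgCompl D v.1 ≃ₐ[Compl v.1]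
        Matrix (BlockIndex (S.removeZeros g)) (BlockIndex (S.removeZeros g)) S.Δ,
      φ '' {x | ∀ y ∈ completeModule I.carrier v, x * y ∈ completeModule I.carrier v} =
        standardOrder (complInt v.1) S.Δ (S.removeZeros g) := by
  obtain ⟨e, he⟩ : ∃ e : BlockIndex S.f ≃ BlockIndex (S.removeZeros g),
      ∀ a b, (e a).1 ≤ (e b).1 ↔ t a ≤ t b := by
    have h1 : g.1 = fun i => Nat.card {a // t a = i} := funext hg
    rw [removeZeros, h1]
    exact exists_equiv_blockIndex t
  let φ := (S.φ.trans (conjEquiv α)).trans (Matrix.reindexAlgEquiv (Compl v.1) S.Δ e)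
  have hstab : ∀ x, (∀ y ∈ completeModule I.carrier v, x * y ∈ completeModule I.carrier v) ↔
      ∀ a b, (t a ≤ t b → conjEquiv (A := Compl v.1) α (S.φ x) a b ∈ maxOrder (complInt v.1) S.Δ) ∧
        (t b < t a → conjEquiv (A := Compl v.1) α (S.φ x) a b ∈ maxIdeal (complInt v.1) S.Δ) := by
    intro x
    rw [← hO.mem_transporter_stdLattice S.f_pos, mem_transporter]
    have h2 : ∀ Y : S.Mat, (α : S.Mat) *
        (conjEquiv (A := Compl v.1) α (S.φ x) * Y) = S.φ (x * S.φ.symm ((α : S.Mat) * Y)) := by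
      intro Y
      rw [conjEquiv_apply, map_mul, AlgEquiv.apply_symm_apply]
      simp only [mul_assoc, Units.mul_inv_cancel_left]
    constructor
    · intro h1 Y hY
      rw [← h, h2, AlgEquiv.symm_apply_apply]
      exact h1 _ ((h Y).2 hY)
    · intro h1 y hy
      obtain ⟨Y, rfl⟩ : ∃ Y : S.Mat, y = S.φ.symm ((α : S.Mat) * Y) :=
        ⟨((α⁻¹ : S.Matˣ) : S.Mat) * S.φ y, by
          rw [← mul_assoc, Units.mul_inv, one_mul, AlgEquiv.symm_apply_apply]⟩
      have h3 := (h _).2 (h1 Y ((h Y).1 hy))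
      rwa [h2, AlgEquiv.symm_apply_apply] at h3
  refine ⟨φ, ?_⟩
  have hφ : ∀ x a b, φ x (e a) (e b) = conjEquiv (A := Compl v.1) α (S.φ x) a b := by
    intro x a b
    change conjEquiv (A := Compl v.1) α (S.φ x) (e.symm (e a)) (e.symm (e b)) = _
    rw [e.symm_apply_apply, e.symm_apply_apply]
  have hiff : ∀ x, (∀ y ∈ completeModule I.carrier v, x * y ∈ completeModule I.carrier v) ↔
      φ x ∈ standardOrder (complInt v.1) S.Δ (S.removeZeros g) := by
    intro x
    rw [hstab]
    constructor
    · intro h1 a b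
      obtain ⟨a, rfl⟩ := e.surjective a
      obtain ⟨b, rfl⟩ := e.surjective b
      rw [hφ, he, lt_iff_not_ge, he, ← lt_iff_not_ge]
      exact h1 a b
    · intro h1 a b
      have h2 := h1 (e a) (e b)
      rwa [hφ, he, lt_iff_not_ge, he, ← lt_iff_not_ge] at h2
  ext X
  constructor
  · rintro ⟨x, hx, rfl⟩
    exact (hiff x).1 hx
  · intro hX
    refine ⟨φ.symm X, (hiff _).2 ?_, φ.apply_symm_apply X⟩
    rwa [AlgEquiv.apply_symm_apply]

omit [FiniteDimensional (Compl v.1) S.Δ] in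
/-- A decomposition of `I_v` into row modules is compatible with the right multiplication by the
matrix units that lie in the order. -/
theorem hasLocalType_mul_single {g : S.TypeIndex}
    {e : completeModule I.carrier v ≃+ ((a : Σ i : Fin S.period, Fin (g.1 i)) → S.indec a.1)}
    (he : ∀ x y : completeModule I.carrier v, ∀ ρ : AlgCompl D v.1, ρ ∈ completeOrder R v →
      (y : AlgCompl D v.1) = x * ρ →
        ∀ a, (e y a : BlockIndex S.f → S.Δ) = Matrix.vecMul (e x a : _ → S.Δ) (S.φ ρ))
    {b' b : BlockIndex S.f} (hb : b'.1 ≤ b.1) (x : completeModule I.carrier v) :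
    ∃ y : completeModule I.carrier v,
      (y : AlgCompl D v.1) = x * S.φ.symm (Matrix.single b' b 1) ∧
      ∀ a, (e y a : BlockIndex S.f → S.Δ) = Pi.single b ((e x a : BlockIndex S.f → S.Δ) b') := by
  have h1 : S.φ.symm (Matrix.single b' b 1) ∈ completeOrder R v := by
    have h2 : Matrix.single b' b 1 ∈ standardOrder (complInt v.1) S.Δ S.f :=
      single_mem_standardOrder.2 ⟨fun _ => isIntegral_one, fun h => absurd h (not_lt.2 hb)⟩
    rwa [← S.coe_matrixOrder, ← S.φ.apply_symm_apply (Matrix.single b' b 1),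
      SetLike.mem_coe, S.apply_mem_matrixOrder] at h2
  refine ⟨⟨_, I.mul_mem_completeModule x.2 h1⟩, rfl, fun a => ?_⟩
  rw [he x _ _ h1 rfl a, AlgEquiv.apply_symm_apply, vecMul_single_one, mul_one]

variable (hO) in
/-- The multiplicity of a row module with positive index is determined by an index that does not depend
on the decomposition. -/
theorem HasLocalType.card_quotient {g : S.TypeIndex} (h : S.HasLocalType I g)
    {b' b : BlockIndex S.f} (hb : (b.1 : ℕ) = b'.1 + 1) :
    Nat.card (completeModule I.carrier v ⧸ mulSubgroup (completeModule I.carrier v)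
      (S.φ.symm (Matrix.single b b 1)) (S.φ.symm (Matrix.single b' b 1))) =
      Nat.card (hO.intModule S.Δ ⧸ hO.maxSubmodule S.Δ) ^ g.1 b.1 := by
  obtain ⟨e, he⟩ := h
  exact hO.card_quotient_mulSubgroup (fun i y => S.mem_indec hO i) e hb
    (hasLocalType_mul_single he (le_refl b.1)) (hasLocalType_mul_single he
      (Fin.le_def.2 (by rw [hb]; exact Nat.le_succ _)))

/-- The local type of a right ideal is unique. The multiplicities with positive index are determined
by indices of subgroups, and the multiplicity with index zero is determined by the sum of all of
them. -/
theorem HasLocalType.unique [Nonempty (BlockIndex S.f)] (hO : IsLocalFieldBase (complInt v.1))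
    (hfg : (Subalgebra.toSubmodule S.matrixOrder).FG) {g g' : S.TypeIndex}
    (h : S.HasLocalType I g) (h' : S.HasLocalType I g') : g = g' := by
  have := hO.finite_residue (hO.fg_intModule S.coe_matrixOrder hfg)
  have := hO.nontrivial_residue (Δ := S.Δ)
  have hpos : ∀ i : Fin S.period, (i : ℕ) ≠ 0 → g.1 i = g'.1 i := by
    intro i hi
    obtain ⟨j, hj⟩ := Nat.exists_eq_succ_of_ne_zero hi
    obtain ⟨b, hb⟩ := exists_block_eq S.f_pos i
    obtain ⟨b', hb'⟩ := exists_block_eq S.f_pos ⟨j, by have := i.2; lia⟩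
    have hbb : (b.1 : ℕ) = b'.1 + 1 := by rw [hb, hb']; exact hj
    have h1 := (h.card_quotient hO hbb).symm.trans (h'.card_quotient hO hbb)
    rw [← hb]
    exact Nat.pow_right_injective Finite.one_lt_card h1
  refine Subtype.ext (funext fun i => ?_)
  by_cases hi : (i : ℕ) = 0
  · have h1 := g.2.trans g'.2.symm
    rw [← Finset.add_sum_erase _ _ (Finset.mem_univ i),
      ← Finset.add_sum_erase _ g'.1 (Finset.mem_univ i)] at h1
    have h2 : ∑ j ∈ Finset.univ.erase i, g.1 j = ∑ j ∈ Finset.univ.erase i, g'.1 j :=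
      Finset.sum_congr rfl fun j hj => hpos j fun h =>
        Finset.ne_of_mem_erase hj (Fin.ext (h.trans hi.symm))
    rw [h2] at h1
    exact Nat.add_right_cancel h1
  · exact hpos i hi

end LocalDescription

end Types

/-! ### Global lattices and their completions -/

section Completion

variable {K : Type u} [Field K] {D : Type w} [Ring D] [Algebra K D] {infty : Place K}

theorem tmul_mem_completeModule {J : Submodule (regularRing infty) D} (v : FinitePlace infty)
    {x : D} (hx : x ∈ J) : (1 : Compl v.1) ⊗ₜ[K] x ∈ completeModule J v :=
  Submodule.subset_span ⟨x, hx, rfl⟩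

theorem completeModule_le {J : Submodule (regularRing infty) D} {v : FinitePlace infty}
    {L : Submodule (complInt v.1) (AlgCompl D v.1)}
    (h : ∀ x ∈ J, (1 : Compl v.1) ⊗ₜ[K] x ∈ L) : completeModule J v ≤ L := by
  rw [completeModule, Submodule.span_le]
  rintro _ ⟨x, hx, rfl⟩
  exact h x hx

theorem completeModule_mono {J J' : Submodule (regularRing infty) D} (h : J ≤ J')
    (v : FinitePlace infty) : completeModule J v ≤ completeModule J' v :=
  completeModule_le fun _ hx => tmul_mem_completeModule v (h hx)

theorem algebraMap_smul_one_tmul (v : Place K) (c : K) (x : D) :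
    algebraMap K (Compl v) c • ((1 : Compl v) ⊗ₜ[K] x) = 1 ⊗ₜ[K] (c • x) := by
  rw [algebraMap_smul, TensorProduct.tmul_smul]

theorem coe_smul_eq {v : Place K} (c : complInt v) (x : AlgCompl D v) :
    c • x = (c : Compl v) • x := rfl

theorem smul_mem_completeModule {J : Submodule (regularRing infty) D} {v : FinitePlace infty}
    {c : Compl v.1} (hc : c ∈ complInt v.1) {x : AlgCompl D v.1} (hx : x ∈ completeModule J v) :
    c • x ∈ completeModule J v :=
  (completeModule J v).smul_mem ⟨c, hc⟩ hx

theorem mem_of_mem_regularRing (v : FinitePlace infty) (a : regularRing infty) :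
    algebraMap K (Compl v.1) a ∈ complInt v.1 :=
  algebraMap_mem_complInt.2 (mem_regularRing.1 a.2 v)

theorem smul_mem_completeModule_of_forall {J J' : Submodule (regularRing infty) D}
    {v : FinitePlace infty} {c : K} (h : ∀ x ∈ J, c • x ∈ J') {x : AlgCompl D v.1}
    (hx : x ∈ completeModule J v) : algebraMap K (Compl v.1) c • x ∈ completeModule J' v := by
  induction hx using Submodule.span_induction with
  | mem x hx =>
    obtain ⟨x, hx, rfl⟩ := hx
    change algebraMap K (Compl v.1) c • ((1 : Compl v.1) ⊗ₜ[K] x) ∈ _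
    rw [algebraMap_smul_one_tmul]
    exact tmul_mem_completeModule v (h x hx)
  | zero => rw [smul_zero]; exact Submodule.zero_mem _
  | add x y _ _ hx hy => rw [smul_add]; exact Submodule.add_mem _ hx hy
  | smul a x _ hx =>
    rw [coe_smul_eq, smul_comm]
    exact smul_mem_completeModule a.2 hx

theorem completeModule_fg {J : Submodule (regularRing infty) D} (hJ : J.FG)
    (v : FinitePlace infty) : (completeModule J v).FG := by
  classical
  obtain ⟨S, rfl⟩ := hJ
  refine ⟨S.image fun x : D => (1 : Compl v.1) ⊗ₜ[K] x, le_antisymm ?_ ?_⟩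
  · rw [Submodule.span_le, Finset.coe_image]
    rintro _ ⟨x, hx, rfl⟩
    exact tmul_mem_completeModule v (Submodule.subset_span hx)
  · refine completeModule_le fun x hx => ?_
    induction hx using Submodule.span_induction with
    | mem x hx => exact Submodule.subset_span (by rw [Finset.coe_image]; exact ⟨x, hx, rfl⟩)
    | zero => rw [TensorProduct.tmul_zero]; exact Submodule.zero_mem _
    | add x y _ _ hx hy => rw [TensorProduct.tmul_add]; exact Submodule.add_mem _ hx hy
    | smul a x _ hx =>
      rw [Subring.smul_def, ← algebraMap_smul_one_tmul]
      exact Submodule.smul_mem _ (⟨_, mem_of_mem_regularRing v a⟩ : complInt v.1) hx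

theorem inv_algebraMap_pow_mem_complInt {v : Place K} {c : K} (hc : v.1.valuation c = 1) (n : ℕ) :
    (algebraMap K (Compl v) c)⁻¹ ^ n ∈ complInt v := by
  rw [← map_inv₀, ← map_pow, algebraMap_mem_complInt, ← ValuationSubring.valuation_le_one_iff]
  rw [map_pow, map_inv₀, hc]
  simp

variable {k : Type*} [Field k] [Algebra k K]

/-- A global lattice is dense in its completion. -/
theorem exists_eq_tmul_add_smul (hK : IsGlobalFunctionField k K)
    {J : Submodule (regularRing infty) D} {v : FinitePlace infty} {y : AlgCompl D v.1}
    (hy : y ∈ completeModule J v) {c : Compl v.1} (hc : c ≠ 0) :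
    ∃ x ∈ J, ∃ z ∈ completeModule J v, y = 1 ⊗ₜ[K] x + c • z := by
  induction hy using Submodule.span_induction with
  | mem y hy =>
    obtain ⟨x, hx, rfl⟩ := hy
    exact ⟨x, hx, 0, Submodule.zero_mem _, by rw [smul_zero, add_zero]⟩
  | zero => exact ⟨0, J.zero_mem, 0, Submodule.zero_mem _, by simp⟩
  | add y y' _ _ h h' =>
    obtain ⟨x, hx, z, hz, rfl⟩ := h
    obtain ⟨x', hx', z', hz', rfl⟩ := h'
    refine ⟨x + x', J.add_mem hx hx', z + z', Submodule.add_mem _ hz hz', ?_⟩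
    rw [TensorProduct.tmul_add, smul_add]
    abel
  | smul b y _ h =>
    obtain ⟨x, hx, z, hz, rfl⟩ := h
    obtain ⟨a, t, ht, hat⟩ := exists_regularRing_sub_eq_mul hK v b.2 hc
    refine ⟨a • x, J.smul_mem a hx, t • ((1 : Compl v.1) ⊗ₜ[K] x) + (b : Compl v.1) • z,
      Submodule.add_mem _ (smul_mem_completeModule ht (tmul_mem_completeModule v hx))
        (smul_mem_completeModule b.2 hz), ?_⟩
    have h1 : (b : Compl v.1) = algebraMap K (Compl v.1) a + c * t := by
      rw [← hat, add_sub_cancel]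
    rw [coe_smul_eq, smul_add, smul_add, Subring.smul_def, ← algebraMap_smul_one_tmul,
      smul_smul c t, smul_comm c (b : Compl v.1) z, ← add_assoc, ← add_smul, ← h1]

theorem exists_pow_smul_mem (hK : IsGlobalFunctionField k K)
    {J : Submodule (regularRing infty) D} (hJ : Submodule.span K (J : Set D) = ⊤)
    {v : FinitePlace infty} {c : K} (hc : v.1.1.valuation c < 1) (y : AlgCompl D v.1) :
    ∃ d : ℕ, ∀ e ≥ d, algebraMap K (Compl v.1) c ^ e • y ∈ completeModule J v := by
  induction y using TensorProduct.induction_on with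
  | zero => exact ⟨0, fun e _ => by rw [smul_zero]; exact Submodule.zero_mem _⟩
  | add y y' h h' =>
    obtain ⟨d, hd⟩ := h
    obtain ⟨d', hd'⟩ := h'
    refine ⟨max d d', fun e he => ?_⟩
    rw [smul_add]
    exact Submodule.add_mem _ (hd e (le_of_max_le_left he)) (hd' e (le_of_max_le_right he))
  | tmul b x =>
    obtain ⟨s, hs, hsx⟩ := exists_smul_mem_of_span_eq_top hK hJ x
    have hs0 : algebraMap K (Compl v.1) s ≠ 0 :=
      (map_ne_zero _).2 fun h => hs (Subtype.ext h)
    obtain ⟨d, hd⟩ := exists_pow_mul_mem_complInt hK v hc (b * (algebraMap K (Compl v.1) s)⁻¹)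
    refine ⟨d, fun e he => ?_⟩
    have h1 : b ⊗ₜ[K] x = (b * (algebraMap K (Compl v.1) s)⁻¹) •
        ((1 : Compl v.1) ⊗ₜ[K] (s • x)) := by
      rw [Subring.smul_def, ← algebraMap_smul_one_tmul, smul_smul, inv_mul_cancel_right₀ hs0,
        TensorProduct.smul_tmul', smul_eq_mul, mul_one]
    rw [h1, smul_smul]
    exact smul_mem_completeModule (hd e he) (tmul_mem_completeModule v hsx)

/-- The completion of a global lattice is a local lattice. -/
theorem isFullLattice_completeModule (hK : IsGlobalFunctionField k K)
    {J : Submodule (regularRing infty) D} (hJ : J.FG)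
    (hspan : Submodule.span K (J : Set D) = ⊤) (v : FinitePlace infty) :
    IsFullLattice (completeModule J v) where
  fg := completeModule_fg hJ v
  full y := by
    obtain ⟨c, hc0, hc, -⟩ := exists_vanishing_only_at hK v
    obtain ⟨d, hd⟩ := exists_pow_smul_mem hK hspan hc y
    have h0 : algebraMap K (Compl v.1) c ≠ 0 := (map_ne_zero _).2 fun h => hc0 (Subtype.ext h)
    refine ⟨⟨algebraMap K (Compl v.1) c ^ d, pow_mem (mem_of_mem_regularRing v c) d⟩,
      fun h => pow_ne_zero d h0 (congrArg Subtype.val h), ?_⟩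
    rw [coe_smul_eq]
    exact hd d le_rfl

/-- Two local lattices are commensurable. -/
theorem IsFullLattice.exists_pow_forall_smul_mem (hK : IsGlobalFunctionField k K)
    {v : FinitePlace infty} {L L' : Submodule (complInt v.1) (AlgCompl D v.1)}
    (hL : IsFullLattice L) (hL' : L'.FG) {c : K} (hc : v.1.1.valuation c < 1) :
    ∃ d : ℕ, ∀ y ∈ L', algebraMap K (Compl v.1) c ^ d • y ∈ L := by
  have h1 : ∀ y, ∃ d : ℕ, ∀ e ≥ d, algebraMap K (Compl v.1) c ^ e • y ∈ L := by
    intro y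
    obtain ⟨a, ha, hay⟩ := hL.full y
    have ha0 : (a : Compl v.1) ≠ 0 := fun h => ha (Subtype.ext h)
    obtain ⟨d, hd⟩ := exists_pow_mul_mem_complInt hK v hc (a : Compl v.1)⁻¹
    refine ⟨d, fun e he => ?_⟩
    have h2 := L.smul_mem ⟨_, hd e he⟩ hay
    rwa [coe_smul_eq, coe_smul_eq, smul_smul, inv_mul_cancel_right₀ ha0] at h2
  obtain ⟨S, rfl⟩ := hL'
  choose d hd using h1
  refine ⟨S.sup d, fun y hy => ?_⟩
  induction hy using Submodule.span_induction with
  | mem y hy => exact hd y _ (Finset.le_sup hy)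
  | zero => rw [smul_zero]; exact Submodule.zero_mem _
  | add y y' _ _ h h' => rw [smul_add]; exact Submodule.add_mem _ h h'
  | smul b y _ h =>
    rw [coe_smul_eq, smul_comm]
    exact L.smul_mem b h

theorem exists_basis_mem {J : Submodule (regularRing infty) D}
    (hspan : Submodule.span K (J : Set D) = ⊤) :
    ∃ (ι : Type w) (B : Module.Basis ι K D), ∀ i, B i ∈ J := by
  obtain ⟨b, hbJ, hb, hli⟩ := exists_linearIndependent K (J : Set D)
  refine ⟨b, Module.Basis.mk hli (by rw [Subtype.range_coe, hb, hspan]), fun i => ?_⟩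
  rw [Module.Basis.mk_apply]
  exact hbJ i.2

theorem repr_mem_regularRing {ι : Type*} (B : Module.Basis ι K D) {y : D}
    (hy : y ∈ Submodule.span (regularRing infty) (Set.range B)) (i : ι) :
    B.repr y i ∈ regularRing infty := by
  classical
  induction hy using Submodule.span_induction with
  | mem y hy =>
    obtain ⟨j, rfl⟩ := hy
    rw [Module.Basis.repr_self, Finsupp.single_apply]
    split_ifs
    exacts [one_mem _, zero_mem _]
  | zero => rw [map_zero]; exact zero_mem _
  | add y y' _ _ h h' => rw [map_add]; exact add_mem h h'
  | smul a y _ h =>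
    rw [Subring.smul_def, map_smul]
    exact mul_mem a.2 h

theorem repr_mem_complInt {ι : Type*} (B : Module.Basis ι K D) {v : FinitePlace infty}
    {y : AlgCompl D v.1}
    (hy : y ∈ completeModule (Submodule.span (regularRing infty) (Set.range B)) v) (i : ι) :
    (Algebra.TensorProduct.basis (Compl v.1) B).repr y i ∈ complInt v.1 := by
  rw [completeModule] at hy
  induction hy using Submodule.span_induction with
  | mem y hy =>
    obtain ⟨y, hy, rfl⟩ := hy
    rw [Algebra.TensorProduct.basis_repr_tmul, one_smul, Finsupp.mapRange_apply]
    exact mem_of_mem_regularRing v ⟨_, repr_mem_regularRing B hy i⟩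
  | zero => rw [map_zero]; exact zero_mem _
  | add y y' _ _ h h' => rw [map_add]; exact add_mem h h'
  | smul a y _ h =>
    rw [coe_smul_eq, map_smul]
    exact mul_mem a.2 h

/-- An element of `D` with coordinates integral at `v` lies in the localization at `v` of any
lattice that contains the basis. -/
theorem exists_smul_mem_of_repr_mem (hK : IsGlobalFunctionField k K)
    {J : Submodule (regularRing infty) D} {ι : Type*} (B : Module.Basis ι K D) (hB : ∀ i, B i ∈ J)
    (v : FinitePlace infty) {x : D} (hx : ∀ i, B.repr x i ∈ v.1.1) :
    ∃ s : regularRing infty, v.1.1.valuation (s : K) = 1 ∧ s • x ∈ J := by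
  classical
  choose t ht htx using fun i => exists_mul_mem_regularRing hK v (hx i)
  refine ⟨∏ i ∈ (B.repr x).support, t i, ?_, ?_⟩
  · rw [← Subring.subtype_apply, map_prod, map_prod]
    exact Finset.prod_eq_one fun i _ => ht i
  · have h5 := B.linearCombination_repr x
    rw [Finsupp.linearCombination_apply, Finsupp.sum] at h5
    nth_rewrite 2 [← h5]
    rw [Finset.smul_sum]
    refine J.sum_mem fun i hi => ?_
    rw [← Finset.prod_erase_mul _ _ hi, mul_smul]
    refine J.smul_mem _ ?_
    rw [Subring.smul_def, smul_smul, mul_comm]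
    exact smul_mem_of_coe J ⟨_, htx i⟩ (hB i)

/-- An element of `D` that lies in the completion of a lattice `J` at `v` lies in the
localization of `J` at `v`. -/
theorem exists_smul_mem_of_tmul_mem (hK : IsGlobalFunctionField k K)
    {J : Submodule (regularRing infty) D} (hJ : J.FG)
    (hspan : Submodule.span K (J : Set D) = ⊤) (v : FinitePlace infty) {x : D}
    (hx : (1 : Compl v.1) ⊗ₜ[K] x ∈ completeModule J v) :
    ∃ s : regularRing infty, v.1.1.valuation (s : K) = 1 ∧ s • x ∈ J := by
  -- a basis of `D` contained in `J` spans a sublattice `N` with `s J ⊆ N`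
  obtain ⟨ι, B, hB⟩ := exists_basis_mem hspan
  let N : Submodule (regularRing infty) D := Submodule.span _ (Set.range B)
  obtain ⟨s, hs, hsJ⟩ := exists_forall_smul_mem hK (N := N) hJ (by
    rw [eq_top_iff, ← B.span_eq]
    exact Submodule.span_mono Submodule.subset_span)
  have hs0 : algebraMap K (Compl v.1) s ≠ 0 := (map_ne_zero _).2 fun h => hs (Subtype.ext h)
  obtain ⟨x', hx', z, hz, hxz⟩ := exists_eq_tmul_add_smul hK hx hs0
  have h1 : (1 : Compl v.1) ⊗ₜ[K] (x - x') ∈ completeModule N v := by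
    rw [TensorProduct.tmul_sub, hxz, add_sub_cancel_left]
    exact smul_mem_completeModule_of_forall hsJ hz
  -- hence the coordinates of `x - x'` are integral at `v`
  obtain ⟨t, ht, htx⟩ := exists_smul_mem_of_repr_mem hK B hB v (x := x - x') fun i => by
    have h4 := repr_mem_complInt B h1 i
    rwa [Algebra.TensorProduct.basis_repr_tmul, one_smul, Finsupp.mapRange_apply,
      algebraMap_mem_complInt] at h4
  refine ⟨t, ht, ?_⟩
  have h2 := J.add_mem htx (J.smul_mem t hx')
  rwa [← smul_add, sub_add_cancel] at h2

/-- A lattice is the intersection of its completions. -/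
theorem mem_iff_forall_tmul_mem (hK : IsGlobalFunctionField k K)
    {J : Submodule (regularRing infty) D} (hJ : J.FG)
    (hspan : Submodule.span K (J : Set D) = ⊤) {x : D} :
    x ∈ J ↔ ∀ v : FinitePlace infty, (1 : Compl v.1) ⊗ₜ[K] x ∈ completeModule J v := by
  refine ⟨fun hx v => tmul_mem_completeModule v hx, fun h => ?_⟩
  have h1 := one_mem_of_forall_exists_valuation_eq_one hK
    (J.comap (LinearMap.toSpanSingleton (regularRing infty) D x)) fun v => by
      obtain ⟨s, hs, hsx⟩ := exists_smul_mem_of_tmul_mem hK hJ hspan v (h v)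
      exact ⟨s, hsx, hs⟩
  have h2 : (1 : regularRing infty) • x ∈ J := h1
  rwa [one_smul] at h2

theorem inv_pow_smul_mem_completeModule {J : Submodule (regularRing infty) D}
    {w : FinitePlace infty} {c : K} (hc : w.1.1.valuation c = 1) (hc0 : c ≠ 0) (n : ℕ) {x : D}
    (hx : c ^ n • x ∈ J) : (1 : Compl w.1) ⊗ₜ[K] x ∈ completeModule J w := by
  have h1 := smul_mem_completeModule (inv_algebraMap_pow_mem_complInt hc n) (tmul_mem_completeModule w hx)
  rwa [← algebraMap_smul_one_tmul, smul_smul, map_pow, ← mul_pow,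
    inv_mul_cancel₀ ((map_ne_zero _).2 hc0), one_pow, one_smul] at h1

/-- A lattice can be modified at one place at will. If `c` vanishes only at `v`, the new lattice consists
of the elements `x` in `L` such that `c^m x` lies in `J`. -/
theorem exists_completeModule_eq (hK : IsGlobalFunctionField k K)
    {J : Submodule (regularRing infty) D} (hJ : J.FG)
    (hspan : Submodule.span K (J : Set D) = ⊤) (v : FinitePlace infty)
    {L : Submodule (complInt v.1) (AlgCompl D v.1)} (hL : IsFullLattice L) :
    ∃ I : Submodule (regularRing infty) D, I.FG ∧ Submodule.span K (I : Set D) = ⊤ ∧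
      completeModule I v = L ∧ ∀ w, w ≠ v → completeModule I w = completeModule J w := by
  have := hasFiniteQuotients_regularRing hK infty
  obtain ⟨c, hc0, hc, hcw⟩ := exists_vanishing_only_at hK v
  have hcK : (c : K) ≠ 0 := fun h => hc0 (Subtype.ext h)
  have hcv : algebraMap K (Compl v.1) c ≠ 0 := (map_ne_zero _).2 hcK
  have hcpow : ∀ n, ((c ^ n : regularRing infty) : K) = (c : K) ^ n := fun n => rfl
  obtain ⟨m, hm⟩ := (isFullLattice_completeModule hK hJ hspan v).exists_pow_forall_smul_mem hK
    hL.fg hc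
  obtain ⟨m', hm'⟩ := hL.exists_pow_forall_smul_mem hK (completeModule_fg hJ v) hc
  let I : Submodule (regularRing infty) D :=
    { carrier := {x | (c : K) ^ m • x ∈ J ∧ (1 : Compl v.1) ⊗ₜ[K] x ∈ L}
      zero_mem' := by
        refine ⟨?_, ?_⟩
        · rw [smul_zero]; exact J.zero_mem
        · rw [TensorProduct.tmul_zero]; exact L.zero_mem
      add_mem' := by
        rintro x y ⟨h1, h2⟩ ⟨h3, h4⟩
        refine ⟨?_, ?_⟩
        · rw [smul_add]; exact J.add_mem h1 h3
        · rw [TensorProduct.tmul_add]; exact L.add_mem h2 h4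
      smul_mem' := by
        rintro a x ⟨h1, h2⟩
        refine ⟨?_, ?_⟩
        · rw [smul_comm]; exact J.smul_mem a h1
        · rw [Subring.smul_def, ← algebraMap_smul_one_tmul]
          exact L.smul_mem ⟨_, mem_of_mem_regularRing v a⟩ h2 }
  have hIJ : ∀ x ∈ J, (c : K) ^ m' • x ∈ I := by
    intro x hx
    refine ⟨?_, ?_⟩
    · rw [smul_smul, ← pow_add, ← hcpow]
      exact smul_mem_of_coe J _ hx
    · rw [← algebraMap_smul_one_tmul, map_pow]
      exact hm' _ (tmul_mem_completeModule v hx)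
  refine ⟨I, ?_, ?_, le_antisymm (completeModule_le fun x hx => hx.2) ?_, ?_⟩
  · let μ : D →ₗ[regularRing infty] D :=
      (LinearMap.lsmul K D ((c : K) ^ m)⁻¹).restrictScalars (regularRing infty)
    refine (hJ.map μ).of_le fun x hx => ⟨(c : K) ^ m • x, hx.1, ?_⟩
    exact inv_smul_smul₀ (pow_ne_zero m hcK) x
  · exact span_eq_top_of_forall_smul_mem hspan (pow_ne_zero m' hc0) hIJ
  · intro y hy
    obtain ⟨x, hx, z, hz, hyx⟩ := exists_eq_tmul_add_smul hK (hm y hy) (pow_ne_zero (m + m') hcv)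
    have h1 : y = 1 ⊗ₜ[K] (((c : K) ^ m)⁻¹ • x) + algebraMap K (Compl v.1) c ^ m' • z := by
      rw [← algebraMap_smul_one_tmul, map_inv₀, map_pow, eq_comm,
        ← smul_right_inj (pow_ne_zero m hcv), smul_add, smul_inv_smul₀ (pow_ne_zero m hcv), hyx,
        smul_smul, ← pow_add]
    have h2 : (((c : K) ^ m)⁻¹ • x) ∈ I := by
      refine ⟨?_, ?_⟩
      · rwa [smul_inv_smul₀ (pow_ne_zero m hcK)]
      · have h3 := L.sub_mem hy (hm' z hz)
        rwa [h1, add_sub_cancel_right] at h3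
    rw [h1]
    refine Submodule.add_mem _ (tmul_mem_completeModule v h2) ?_
    rw [← map_pow]
    exact smul_mem_completeModule_of_forall hIJ hz
  · intro w hw
    exact le_antisymm
      (completeModule_le fun x hx => inv_pow_smul_mem_completeModule (hcw w hw) hcK m hx.1)
      (completeModule_le fun x hx =>
        inv_pow_smul_mem_completeModule (hcw w hw) hcK m' (hIJ x hx))

variable {R : Subalgebra (regularRing infty) D}

theorem one_tmul_mul (v : Place K) (x y : D) :
    (1 : Compl v) ⊗ₜ[K] (x * y) = (1 ⊗ₜ[K] x) * (1 ⊗ₜ[K] y) := by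
  rw [Algebra.TensorProduct.tmul_mul_tmul, one_mul]

theorem tmul_mem_completeOrder (v : FinitePlace infty) {x : D} (hx : x ∈ R) :
    (1 : Compl v.1) ⊗ₜ[K] x ∈ completeOrder R v :=
  Algebra.subset_adjoin ⟨x, hx, rfl⟩

/-- A right ideal can be modified at one place at will. -/
theorem RightIdeal.exists_completeModule_eq (hK : IsGlobalFunctionField k K) (J : RightIdeal R)
    (v : FinitePlace infty) {L : Submodule (complInt v.1) (AlgCompl D v.1)} (hL : IsFullLattice L)
    (hLR : ∀ x ∈ L, ∀ ρ ∈ completeOrder R v, x * ρ ∈ L) :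
    ∃ I : RightIdeal R, completeModule I.carrier v = L ∧
      ∀ w, w ≠ v → completeModule I.carrier w = completeModule J.carrier w := by
  obtain ⟨I, hI, hspan, hv, hw⟩ := GlobalOrders.exists_completeModule_eq hK J.fg J.span_eq_top v hL
  refine ⟨⟨I, hI, hspan, fun x hx r hr => ?_⟩, hv, hw⟩
  rw [mem_iff_forall_tmul_mem hK hI hspan]
  intro w
  rw [one_tmul_mul]
  rcases eq_or_ne w v with rfl | hwv
  · rw [hv]
    exact hLR _ (hv ▸ tmul_mem_completeModule w hx) _ (tmul_mem_completeOrder w hr)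
  · rw [hw w hwv]
    exact J.mul_mem_completeModule (hw w hwv ▸ tmul_mem_completeModule w hx)
      (tmul_mem_completeOrder w hr)

theorem transporter_fg (hK : IsGlobalFunctionField k K) {I J : Submodule (regularRing infty) D}
    (hI : Submodule.span K (I : Set D) = ⊤) (hJ : J.FG) : (transporter I J).FG := by
  have := hasFiniteQuotients_regularRing hK infty
  obtain ⟨s, hs, hsI⟩ := exists_smul_mem_of_span_eq_top hK hI 1
  have hsK : (s : K) ≠ 0 := fun h => hs (Subtype.ext h)
  let μ : D →ₗ[regularRing infty] D :=
    (LinearMap.lsmul K D (s : K)⁻¹).restrictScalars (regularRing infty)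
  refine (hJ.map μ).of_le fun x hx => ⟨(s : K) • x, ?_, inv_smul_smul₀ hsK x⟩
  have h1 : x * (s • (1 : D)) ∈ J := hx _ hsI
  rwa [mul_smul_comm, mul_one] at h1

theorem span_transporter_eq_top (hK : IsGlobalFunctionField k K)
    {I J : Submodule (regularRing infty) D} (hI : I.FG)
    (hJ : Submodule.span K (J : Set D) = ⊤) :
    Submodule.span K (transporter I J : Set D) = ⊤ := by
  rw [eq_top_iff]
  intro x _
  obtain ⟨s, hs, hsx⟩ := exists_forall_smul_mem hK
    (hI.map (LinearMap.mulLeft (regularRing infty) x)) hJ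
  have hsK : (s : K) ≠ 0 := fun h => hs (Subtype.ext h)
  have h1 : (s : K) • x ∈ transporter I J := fun y hy => by
    rw [smul_mul_assoc]
    exact hsx _ ⟨y, hy, rfl⟩
  rw [← inv_smul_smul₀ hsK x]
  exact Submodule.smul_mem _ _ (Submodule.subset_span h1)

theorem completeModule_mul (I J : Submodule (regularRing infty) D) (v : FinitePlace infty) :
    completeModule (I * J) v = completeModule I v * completeModule J v := by
  refine le_antisymm (completeModule_le fun z hz => ?_) ?_
  · induction hz using Submodule.mul_induction_on' with
    | mem_mul_mem x hx y hy =>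
      rw [one_tmul_mul]
      exact Submodule.mul_mem_mul (tmul_mem_completeModule v hx) (tmul_mem_completeModule v hy)
    | add x _ y _ hx hy => rw [TensorProduct.tmul_add]; exact Submodule.add_mem _ hx hy
  · rw [completeModule, completeModule, completeModule, Submodule.span_mul_span]
    refine Submodule.span_mono ?_
    rintro _ ⟨_, ⟨x, hx, rfl⟩, _, ⟨y, hy, rfl⟩, rfl⟩
    exact ⟨x * y, Submodule.mul_mem_mul hx hy, one_tmul_mul v.1 x y⟩

/-- Transporters commute with completion. -/
theorem mem_completeModule_transporter (hK : IsGlobalFunctionField k K)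
    {I J : Submodule (regularRing infty) D} (hI : I.FG) (hJ : J.FG)
    (hspan : Submodule.span K (J : Set D) = ⊤) {v : FinitePlace infty} {x : AlgCompl D v.1} :
    x ∈ completeModule (transporter I J) v ↔
      ∀ y ∈ completeModule I v, x * y ∈ completeModule J v := by
  have hmul : ∀ x ∈ completeModule (transporter I J) v, ∀ y ∈ completeModule I v,
      x * y ∈ completeModule J v := by
    intro x hx y hy
    have h1 := Submodule.mul_mem_mul hx hy
    rw [← completeModule_mul] at h1
    have h2 : transporter I J * I ≤ J := Submodule.mul_le.2 fun d hd y hy => hd y hy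
    exact completeModule_mono h2 v h1
  refine ⟨hmul x, fun hx => ?_⟩
  obtain ⟨c, hc0, hc, -⟩ := exists_vanishing_only_at hK v
  have hcK : (c : K) ≠ 0 := fun h => hc0 (Subtype.ext h)
  have hcv : algebraMap K (Compl v.1) c ≠ 0 := (map_ne_zero _).2 hcK
  obtain ⟨m, hm⟩ := exists_pow_smul_mem hK (span_transporter_eq_top hK hI hspan) hc x
  obtain ⟨r, hr, z, hz, hxr⟩ := exists_eq_tmul_add_smul hK (hm m le_rfl) (pow_ne_zero m hcv)
  -- `x` is congruent to an element `d` of `D` modulo the completion of the transporter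
  set d : D := ((c : K) ^ m)⁻¹ • r with hd
  have h1 : x = 1 ⊗ₜ[K] d + z := by
    rw [hd, ← algebraMap_smul_one_tmul, map_inv₀, map_pow, eq_comm,
      ← smul_right_inj (pow_ne_zero m hcv), smul_add, smul_inv_smul₀ (pow_ne_zero m hcv), hxr]
  have h2 : ∀ y, ∃ s : regularRing infty, v.1.1.valuation (s : K) = 1 ∧
      (y ∈ I → s • (d * y) ∈ J) := by
    intro y
    by_cases hy : y ∈ I
    · have h3 := Submodule.sub_mem _ (hx _ (tmul_mem_completeModule v hy))
        (hmul z hz _ (tmul_mem_completeModule v hy))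
      rw [← sub_mul, h1, add_sub_cancel_right, ← one_tmul_mul] at h3
      obtain ⟨s, hs, hsy⟩ := exists_smul_mem_of_tmul_mem hK hJ hspan v h3
      exact ⟨s, hs, fun _ => hsy⟩
    · exact ⟨1, map_one _, fun h => absurd h hy⟩
  choose s hs hsd using h2
  obtain ⟨S, hS⟩ := hI
  have h3 : (∏ y ∈ S, s y) • d ∈ transporter I J := by
    intro y hy
    rw [smul_mul_assoc]
    rw [← hS] at hy
    induction hy using Submodule.span_induction with
    | mem y hy =>
      classical
      have hy' : y ∈ I := hS ▸ Submodule.subset_span hy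
      rw [← Finset.prod_erase_mul _ _ hy, mul_smul]
      exact J.smul_mem _ (hsd y hy')
    | zero => rw [mul_zero, smul_zero]; exact Submodule.zero_mem _
    | add y y' _ _ h h' => rw [mul_add, smul_add]; exact Submodule.add_mem _ h h'
    | smul b y _ h =>
      rw [mul_smul_comm, smul_comm]
      exact Submodule.smul_mem _ _ h
  have h4 : v.1.1.valuation ((∏ y ∈ S, s y : regularRing infty) : K) = 1 := by
    rw [← Subring.subtype_apply, map_prod, map_prod]
    exact Finset.prod_eq_one fun i _ => hs i
  rw [h1]
  refine add_mem ?_ hz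
  exact inv_pow_smul_mem_completeModule h4
    (fun h => by rw [h, map_zero] at h4; exact zero_ne_one h4) 1 (by rw [pow_one]; exact h3)

/-- The left order of a right ideal is an order. -/
theorem isOrder_leftOrder (hK : IsGlobalFunctionField k K) (I : RightIdeal R) :
    IsOrder (leftOrder I) where
  fg := transporter_fg hK I.span_eq_top I.fg
  span_eq_top := span_transporter_eq_top hK I.fg I.span_eq_top

theorem mem_completeOrder_leftOrder (hK : IsGlobalFunctionField k K) {I : RightIdeal R}
    {v : FinitePlace infty} {x : AlgCompl D v.1} : x ∈ completeOrder (leftOrder I) v ↔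
      ∀ y ∈ completeModule I.carrier v, x * y ∈ completeModule I.carrier v := by
  rw [← mem_completeModule_transporter hK I.fg I.fg I.span_eq_top, ← Subalgebra.mem_toSubmodule,
    completeOrder_toSubmodule]
  rfl

end Completion

/-! ### Local descriptions of orders -/

section Sandwich

variable {K D : Type*} [Field K] [Ring D] [Algebra K D]

/-- Every linear form on a central simple algebra is a sum of two-sided multiplications. By the density
theorem for the simple bimodule `D`, whose endomorphisms are the scalars, the two-sided multiplications
exhaust the linear endomorphisms of `D`. -/
theorem exists_sum_mul_mul_eq [IsSimpleRing D] [Algebra.IsCentral K D]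
    [FiniteDimensional K D] (φ : D →ₗ[K] K) :
    ∃ (n : ℕ) (a b : Fin n → D), ∀ x, ∑ i, a i * x * b i = algebraMap K D (φ x) := by
  let _ : Module (D ⊗[K] Dᵐᵒᵖ) D := TensorProduct.Algebra.module
  have hsmul : ∀ (a : D) (b : Dᵐᵒᵖ) (x : D), (a ⊗ₜ[K] b) • x = a * x * b.unop := by
    intro a b x
    rw [TensorProduct.Algebra.smul_def, MulOpposite.smul_eq_mul_unop, smul_eq_mul, mul_assoc]
  have : IsSimpleModule (D ⊗[K] Dᵐᵒᵖ) D := by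
    refine isSimpleModule_iff_toSpanSingleton_surjective.2 ⟨inferInstance, fun x hx => ?_⟩
    let N := LinearMap.range (LinearMap.toSpanSingleton (D ⊗[K] Dᵐᵒᵖ) D x)
    let T : TwoSidedIdeal D := TwoSidedIdeal.mk' (N : Set D) N.zero_mem N.add_mem N.neg_mem
      (fun {a y} hy => by
        have h := N.smul_mem (a ⊗ₜ[K] 1) hy
        rwa [hsmul, MulOpposite.unop_one, mul_one] at h)
      (fun {y b} hy => by
        have h := N.smul_mem (1 ⊗ₜ[K] MulOpposite.op b) hy
        rwa [hsmul, MulOpposite.unop_op, one_mul] at h)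
    have hT : ∀ y, y ∈ T ↔ y ∈ N := fun y => TwoSidedIdeal.mem_mk' ..
    have hx1 : x ∈ T := (hT x).2 ⟨1, one_smul _ x⟩
    rcases eq_bot_or_eq_top T with h | h
    · rw [h, TwoSidedIdeal.mem_bot] at hx1
      exact absurd hx1 hx
    · intro y
      exact (hT y).1 (h ▸ TwoSidedIdeal.mem_top D)
  -- an endomorphism of the bimodule `D` is the multiplication by a scalar
  have hend : ∀ g : Module.End (D ⊗[K] Dᵐᵒᵖ) D, ∃ c : K, ∀ x, g x = c • x := by
    intro g
    have h1 : ∀ x, g x = x * g 1 := fun x => by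
      have := g.map_smul (x ⊗ₜ[K] 1) 1
      rwa [hsmul, hsmul, MulOpposite.unop_one, mul_one, mul_one, mul_one] at this
    have h2 : ∀ x, g x = g 1 * x := fun x => by
      have := g.map_smul (1 ⊗ₜ[K] MulOpposite.op x) 1
      rwa [hsmul, hsmul, MulOpposite.unop_op, one_mul, one_mul, one_mul] at this
    have h3 : g 1 ∈ Subalgebra.center K D :=
      Subalgebra.mem_center_iff.2 fun x => by rw [← h1, ← h2]
    rw [Algebra.IsCentral.center_eq_bot] at h3
    obtain ⟨c, hc⟩ := Algebra.mem_bot.1 h3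
    exact ⟨c, fun x => by rw [h2, ← hc, Algebra.smul_def]⟩
  let f : Module.End (Module.End (D ⊗[K] Dᵐᵒᵖ) D) D :=
    { toFun := fun x => algebraMap K D (φ x)
      map_add' := fun x y => by rw [map_add, map_add]
      map_smul' := fun g x => by
        obtain ⟨c, hc⟩ := hend g
        rw [Module.End.smul_def, hc, map_smul, RingHom.id_apply, Module.End.smul_def, hc,
          smul_eq_mul, map_mul, Algebra.smul_def] }
  let B := Module.finBasis K D
  classical
  obtain ⟨r, hr⟩ := jacobson_density f (Finset.univ.image B)
  obtain ⟨n, a, b, rfl⟩ := TensorProduct.exists_sum_tmul_eq r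
  refine ⟨n, a, fun i => (b i).unop, fun x => ?_⟩
  let F : D →ₗ[K] D := ∑ i, LinearMap.mulLeftRight K (a i, (b i).unop)
  have hF : F = (Algebra.linearMap K D).comp φ := by
    refine B.ext fun j => ?_
    have h1 := hr (B j) (Finset.mem_image_of_mem _ (Finset.mem_univ j))
    rw [Finset.sum_smul] at h1
    simp only [hsmul] at h1
    simp only [F, LinearMap.sum_apply, LinearMap.mulLeftRight_apply]
    exact h1.symm
  have h2 := congrArg (fun G => G x) hF
  simp only [F, LinearMap.sum_apply, LinearMap.mulLeftRight_apply] at h2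
  exact h2

variable {F : Type*} [Field F] [Algebra K F] {ι : Type*}

/-- The coordinates of an element of `F ⊗ D` are recovered by two-sided multiplications. -/
theorem sum_tmul_mul_mul_tmul_eq (B : Module.Basis ι K D) {j : ι} {n : ℕ} {a b : Fin n → D}
    (h : ∀ x, ∑ i, a i * x * b i = algebraMap K D (B.coord j x)) (y : F ⊗[K] D) :
    ∑ i, ((1 : F) ⊗ₜ[K] a i) * y * ((1 : F) ⊗ₜ[K] b i) =
      algebraMap F (F ⊗[K] D) ((Algebra.TensorProduct.basis F B).repr y j) := by
  induction y using TensorProduct.induction_on with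
  | zero => simp
  | add x y hx hy =>
    rw [map_add, Finsupp.add_apply, map_add, ← hx, ← hy, ← Finset.sum_add_distrib]
    exact Finset.sum_congr rfl fun i _ => by rw [mul_add, add_mul]
  | tmul c x =>
    rw [Algebra.TensorProduct.basis_repr_tmul, Finsupp.smul_apply, Finsupp.mapRange_apply]
    simp only [Algebra.TensorProduct.tmul_mul_tmul, one_mul, mul_one]
    rw [← TensorProduct.tmul_sum, h, Algebra.TensorProduct.algebraMap_apply, smul_eq_mul,
      Algebra.algebraMap_eq_smul_one, TensorProduct.tmul_smul, TensorProduct.smul_tmul',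
      Algebra.smul_def, mul_comm]
    rfl

/-- A central simple algebra stays simple under field extension. -/
theorem isSimpleRing_tensorProduct [IsSimpleRing D] [Algebra.IsCentral K D]
    [FiniteDimensional K D] : IsSimpleRing (F ⊗[K] D) := by
  have hinj : Function.Injective (fun x : D => (1 : F) ⊗ₜ[K] x) :=
    Algebra.TensorProduct.includeRight_injective (algebraMap K F).injective
  have : Nontrivial (F ⊗[K] D) := hinj.nontrivial
  refine ⟨⟨fun T => or_iff_not_imp_left.2 fun hT => ?_⟩⟩
  obtain ⟨y, hy, hy0⟩ : ∃ y ∈ T, y ≠ 0 := by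
    by_contra! h
    exact hT (le_antisymm (fun y hy => (TwoSidedIdeal.mem_bot _).2 (h y hy)) bot_le)
  let B := Module.finBasis K D
  obtain ⟨j, hj⟩ : ∃ j, (Algebra.TensorProduct.basis F B).repr y j ≠ 0 := by
    by_contra! h
    exact hy0 ((Algebra.TensorProduct.basis F B).repr.map_eq_zero_iff.1 (Finsupp.ext h))
  obtain ⟨n, a, b, hab⟩ := exists_sum_mul_mul_eq (B.coord j)
  have h1 : algebraMap F (F ⊗[K] D) ((Algebra.TensorProduct.basis F B).repr y j) ∈ T := by
    rw [← sum_tmul_mul_mul_tmul_eq B hab]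
    exact sum_mem fun i _ => T.mul_mem_right _ _ (T.mul_mem_left _ _ hy)
  have h2 := T.mul_mem_left
    (algebraMap F (F ⊗[K] D) ((Algebra.TensorProduct.basis F B).repr y j)⁻¹) _ h1
  rw [← map_mul, inv_mul_cancel₀ hj, map_one] at h2
  refine le_antisymm le_top fun z _ => ?_
  have h3 := T.mul_mem_left z _ h2
  rwa [mul_one] at h3

end Sandwich

section Descriptions

variable {K : Type u} [Field K] {D : Type w} [Ring D] [Algebra K D] {infty : Place K}
  {R : Subalgebra (regularRing infty) D} {v : FinitePlace infty}

instance [Nontrivial D] (v : Place K) : Nontrivial (AlgCompl D v) :=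
  (Algebra.TensorProduct.includeRight_injective
    (algebraMap K (Compl v)).injective : Function.Injective
      (fun x : D => (1 : Compl v) ⊗ₜ[K] x)).nontrivial

theorem LocalDescription.nonempty_blockIndex [Nontrivial D] (S : LocalDescription R v) :
    Nonempty (BlockIndex S.f) := by
  by_contra h
  rw [not_nonempty_iff] at h
  have h1 : Subsingleton (AlgCompl D v.1) := S.φ.toEquiv.subsingleton
  exact not_subsingleton _ h1

theorem LocalDescription.finiteDimensional [Nontrivial D] [FiniteDimensional K D]
    (S : LocalDescription R v) : FiniteDimensional (Compl v.1) S.Δ := by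
  obtain ⟨b⟩ := S.nonempty_blockIndex
  have h1 : FiniteDimensional (Compl v.1) S.Mat := S.φ.toLinearEquiv.finiteDimensional
  exact Module.Finite.of_surjective (Matrix.entryLinearMap (Compl v.1) S.Δ b b) fun x =>
    ⟨Matrix.single b b x, Matrix.single_apply_same ..⟩

variable {k : Type*} [Field k] [Algebra k K]

theorem isFullLattice_completeOrder (hK : IsGlobalFunctionField k K) (hR : IsOrder R)
    (v : FinitePlace infty) : IsFullLattice (Subalgebra.toSubmodule (completeOrder R v)) := by
  rw [completeOrder_toSubmodule]
  exact isFullLattice_completeModule hK hR.fg hR.span_eq_top v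

/-- The order `R` as a right ideal of itself. -/
def IsOrder.rightIdeal (hR : IsOrder R) : RightIdeal R where
  carrier := Subalgebra.toSubmodule R
  fg := hR.fg
  span_eq_top := hR.span_eq_top
  mul_mem _ hx _ hr := R.mul_mem hx hr

/-- If all right lattices of an order have dual bases, so have those of its completions, because
every local lattice is the completion of a global one. -/
theorem HasDualBases.completeOrder (hK : IsGlobalFunctionField k K) (hR : IsOrder R)
    (h : HasDualBases R) (v : FinitePlace infty) : HasDualBases (completeOrder R v) := by
  intro L hL hLR
  obtain ⟨I, hI, -⟩ := hR.rightIdeal.exists_completeModule_eq hK v hL hLR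
  have hfull : IsFullLattice I.carrier :=
    ⟨I.fg, fun x => exists_smul_mem_of_span_eq_top hK I.span_eq_top x⟩
  have h1 := h I.carrier hfull I.mul_mem
  have h2 : ∀ z ∈ I.carrier * transporter I.carrier (Subalgebra.toSubmodule R),
      (1 : Compl v.1) ⊗ₜ[K] z ∈
        L * transporter L (Subalgebra.toSubmodule (GlobalOrders.completeOrder R v)) := by
    intro z hz
    induction hz using Submodule.mul_induction_on' with
    | mem_mul_mem x hx d hd =>
      rw [one_tmul_mul]
      refine Submodule.mul_mem_mul (hI ▸ tmul_mem_completeModule v hx) fun y hy => ?_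
      rw [← hI] at hy
      induction hy using Submodule.span_induction with
      | mem y hy =>
        obtain ⟨y, hy, rfl⟩ := hy
        change (1 : Compl v.1) ⊗ₜ[K] d * ((1 : Compl v.1) ⊗ₜ[K] y) ∈ _
        rw [← one_tmul_mul]
        exact tmul_mem_completeOrder v (hd y hy)
      | zero => rw [mul_zero]; exact Submodule.zero_mem _
      | add y y' _ _ h h' => rw [mul_add]; exact Submodule.add_mem _ h h'
      | smul b y _ h => rw [mul_smul_comm]; exact Submodule.smul_mem _ _ h
    | add x _ y _ hx hy => rw [TensorProduct.tmul_add]; exact Submodule.add_mem _ hx hy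
  exact h2 1 h1

/-- At every finite place an order whose right lattices have dual bases has an invariant. -/
theorem nonempty_localDescription [IsSimpleRing D] [Algebra.IsCentral K D] [FiniteDimensional K D]
    (hK : IsGlobalFunctionField k K) (hR : IsOrder R) (h : HasDualBases R)
    (v : FinitePlace infty) : Nonempty (LocalDescription R v) := by
  have : IsSimpleRing (AlgCompl D v.1) := isSimpleRing_tensorProduct
  have : IsArtinianRing (AlgCompl D v.1) := IsArtinianRing.of_finite (Compl v.1) _
  obtain ⟨n, hn, Δ, _, _, _, ⟨e⟩⟩ :=
    IsSimpleRing.exists_algEquiv_matrix_divisionRing_finite (Compl v.1) (AlgCompl D v.1)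
  let e' : AlgCompl D v.1 ≃ₐ[complInt v.1] Matrix (Fin n) (Fin n) Δ := e.restrictScalars _
  obtain ⟨f, hf, ψ, hψ⟩ := (isLocalFieldBase_complInt hK v).exists_image_eq_standardOrder
    ((h.completeOrder hK hR v).map e') ((isFullLattice_completeOrder hK hR v).map_subalgebra e')
  refine ⟨⟨Δ, f, hf, e.trans ψ, ?_⟩⟩
  rw [← hψ]
  ext X
  constructor
  · rintro ⟨x, hx, rfl⟩
    exact ⟨e x, ⟨x, hx, rfl⟩, rfl⟩
  · rintro ⟨_, ⟨x, hx, rfl⟩, rfl⟩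
    exact ⟨x, hx, rfl⟩

theorem LocalDescription.hasDualBases_matrixOrder (hK : IsGlobalFunctionField k K)
    (hR : IsOrder R) (h : HasDualBases R) (S : LocalDescription R v) :
    HasDualBases S.matrixOrder :=
  (h.completeOrder hK hR v).map _

theorem LocalDescription.fg_matrixOrder (hK : IsGlobalFunctionField k K) (hR : IsOrder R)
    (S : LocalDescription R v) : (Subalgebra.toSubmodule S.matrixOrder).FG :=
  ((isFullLattice_completeOrder hK hR v).map_subalgebra _).fg

/-- The completion of a right ideal is a direct sum of standard row modules, one for each row. -/
theorem LocalDescription.exists_hasRowType [Nontrivial D] (hK : IsGlobalFunctionField k K)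
    (hR : IsOrder R) (h : HasDualBases R) (S : LocalDescription R v)
    [FiniteDimensional (Compl v.1) S.Δ] (hO : IsLocalFieldBase (complInt v.1))
    (I : RightIdeal R) : ∃ α t, S.HasRowType hO I α t := by
  have := S.nonempty_blockIndex
  let e : AlgCompl D v.1 ≃ₐ[complInt v.1] S.Mat := S.φ.restrictScalars _
  have hL := (isFullLattice_completeModule hK I.fg I.span_eq_top v).map
    (f := e.toLinearMap) e.surjective
  obtain ⟨α, t, hαt⟩ := hO.exists_unit_mul_mem_iff S.coe_matrixOrder
    (S.hasDualBases_matrixOrder hK hR h) hL (by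
      rintro _ ⟨x, hx, rfl⟩ _ ⟨ρ, hρ, rfl⟩
      exact ⟨x * ρ, I.mul_mem_completeModule hx hρ, map_mul e x ρ⟩)
  refine ⟨α, t, fun Y => ?_⟩
  rw [← hαt]
  constructor
  · exact fun hY => ⟨_, hY, S.φ.apply_symm_apply _⟩
  · rintro ⟨x, hx, hxY⟩
    rw [← hxY]
    change S.φ.symm (S.φ x) ∈ _
    rwa [S.φ.symm_apply_apply]

/-- Suppose that the coordinates of the elements of `R_v` with respect to a basis are integral,
and that they arise from two-sided multiplications by elements of `R_v`. Then the period of `R_v`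
is at most one. -/
theorem LocalDescription.period_le_one (S : LocalDescription R v)
    [FiniteDimensional (Compl v.1) S.Δ] (hO : IsLocalFieldBase (complInt v.1)) {ι : Type*}
    [Fintype ι] (B : Module.Basis ι (Compl v.1) (AlgCompl D v.1))
    (hB : ∀ j, B j ∈ completeOrder R v)
    (h : ∀ j, ∃ (n : ℕ) (a b : Fin n → AlgCompl D v.1), (∀ i, a i ∈ completeOrder R v) ∧
      (∀ i, b i ∈ completeOrder R v) ∧
        ∀ x, ∑ i, a i * x * b i = algebraMap (Compl v.1) _ (B.repr x j)) :
    S.period ≤ 1 := by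
  by_contra! hlt
  obtain ⟨b, hb⟩ := exists_block_eq S.f_pos ⟨0, Nat.zero_lt_of_lt hlt⟩
  obtain ⟨b', hb'⟩ := exists_block_eq S.f_pos ⟨1, hlt⟩
  have hbb' : b.1 < b'.1 := by
    rw [hb, hb', Fin.lt_def]
    exact Nat.zero_lt_one
  have hstd : ∀ x ∈ completeOrder R v, S.φ x ∈ standardOrder (complInt v.1) S.Δ S.f := fun x hx =>
    S.coe_matrixOrder ▸ S.apply_mem_matrixOrder.2 hx
  -- the two-sided ideal generated by the first diagonal idempotent contains only scalars in the
  -- maximal ideal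
  let x := S.φ.symm (Matrix.single b b 1)
  have hcoord : ∀ j, algebraMap (Compl v.1) S.Δ (B.repr x j) ∈ maxIdeal (complInt v.1) S.Δ := by
    intro j
    obtain ⟨n, p, q, hp, hq, hpq⟩ := h j
    have h1 := congrArg (fun z => S.φ z b' b') (hpq x)
    simp only [map_sum, map_mul, x, AlgEquiv.apply_symm_apply, AlgEquiv.commutes,
      Matrix.algebraMap_matrix_apply, if_true] at h1
    rw [← h1, Matrix.sum_apply]
    refine hO.sum_mem_maxIdeal fun i _ => ?_
    have h2 : (S.φ (p i) * Matrix.single b b 1 * S.φ (q i) : S.Mat) b' b' =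
        S.φ (p i) b' b * S.φ (q i) b b' := by
      rw [Matrix.mul_apply, Finset.sum_eq_single b]
      · rw [Matrix.mul_single_apply_same, mul_one]
      · intro c _ hc
        rw [Matrix.mul_single_apply_of_ne _ _ _ _ _ hc, zero_mul]
      · simp
    rw [h2]
    exact hO.mul_mem_maxIdeal_right ((hstd _ (hp i) b' b).2 hbb')
      ((hstd _ (hq i) b b').1 hbb'.le)
  have h1 : (Matrix.single b b 1 : S.Mat) b b ∈ maxIdeal (complInt v.1) S.Δ := by
    have h2 : Matrix.single b b 1 = S.φ x := (S.φ.apply_symm_apply _).symm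
    rw [h2, ← B.sum_repr x, map_sum, Matrix.sum_apply]
    refine hO.sum_mem_maxIdeal fun j _ => ?_
    rw [map_smul, Matrix.smul_apply, Algebra.smul_def]
    exact hO.mul_mem_maxIdeal_right (hcoord j) ((hstd _ (hB j) b b).1 le_rfl)
  rw [Matrix.single_apply_same] at h1
  exact one_notMem_maxIdeal h1

/-- Almost all completions of an order have period one: the finitely many elements of `D` that recover
the coordinates by two-sided multiplications are integral at almost all places. -/
theorem finite_setOf_one_lt_period [IsSimpleRing D] [Algebra.IsCentral K D]
    [FiniteDimensional K D] (hK : IsGlobalFunctionField k K) (hR : IsOrder R)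
    (S : ∀ v : FinitePlace infty, LocalDescription R v) :
    {v | 1 < (S v).period}.Finite := by
  obtain ⟨ι, B, hB⟩ := exists_basis_mem (J := Subalgebra.toSubmodule R) hR.span_eq_top
  have := Module.Finite.finite_basis B
  have := Fintype.ofFinite ι
  choose n a b hab using fun j => exists_sum_mul_mul_eq (B.coord j)
  let J : Submodule (regularRing infty) D := Submodule.span _
    ((Set.range fun p : Σ j, Fin (n j) => a p.1 p.2) ∪
      Set.range fun p : Σ j, Fin (n j) => b p.1 p.2)
  have hJ : J.FG := Submodule.fg_span ((Set.finite_range _).union (Set.finite_range _))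
  obtain ⟨t, ht, htJ⟩ := exists_forall_smul_mem hK (N := Subalgebra.toSubmodule R) hJ
    hR.span_eq_top
  have ht0 : (t : K) ≠ 0 := fun h => ht (Subtype.ext h)
  refine (finite_setOf_valuation_lt_one hK ht).subset fun v hv => ?_
  by_contra htv
  have htv1 : v.1.1.valuation (t : K) = 1 :=
    le_antisymm ((v.1.1.valuation_le_one_iff _).2 (mem_regularRing.1 t.2 v)) (not_lt.1 htv)
  have hmem : ∀ x ∈ J, (1 : Compl v.1) ⊗ₜ[K] x ∈ completeOrder R v := by
    intro x hx
    have h1 := inv_pow_smul_mem_completeModule (J := Subalgebra.toSubmodule R) htv1 ht0 1 (x := x)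
      (by rw [pow_one]; exact htJ x hx)
    rwa [← completeOrder_toSubmodule] at h1
  have := (S v).finiteDimensional
  refine absurd ((S v).period_le_one (isLocalFieldBase_complInt hK v)
    (Algebra.TensorProduct.basis (Compl v.1) B) (fun j => ?_) fun j => ?_) (not_le.2 hv)
  · rw [Algebra.TensorProduct.basis_apply]
    exact tmul_mem_completeOrder v (hB j)
  · exact ⟨n j, _, _,
      fun i => hmem _ (Submodule.subset_span (Or.inl ⟨⟨j, i⟩, rfl⟩)),
      fun i => hmem _ (Submodule.subset_span (Or.inr ⟨⟨j, i⟩, rfl⟩)),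
      sum_tmul_mul_mul_tmul_eq B (hab j)⟩

end Descriptions

/-! ### Hereditary orders and genera -/

section Hereditary

variable {K : Type u} [Field K] {D : Type w} [Ring D] [Algebra K D] {infty : Place K}
  {R : Subalgebra (regularRing infty) D} {k : Type*} [Field k] [Algebra k K]

/-- Over a hereditary order all right lattices have dual bases: a section `σ` of a free cover of a right
ideal `N` gives linear forms on `N`, and a form on `N` is the left multiplication by an element of `D`,
as is seen by comparing its values at `y` and at a nonzero scalar in `N`. -/
theorem IsHereditary.hasDualBases (hK : IsGlobalFunctionField k K) (hR : IsOrder R)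
    (h : IsHereditary R) : HasDualBases R := by
  intro J hJ hJR
  obtain ⟨s, hs, hsJ⟩ := exists_forall_smul_mem hK (N := Subalgebra.toSubmodule R) hJ.fg
    hR.span_eq_top
  obtain ⟨t, ht, htJ⟩ := hJ.full 1
  have hsK : (s : K) ≠ 0 := fun h => hs (Subtype.ext h)
  have htK : (t : K) ≠ 0 := fun h => ht (Subtype.ext h)
  -- the ideal `N = s J` of `R` is projective
  let N : Submodule (↥R)ᵐᵒᵖ ↥R :=
    { carrier := {y | (s : K)⁻¹ • (y : D) ∈ J}
      zero_mem' := by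
        change (s : K)⁻¹ • (0 : D) ∈ J
        rw [smul_zero]
        exact J.zero_mem
      add_mem' := fun {x y} hx hy => by
        change (s : K)⁻¹ • ((x : D) + y) ∈ J
        rw [smul_add]
        exact J.add_mem hx hy
      smul_mem' := fun r y hy => by
        change (s : K)⁻¹ • ((y : D) * r.unop) ∈ J
        rw [← smul_mul_assoc]
        exact hJR _ hy _ r.unop.2 }
  obtain ⟨σ, hσ⟩ := (h N).out
  let c : R := s • t • 1
  have hc : (c : D) = ((s : K) * t) • (1 : D) := by rw [mul_smul]; rfl
  have hcN : c ∈ N := by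
    change (s : K)⁻¹ • (c : D) ∈ J
    rw [hc, mul_smul, inv_smul_smul₀ hsK]
    exact htJ
  let y₀ : N := ⟨c, hcN⟩
  have hst : (s : K) * t ≠ 0 := mul_ne_zero hsK htK
  have hmul : ∀ (n y : N), ((σ y₀ n).unop : D) * (y : R) = ((s : K) * t) • ((σ y n).unop : D) := by
    intro n y
    have h1 : MulOpposite.op (y : R) • y₀ = MulOpposite.op c • y := by
      refine Subtype.ext (Subtype.ext ?_)
      change (c : D) * (y : R) = (y : R) * (c : D)
      rw [hc, smul_mul_assoc, one_mul, mul_smul_comm, mul_one]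
    have h2 := congrArg (fun z => ((σ z n).unop : D)) h1
    simp only [map_smul, Finsupp.smul_apply, smul_eq_mul, MulOpposite.unop_mul,
      MulOpposite.unop_op, MulMemClass.coe_mul] at h2
    rw [h2, hc, mul_smul_comm, mul_one]
  have hsum : (c : D) = ∑ n ∈ (σ y₀).support, ((n : R) : D) * ((σ y₀ n).unop : D) := by
    have h1 := congrArg (fun z : N => ((z : R) : D)) (hσ y₀)
    rw [Finsupp.linearCombination_apply, Finsupp.sum] at h1
    simp only [AddSubmonoidClass.coe_finsetSum] at h1
    exact h1.symm
  have hone : (1 : D) = ∑ n ∈ (σ y₀).support,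
      ((s : K)⁻¹ • ((n : R) : D)) * ((t : K)⁻¹ • ((σ y₀ n).unop : D)) := by
    simp only [smul_mul_smul_comm]
    rw [← Finset.smul_sum, ← hsum, hc, ← mul_inv, inv_smul_smul₀ hst]
  rw [hone]
  refine Submodule.sum_mem _ fun n _ => Submodule.mul_mem_mul n.2 fun x hx => ?_
  have hxN : (⟨s • x, hsJ x hx⟩ : R) ∈ N := by
    change (s : K)⁻¹ • ((s : K) • x) ∈ J
    rwa [inv_smul_smul₀ hsK]
  have h1 := hmul n ⟨_, hxN⟩
  have h2 : (t : K)⁻¹ • ((σ y₀ n).unop : D) * x = ((σ ⟨_, hxN⟩ n).unop : D) := by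
    have h3 : ((σ y₀ n).unop : D) * ((s : K) • x) =
      ((s : K) * t) • ((σ ⟨_, hxN⟩ n).unop : D) := h1
    rw [mul_smul_comm, mul_smul, smul_right_inj hsK] at h3
    rw [smul_mul_assoc, h3, inv_smul_smul₀ htK]
  rw [h2]
  exact (σ ⟨_, hxN⟩ n).unop.2

/-- In a division algebra, an order all of whose right lattices have dual bases is hereditary. -/
theorem HasDualBases.isHereditary (hK : IsGlobalFunctionField k K)
    (hunit : ∀ x : D, x ≠ 0 → IsUnit x) (hR : IsOrder R) (h : HasDualBases R) :
    IsHereditary R := by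
  have := hasFiniteQuotients_regularRing hK infty
  intro N
  rw [Module.projective_def]
  by_cases hN : N = ⊥
  · subst hN
    exact ⟨0, fun x => Subsingleton.elim _ _⟩
  obtain ⟨x₀, hx₀, hx₀0⟩ := Submodule.exists_mem_ne_zero_of_ne_bot hN
  obtain ⟨u, hu⟩ := hunit x₀ fun h => hx₀0 (Subtype.ext h)
  let J : Submodule (regularRing infty) D :=
    { carrier := {x | ∃ y ∈ N, (y : D) = x}
      zero_mem' := ⟨0, N.zero_mem, rfl⟩
      add_mem' := by
        rintro _ _ ⟨x, hx, rfl⟩ ⟨y, hy, rfl⟩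
        exact ⟨x + y, N.add_mem hx hy, rfl⟩
      smul_mem' := by
        rintro a _ ⟨x, hx, rfl⟩
        refine ⟨_, N.smul_mem (MulOpposite.op (algebraMap (regularRing infty) R a)) hx, ?_⟩
        change (x : D) * algebraMap (regularRing infty) D a = a • (x : D)
        rw [Algebra.smul_def, Algebra.commutes] }
  have hJ : IsFullLattice J := by
    refine ⟨hR.fg.of_le ?_, fun z => ?_⟩
    · rintro _ ⟨x, -, rfl⟩
      exact x.2
    · obtain ⟨a, ha, haz⟩ := exists_smul_mem_of_span_eq_top hK
        (N := Subalgebra.toSubmodule R) hR.span_eq_top ((u⁻¹ : Dˣ) * z)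
      refine ⟨a, ha, _, N.smul_mem (MulOpposite.op ⟨_, haz⟩) hx₀, ?_⟩
      change (x₀ : D) * (a • ((u⁻¹ : Dˣ) * z)) = a • z
      rw [← hu, mul_smul_comm, Units.mul_inv_cancel_left]
  have h1 := h J hJ (by
    rintro _ ⟨x, hx, rfl⟩ r hr
    exact ⟨_, N.smul_mem (MulOpposite.op ⟨r, hr⟩) hx, rfl⟩)
  have h2 : ∀ z ∈ J * transporter J (Subalgebra.toSubmodule R),
      ∃ σ : N →ₗ[(↥R)ᵐᵒᵖ] N →₀ (↥R)ᵐᵒᵖ, ∀ y : N,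
        ((Finsupp.linearCombination (↥R)ᵐᵒᵖ id (σ y) : N) : D) = z * (y : R) := by
    intro z hz
    induction hz using Submodule.mul_induction_on' with
    | mem_mul_mem x hx d hd =>
      obtain ⟨x, hx, rfl⟩ := hx
      have hdy : ∀ y : N, d * (y : R) ∈ R := fun y => hd _ ⟨y, y.2, rfl⟩
      let τ : N →ₗ[(↥R)ᵐᵒᵖ] (↥R)ᵐᵒᵖ :=
        { toFun := fun y => MulOpposite.op ⟨d * (y : R), hdy y⟩
          map_add' := fun y y' => MulOpposite.unop_injective (Subtype.ext (mul_add d _ _))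
          map_smul' := fun r y => MulOpposite.unop_injective (Subtype.ext (mul_assoc d _ _).symm) }
      refine ⟨(Finsupp.lsingle ⟨x, hx⟩).comp τ, fun y => ?_⟩
      rw [LinearMap.comp_apply, Finsupp.lsingle_apply, Finsupp.linearCombination_single]
      exact (mul_assoc (x : D) d _).symm
    | add z _ z' _ hz hz' =>
      obtain ⟨σ, hσ⟩ := hz
      obtain ⟨σ', hσ'⟩ := hz'
      refine ⟨σ + σ', fun y => ?_⟩
      rw [LinearMap.add_apply, map_add, add_mul, ← hσ, ← hσ']
      rfl
  obtain ⟨σ, hσ⟩ := h2 1 h1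
  exact ⟨σ, fun y => Subtype.ext (Subtype.ext (by rw [hσ, one_mul]))⟩

/-- The existence of dual bases passes to the left order of a right ideal `I`: a dual basis of `J I`
over `R` yields one of `J` over the left order, because `I (R : J I)` is contained in the
transporter of `J`. -/
theorem HasDualBases.leftOrder (hK : IsGlobalFunctionField k K) (h : HasDualBases R)
    (I : RightIdeal R) : HasDualBases (leftOrder I) := by
  intro J hJ hJR
  obtain ⟨t, ht, htI⟩ := exists_smul_mem_of_span_eq_top hK I.span_eq_top 1
  have hfull : IsFullLattice (J * I.carrier) := by
    refine ⟨hJ.fg.mul I.fg, fun x => ?_⟩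
    obtain ⟨a, ha, hax⟩ := hJ.full x
    refine ⟨a * t, mul_ne_zero ha ht, ?_⟩
    have h1 := Submodule.mul_mem_mul hax htI
    rwa [smul_mul_smul_comm, mul_one] at h1
  have h1 := h _ hfull (by
    intro x hx r hr
    induction hx using Submodule.mul_induction_on' with
    | mem_mul_mem y hy z hz =>
      rw [mul_assoc]
      exact Submodule.mul_mem_mul hy (I.mul_mem z hz r hr)
    | add y _ z _ hy hz => rw [add_mul]; exact Submodule.add_mem _ hy hz)
  rw [mul_assoc] at h1
  have h2 : I.carrier * transporter (J * I.carrier) (Subalgebra.toSubmodule R) ≤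
      transporter J (Subalgebra.toSubmodule (GlobalOrders.leftOrder I)) :=
    Submodule.mul_le.2 fun x hx d hd y hy z hz => by
      rw [mul_assoc, mul_assoc]
      exact I.mul_mem x hx _ (hd _ (Submodule.mul_mem_mul hy hz))
  exact Submodule.mul_le.2 (fun x hx y hy => Submodule.mul_mem_mul hx (h2 hy)) h1

end Hereditary

section Genus

variable {S B : Type*} [CommRing S] [Ring B] [Algebra S B]

theorem isLeftMul_iff {a : Bˣ} {I J : Submodule S B} :
    IsLeftMul a I J ↔ ∀ x, (a : B) * x ∈ J ↔ x ∈ I := by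
  constructor
  · rintro rfl x
    constructor
    · rintro ⟨y, hy, hyx⟩
      have h : (a : B) * y = a * x := hyx
      rwa [← a.mul_right_inj.1 h]
    · exact fun hx => ⟨x, hx, rfl⟩
  · intro h
    refine le_antisymm (fun x hx => ⟨(a⁻¹ : Bˣ) * x, (h _).1 ?_, ?_⟩) ?_ (a := J)
    · rwa [Units.mul_inv_cancel_left]
    · exact Units.mul_inv_cancel_left a x
    · rintro _ ⟨x, hx, rfl⟩
      exact (h x).2 hx

theorem IsLeftMul.mul {a : Bˣ} {I J : Submodule S B} (h : IsLeftMul a I J) (N : Submodule S B) :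
    IsLeftMul a (I * N) (J * N) := by
  have key : ∀ {a : Bˣ} {I J : Submodule S B}, IsLeftMul a I J → ∀ x ∈ I * N, (a : B) * x ∈ J * N := by
    intro a I J h x hx
    induction hx using Submodule.mul_induction_on' with
    | mem_mul_mem y hy z hz =>
      rw [← mul_assoc]
      exact Submodule.mul_mem_mul ((isLeftMul_iff.1 h y).2 hy) hz
    | add y _ z _ hy hz => rw [mul_add]; exact Submodule.add_mem _ hy hz
  refine isLeftMul_iff.2 fun x => ⟨fun hx => ?_, key h x⟩
  have h1 := key h.symm _ hx
  rwa [Units.inv_mul_cancel_left] at h1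

theorem IsLeftMul.transporter {a : Bˣ} {I J : Submodule S B} (h : IsLeftMul a I J)
    (N : Submodule S B) : IsLeftMul a (transporter N I) (transporter N J) :=
  isLeftMul_iff.2 fun x => forall₂_congr fun y _ => by rw [mul_assoc]; exact isLeftMul_iff.1 h _

variable {K : Type u} [Field K] {D : Type w} [Ring D] [Algebra K D] {infty : Place K}
  {R : Subalgebra (regularRing infty) D} {k : Type*} [Field k] [Algebra k K]

theorem RightIdeal.ext_carrier {I J : RightIdeal R} (h : I.carrier = J.carrier) : I = J := by
  cases I
  cases J
  congr

theorem RightIdeal.carrier_eq_of_forall (hK : IsGlobalFunctionField k K) {I J : RightIdeal R}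
    (h : ∀ v, completeModule I.carrier v = completeModule J.carrier v) : I = J := by
  refine RightIdeal.ext_carrier (Submodule.ext fun x => ?_)
  rw [mem_iff_forall_tmul_mem hK I.fg I.span_eq_top, mem_iff_forall_tmul_mem hK J.fg J.span_eq_top]
  exact forall_congr' fun v => by rw [h v]

theorem genusOf_eq_iff {I J : RightIdeal R} : genusOf I = genusOf J ↔
    ∀ v : FinitePlace infty, ∃ a : (AlgCompl D v.1)ˣ,
      IsLeftMul a (completeModule I.carrier v) (completeModule J.carrier v) :=
  Quotient.eq (r := genusSetoid R)

/-- The product of a right ideal of the left order of `I` with `I`. -/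
def RightIdeal.mulIdeal (I : RightIdeal R) (X : RightIdeal (leftOrder I)) : RightIdeal R where
  carrier := X.carrier * I.carrier
  fg := X.fg.mul I.fg
  span_eq_top := by
    rw [eq_top_iff]
    intro x _
    have h1 : x * 1 ∈ Submodule.span K (X.carrier : Set D) * Submodule.span K (I.carrier : Set D) :=
      Submodule.mul_mem_mul (X.span_eq_top ▸ Submodule.mem_top) (I.span_eq_top ▸ Submodule.mem_top)
    rw [mul_one, Submodule.span_mul_span] at h1
    refine Submodule.span_mono ?_ h1
    rintro _ ⟨y, hy, z, hz, rfl⟩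
    exact Submodule.mul_mem_mul hy hz
  mul_mem := by
    intro x hx r hr
    induction hx using Submodule.mul_induction_on' with
    | mem_mul_mem y hy z hz =>
      rw [mul_assoc]
      exact Submodule.mul_mem_mul hy (I.mul_mem z hz r hr)
    | add y _ z _ hy hz => rw [add_mul]; exact Submodule.add_mem _ hy hz

/-- The right ideal `{x | x I ⊆ J}` of the left order of `I`. -/
def RightIdeal.colon (hK : IsGlobalFunctionField k K) (I J : RightIdeal R) :
    RightIdeal (leftOrder I) where
  carrier := transporter I.carrier J.carrier
  fg := transporter_fg hK I.span_eq_top J.fg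
  span_eq_top := span_transporter_eq_top hK I.fg J.span_eq_top
  mul_mem x hx r hr y hy := by
    rw [mul_assoc]
    exact hx _ (hr y hy)

/-- If `X` is locally free with local generator `a`, then `X I` is locally `a I`. -/
theorem isLeftMul_mulIdeal {I : RightIdeal R} {X : RightIdeal (leftOrder I)} {v : FinitePlace infty}
    {a : (AlgCompl D v.1)ˣ} (h : IsLeftMul a
      (Subalgebra.toSubmodule (completeOrder (leftOrder I) v)) (completeModule X.carrier v)) :
    IsLeftMul a (completeModule I.carrier v) (completeModule (I.mulIdeal X).carrier v) := by
  have h1 := h.mul (completeModule I.carrier v)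
  have h2 : Subalgebra.toSubmodule (completeOrder (leftOrder I) v) * completeModule I.carrier v =
      completeModule I.carrier v := by
    refine le_antisymm (Submodule.mul_le.2 fun x hx y hy => ?_) fun y hy => ?_
    · rw [completeOrder_toSubmodule] at hx
      have h3 := Submodule.mul_mem_mul hx hy
      rw [← completeModule_mul] at h3
      have h4 : Subalgebra.toSubmodule (leftOrder I) * I.carrier ≤ I.carrier :=
        Submodule.mul_le.2 fun x hx y hy => hx y hy
      exact completeModule_mono h4 v h3
    · rw [← one_mul y]
      exact Submodule.mul_mem_mul (one_mem (completeOrder (leftOrder I) v)) hy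
  rw [h2, ← completeModule_mul] at h1
  exact h1

/-- If `J` is locally `a I`, then `{x | x I ⊆ J}` is locally free with local generator `a`. -/
theorem isLeftMul_colon (hK : IsGlobalFunctionField k K) {I J : RightIdeal R}
    {v : FinitePlace infty} {a : (AlgCompl D v.1)ˣ}
    (h : IsLeftMul a (completeModule I.carrier v) (completeModule J.carrier v)) :
    IsLeftMul a (Subalgebra.toSubmodule (completeOrder (leftOrder I) v))
      (completeModule (I.colon hK J).carrier v) := by
  have h1 : ∀ L : RightIdeal R, completeModule (I.colon hK L).carrier v =
      transporter (completeModule I.carrier v) (completeModule L.carrier v) := fun L =>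
    Submodule.ext fun x => mem_completeModule_transporter hK I.fg L.fg L.span_eq_top
  have h2 : Subalgebra.toSubmodule (completeOrder (leftOrder I) v) =
      transporter (completeModule I.carrier v) (completeModule I.carrier v) :=
    Submodule.ext fun x => mem_completeOrder_leftOrder hK
  rw [h1, h2]
  exact h.transporter _

theorem IsLeftMul.eq {S B : Type*} [CommRing S] [Ring B] [Algebra S B] {a : Bˣ}
    {I J L : Submodule S B} (h : IsLeftMul a I J) (h' : IsLeftMul a I L) : J = L :=
  Eq.trans (b := I.map (LinearMap.mulLeft S (a : B))) h (Eq.symm h')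

/-- The right ideals in the genus of `I` correspond to the locally free right ideals of the left
order of `I`. -/
def genusEquivLocallyFree (hK : IsGlobalFunctionField k K) (I : RightIdeal R) :
    {J : RightIdeal R // genusOf J = genusOf I} ≃
      {X : RightIdeal (leftOrder I) // IsLocallyFree X} where
  toFun J := ⟨I.colon hK J.1, fun v =>
    let ⟨a, ha⟩ := genusOf_eq_iff.1 J.2.symm v
    ⟨a, isLeftMul_colon hK ha⟩⟩
  invFun X := ⟨I.mulIdeal X.1, Eq.symm (genusOf_eq_iff.2 fun v =>
    let ⟨a, ha⟩ := X.2 v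
    ⟨a, isLeftMul_mulIdeal ha⟩)⟩
  left_inv J := Subtype.ext <| RightIdeal.carrier_eq_of_forall hK fun v => by
    obtain ⟨a, ha⟩ := genusOf_eq_iff.1 J.2.symm v
    exact (isLeftMul_mulIdeal (isLeftMul_colon hK ha)).eq ha
  right_inv X := Subtype.ext <| RightIdeal.carrier_eq_of_forall hK fun v => by
    obtain ⟨a, ha⟩ := X.2 v
    exact (isLeftMul_colon hK (isLeftMul_mulIdeal ha)).eq ha

/-- The classes in the genus of `I` correspond to the classes of locally free right ideals of the
left order of `I`. -/
def genusClassEquiv (hK : IsGlobalFunctionField k K) (I : RightIdeal R) :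
    GenusClass (genusOf I) ≃ LocallyFreeClass (leftOrder I) :=
  Quotient.congr (genusEquivLocallyFree hK I) fun J J' => by
    constructor
    · rintro ⟨a, ha⟩
      exact ⟨a, ha.transporter I.carrier⟩
    · rintro ⟨a, ha⟩
      have h1 : ∀ J : {J : RightIdeal R // genusOf J = genusOf I},
          (I.colon hK J.1).carrier * I.carrier = J.1.carrier := fun J =>
        congrArg (fun L : {J : RightIdeal R // genusOf J = genusOf I} => L.1.carrier)
          ((genusEquivLocallyFree hK I).left_inv J)
      have h2 := IsLeftMul.mul (I := (I.colon hK J.1).carrier) (J := (I.colon hK J'.1).carrier)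
        ha I.carrier
      rw [h1, h1] at h2
      exact ⟨a, h2⟩

theorem finite_locallyFreeClass [Nontrivial D] [FiniteDimensional K D]
    (hK : IsGlobalFunctionField k K) (hD : IsDefinite D infty) (hR : IsOrder R) : Finite (LocallyFreeClass R) := by
  have := finite_rightIdealClass hK hD hR
  refine Finite.of_injective (β := RightIdealClass R)
    (Quotient.lift (fun I => Quotient.mk (globalSetoid R) I.1) fun I J h => Quotient.sound h) ?_
  intro x y
  refine Quotient.inductionOn₂ x y fun I J h => Quotient.sound ?_
  exact Quotient.exact (s := globalSetoid R) (a := I.1) (b := J.1) h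

end Genus

/-! ### Parametrization of the genera -/

section StandardLattices

variable {F : Type*} [Field F] {O : Subring F} {Δ : Type*} [DivisionRing Δ] [Algebra F Δ]
  [FiniteDimensional F Δ] {f : List ℕ}

theorem IsLocalFieldBase.vecMul_mem_stdRow (hO : IsLocalFieldBase O)
    {X : Matrix (BlockIndex f) (BlockIndex f) Δ} (hX : X ∈ standardOrder O Δ f) {i : ℕ}
    {y : BlockIndex f → Δ} (hy : y ∈ hO.stdRow Δ f i) :
    Matrix.vecMul y X ∈ hO.stdRow Δ f i := by
  intro b
  have hint : ∀ a, IsIntegral O (X a b) := fun a => by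
    rcases le_or_gt a.1 b.1 with h' | h'
    · exact (hX a b).1 h'
    · exact ((hX a b).2 h').1
  refine ⟨fun hb => hO.sum_mem_maxIdeal fun a _ => ?_,
    hO.isIntegral_sum fun a _ => hO.isIntegral_mul (hy a).2 (hint a)⟩
  rcases lt_or_ge (a.1 : ℕ) i with h | h
  · exact hO.mul_mem_maxIdeal_right ((hy a).1 h) (hint a)
  · exact hO.mul_mem_maxIdeal_left (hy a).2 ((hX a b).2 (hb.trans_le h))

theorem IsLocalFieldBase.isFullLattice_stdLattice (hO : IsLocalFieldBase O)
    {Λ : Subalgebra O (Matrix (BlockIndex f) (BlockIndex f) Δ)}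
    (hstd : (Λ : Set (Matrix (BlockIndex f) (BlockIndex f) Δ)) = standardOrder O Δ f)
    (hΛ : IsFullLattice (Subalgebra.toSubmodule Λ)) (t : BlockIndex f → Fin f.length) :
    IsFullLattice (hO.stdLattice (Δ := Δ) t) := by
  have := hO.hasFiniteQuotients
  obtain ⟨ϖ, hϖ, hϖ0, hϖinv, -⟩ := hO.exists_pow_mul_mem
  have hP : ∀ {x : Δ}, IsIntegral O x → ϖ • x ∈ maxIdeal O Δ := by
    intro x hx
    rw [Algebra.smul_def]
    refine hO.mul_mem_maxIdeal_right (hO.mem_maxIdeal.2 (Or.inr fun h => hϖinv ?_)) hx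
    rwa [← map_inv₀, hO.isIntegral_algebraMap_iff] at h
  have hmem : ∀ X, X ∈ Λ ↔ X ∈ standardOrder O Δ f := fun X => by rw [← hstd]; rfl
  -- the nonunit `ϖ` multiplies the lattice into the order and conversely
  have h1 : ∀ X ∈ hO.stdLattice (Δ := Δ) t, ϖ • X ∈ Λ := by
    intro X hX
    rw [hmem]
    have h2 : ∀ a b, ϖ • X a b ∈ maxIdeal O Δ := fun a b => hP (mem_rowsIn.1 hX a b).2
    exact fun a b => ⟨fun _ => (h2 a b).1, fun _ => h2 a b⟩
  have h2 : ∀ X ∈ Λ, ϖ • X ∈ hO.stdLattice (Δ := Δ) t := by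
    intro X hX
    rw [hmem] at hX
    have h3 : ∀ a b, ϖ • X a b ∈ maxIdeal O Δ := fun a b => hP (by
      rcases le_or_gt a.1 b.1 with h' | h'
      · exact (hX a b).1 h'
      · exact ((hX a b).2 h').1)
    exact mem_rowsIn.2 fun a b => ⟨fun _ => h3 a b, (h3 a b).1⟩
  constructor
  · let μ : Matrix (BlockIndex f) (BlockIndex f) Δ →ₗ[O] Matrix (BlockIndex f) (BlockIndex f) Δ :=
      (LinearMap.lsmul F (Matrix (BlockIndex f) (BlockIndex f) Δ) ϖ⁻¹).restrictScalars O
    exact (hΛ.fg.map μ).of_le fun X hX => ⟨ϖ • X, h1 X hX, inv_smul_smul₀ hϖ0 X⟩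
  · intro X
    obtain ⟨c, hc, hcX⟩ := hΛ.full X
    refine ⟨⟨ϖ, hϖ⟩ * c, mul_ne_zero (fun h => hϖ0 (congrArg Subtype.val h)) hc, ?_⟩
    rw [mul_smul]
    exact h2 _ hcX

end StandardLattices

section Parametrization

variable {K : Type u} [Field K] {D : Type w} [Ring D] [Algebra K D] {infty : Place K}
  {R : Subalgebra (regularRing infty) D} {v : FinitePlace infty}

theorem LocalDescription.HasRowType.of_isLeftMul {S : LocalDescription R v}
    [FiniteDimensional (Compl v.1) S.Δ] {hO : IsLocalFieldBase (complInt v.1)}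
    {I J : RightIdeal R} {α : S.Matˣ} {t : BlockIndex S.f → Fin S.period}
    (h : S.HasRowType hO I α t) {a : (AlgCompl D v.1)ˣ}
    (ha : IsLeftMul a (completeModule I.carrier v) (completeModule J.carrier v)) :
    S.HasRowType hO J (Units.map (S.φ : AlgCompl D v.1 →* S.Mat) a * α) t := by
  intro Y
  rw [← h, ← isLeftMul_iff.1 ha]
  have h1 : S.φ.symm (((Units.map (S.φ : AlgCompl D v.1 →* S.Mat) a * α : S.Matˣ) : S.Mat) * Y) =
      (a : AlgCompl D v.1) * S.φ.symm ((α : S.Mat) * Y) := by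
    apply S.φ.injective
    rw [S.φ.apply_symm_apply, map_mul S.φ (a : AlgCompl D v.1), S.φ.apply_symm_apply,
      Units.val_mul, mul_assoc]
    rfl
  rw [h1]

/-- Every type index counts the rows of each kind for some assignment of kinds to the rows. -/
theorem LocalDescription.exists_fiber_card_eq (S : LocalDescription R v) (g : S.TypeIndex) :
    ∃ t : BlockIndex S.f → Fin S.period, ∀ i, g.1 i = Nat.card {a // t a = i} := by
  obtain ⟨e⟩ : Nonempty (BlockIndex S.f ≃ Σ i, Fin (g.1 i)) := by
    rw [← Fintype.card_eq, card_blockIndex, Fintype.card_sigma]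
    simp only [Fintype.card_fin]
    exact g.2.symm
  refine ⟨fun a => (e a).1, fun i => ?_⟩
  rw [Nat.card_congr ((e.subtypeEquiv fun a => Iff.rfl).trans
    (Equiv.sigmaSubtype (β := fun i => Fin (g.1 i)) i) : {a // (e a).1 = i} ≃ Fin (g.1 i)),
    Nat.card_eq_fintype_card, Fintype.card_fin]

theorem LocalDescription.subsingleton_typeIndex (S : LocalDescription R v) (h : S.period ≤ 1) :
    Subsingleton S.TypeIndex := by
  refine ⟨fun g g' => Subtype.ext (funext fun i => ?_)⟩
  have : Subsingleton (Fin S.period) := Fin.subsingleton_iff_le_one.2 h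
  have h1 := g.2.trans g'.2.symm
  rwa [Fintype.sum_subsingleton _ i, Fintype.sum_subsingleton _ i] at h1

variable {k : Type*} [Field k] [Algebra k K]

/-- Every right ideal has a unique type. -/
theorem existsUnique_hasType [Nontrivial D] [FiniteDimensional K D]
    (hK : IsGlobalFunctionField k K) (hR : IsOrder R) (h : HasDualBases R)
    (S : ∀ v : FinitePlace infty, LocalDescription R v) (I : RightIdeal R) :
    ∃! g : GenusIndex S, HasType S I g := by
  have h1 : ∀ v, ∃ g, (S v).HasLocalType I g := by
    intro v
    have := (S v).finiteDimensional
    obtain ⟨α, t, ht⟩ := (S v).exists_hasRowType hK hR h (isLocalFieldBase_complInt hK v) I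
    obtain ⟨g, hg⟩ := LocalDescription.exists_typeIndex t
    exact ⟨g, ht.hasLocalType hg⟩
  choose g hg using h1
  refine ⟨g, hg, fun g' hg' => funext fun v => ?_⟩
  have := (S v).finiteDimensional
  have := (S v).nonempty_blockIndex
  exact (hg' v).unique (isLocalFieldBase_complInt hK v) ((S v).fg_matrixOrder hK hR) (hg v)

/-- Given a type at a place, the right ideal is given by rows with that type. -/
theorem LocalDescription.HasLocalType.exists_hasRowType [Nontrivial D]
    (hK : IsGlobalFunctionField k K) (hR : IsOrder R) (h : HasDualBases R)
    {S : LocalDescription R v} [FiniteDimensional (Compl v.1) S.Δ]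
    (hO : IsLocalFieldBase (complInt v.1)) {I : RightIdeal R} {g : S.TypeIndex}
    (hg : S.HasLocalType I g) :
    ∃ α t, S.HasRowType hO I α t ∧ ∀ i, g.1 i = Nat.card {a // t a = i} := by
  have := S.nonempty_blockIndex
  obtain ⟨α, t, ht⟩ := S.exists_hasRowType hK hR h hO I
  obtain ⟨g', hg'⟩ := LocalDescription.exists_typeIndex t
  have h1 := (ht.hasLocalType hg').unique hO (S.fg_matrixOrder hK hR) hg
  exact ⟨α, t, ht, h1 ▸ hg'⟩

/-- Two right ideals lie in the same genus if and only if they have the same type. -/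
theorem HasType.genusOf_eq_iff [Nontrivial D] [FiniteDimensional K D]
    (hK : IsGlobalFunctionField k K) (hR : IsOrder R) (h : HasDualBases R)
    {S : ∀ v : FinitePlace infty, LocalDescription R v} {I J : RightIdeal R}
    {g : GenusIndex S} (hI : HasType S I g) : genusOf I = genusOf J ↔ HasType S J g := by
  rw [GlobalOrders.genusOf_eq_iff]
  refine forall_congr' fun v => ?_
  have := (S v).finiteDimensional
  have hO := isLocalFieldBase_complInt hK v
  obtain ⟨α, t, ht, hg⟩ := (hI v).exists_hasRowType hK hR h hO
  constructor
  · rintro ⟨a, ha⟩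
    exact (ht.of_isLeftMul ha).hasLocalType hg
  · intro hJ
    obtain ⟨α', t', ht', hg'⟩ := hJ.exists_hasRowType hK hR h hO
    exact ht.exists_isLeftMul ht' fun i => by rw [← hg, ← hg']

/-- Every family of local types is the type of a right ideal: it suffices to modify `R` at the
finitely many places where the period is not one. -/
theorem exists_hasType [IsSimpleRing D] [Algebra.IsCentral K D] [FiniteDimensional K D]
    (hK : IsGlobalFunctionField k K) (hR : IsOrder R) (h : HasDualBases R)
    (S : ∀ v : FinitePlace infty, LocalDescription R v) (g : GenusIndex S) :
    ∃ I : RightIdeal R, HasType S I g := by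
  classical
  have hfd := fun v => (S v).finiteDimensional
  have hO := fun v : FinitePlace infty => isLocalFieldBase_complInt hK v
  choose t ht using fun v => (S v).exists_fiber_card_eq (g v)
  have key : ∀ s : Finset (FinitePlace infty), ∃ I : RightIdeal R, ∀ v ∈ s,
      (S v).HasRowType (hO v) I 1 (t v) := by
    intro s
    induction s using Finset.induction_on with
    | empty => exact ⟨hR.rightIdeal, fun v hv => absurd hv (Finset.notMem_empty v)⟩
    | insert v s hv ih =>
      obtain ⟨J, hJ⟩ := ih
      let e : (S v).Mat ≃ₐ[complInt v.1] AlgCompl D v.1 := (S v).φ.symm.restrictScalars _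
      have hfull := (hO v).isFullLattice_stdLattice (S v).coe_matrixOrder
        ((isFullLattice_completeOrder hK hR v).map_subalgebra _) (t v)
      obtain ⟨I, hIv, hIw⟩ := J.exists_completeModule_eq hK v
        (L := ((hO v).stdLattice (t v)).map e.toLinearMap) (hfull.map e.surjective) (by
          rintro _ ⟨Y, hY, rfl⟩ ρ hρ
          refine ⟨Y * (S v).φ ρ, mem_rowsIn.2 fun a => ?_, ?_⟩
          · rw [Matrix.mul_apply_eq_vecMul]
            refine (hO v).vecMul_mem_stdRow ?_ (mem_rowsIn.1 hY a)
            rw [← (S v).coe_matrixOrder]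
            exact (S v).apply_mem_matrixOrder.2 hρ
          · change (S v).φ.symm (Y * (S v).φ ρ) = (S v).φ.symm Y * ρ
            rw [map_mul, AlgEquiv.symm_apply_apply])
      refine ⟨I, fun w hw Y => ?_⟩
      rcases Finset.mem_insert.1 hw with rfl | hws
      · rw [Units.val_one, one_mul, hIv]
        constructor
        · rintro ⟨Y', hY', hYY'⟩
          rwa [← e.injective hYY']
        · exact fun hY => ⟨Y, hY, rfl⟩
      · have hwv : w ≠ v := fun h => hv (h ▸ hws)
        rw [hIw w hwv]
        exact hJ w hws Y
  obtain ⟨I, hI⟩ := key (finite_setOf_one_lt_period hK hR S).toFinset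
  obtain ⟨g', hg', -⟩ := existsUnique_hasType hK hR h S I
  refine ⟨I, fun v => ?_⟩
  by_cases hv : 1 < (S v).period
  · exact (hI v ((Set.Finite.mem_toFinset _).2 hv)).hasLocalType (ht v)
  · have := (S v).subsingleton_typeIndex (not_lt.1 hv)
    rw [Subsingleton.elim (g v) (g' v)]
    exact hg' v

/-- The genera correspond to the types. -/
theorem exists_genusIndex_equiv [IsSimpleRing D] [Algebra.IsCentral K D] [FiniteDimensional K D]
    (hK : IsGlobalFunctionField k K) (hR : IsOrder R) (h : HasDualBases R)
    (S : ∀ v : FinitePlace infty, LocalDescription R v) :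
    ∃ Γ : GenusIndex S ≃ Genus R, ∀ (I : RightIdeal R) (g : GenusIndex S),
      HasType S I g ↔ genusOf I = Γ g := by
  choose J hJ using exists_hasType hK hR h S
  have hiff : ∀ (I : RightIdeal R) g, HasType S I g ↔ genusOf I = genusOf (J g) := fun I g => by
    rw [← (hJ g).genusOf_eq_iff hK hR h, eq_comm]
  refine ⟨Equiv.ofBijective (fun g => genusOf (J g)) ⟨fun g g' hgg' => ?_, fun L => ?_⟩, hiff⟩
  · exact (existsUnique_hasType hK hR h S (J g)).unique (hJ g) ((hiff _ _).2 hgg')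
  · obtain ⟨I, rfl⟩ := Quotient.exists_rep L
    obtain ⟨g, hg, -⟩ := existsUnique_hasType hK hR h S I
    exact ⟨g, ((hiff I g).1 hg).symm⟩

theorem IsLeftMul.completeModule {a : Dˣ} {I J : Submodule (regularRing infty) D}
    (h : IsLeftMul a I J) (v : FinitePlace infty) :
    IsLeftMul (Units.map (Algebra.TensorProduct.includeRight : D →ₐ[K] AlgCompl D v.1) a)
      (completeModule I v) (completeModule J v) := by
  have key : ∀ {a : Dˣ} {I J : Submodule (regularRing infty) D}, IsLeftMul a I J →
      ∀ x ∈ GlobalOrders.completeModule I v,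
        ((1 : Compl v.1) ⊗ₜ[K] (a : D)) * x ∈ GlobalOrders.completeModule J v := by
    intro a I J h x hx
    induction hx using Submodule.span_induction with
    | mem x hx =>
      obtain ⟨x, hx, rfl⟩ := hx
      change ((1 : Compl v.1) ⊗ₜ[K] (a : D)) * (1 ⊗ₜ[K] x) ∈ _
      rw [← one_tmul_mul]
      exact tmul_mem_completeModule v ((isLeftMul_iff.1 h x).2 hx)
    | zero => rw [mul_zero]; exact Submodule.zero_mem _
    | add x y _ _ hx hy => rw [mul_add]; exact Submodule.add_mem _ hx hy
    | smul c x _ hx => rw [mul_smul_comm]; exact Submodule.smul_mem _ c hx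
  refine isLeftMul_iff.2 fun x => ⟨fun hx => ?_, key h x⟩
  have h1 := key h.symm _ hx
  have h2 : ((1 : Compl v.1) ⊗ₜ[K] ((a⁻¹ : Dˣ) : D)) *
      (((1 : Compl v.1) ⊗ₜ[K] (a : D)) * x) = x := by
    rw [← mul_assoc, ← one_tmul_mul, Units.inv_mul]
    exact one_mul x
  exact h2 ▸ h1

/-- The genus of a class of right ideals. -/
def RightIdealClass.genus : RightIdealClass R → Genus R :=
  Quotient.lift genusOf fun _ _ ⟨_, ha⟩ =>
    GlobalOrders.genusOf_eq_iff.2 fun v => ⟨_, ha.completeModule v⟩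

theorem RightIdealClass.genus_surjective : Function.Surjective (RightIdealClass.genus (R := R)) :=
  fun L => Quotient.inductionOn L fun I => ⟨Quotient.mk _ I, rfl⟩

/-- The classes of right ideals are the union of the classes in the various genera. -/
def rightIdealClassEquiv : RightIdealClass R ≃ Σ L : Genus R, GenusClass L :=
  (Equiv.sigmaFiberEquiv (RightIdealClass.genus (R := R))).symm.trans <|
    Equiv.sigmaCongrRight fun L =>
      Equiv.subtypeQuotientEquivQuotientSubtype (s₁ := globalSetoid R)
        (s₂ := (globalSetoid R).comap Subtype.val) (fun I => genusOf I = L)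
        (fun X => RightIdealClass.genus X = L) (fun _ => Iff.rfl) (fun _ _ => Iff.rfl)

/-- The class number formula for a parametrization of the genera. -/
theorem card_rightIdealClass_eq_finsum [Finite (RightIdealClass R)]
    (hK : IsGlobalFunctionField k K) {ι : Type*} (Γ : ι ≃ Genus R) (I : ι → RightIdeal R)
    (hI : ∀ g, genusOf (I g) = Γ g) :
    Nat.card (RightIdealClass R) = ∑ᶠ g, classNumber (leftOrder (I g)) := by
  have h1 : Finite (Σ L : Genus R, GenusClass L) := Finite.of_equiv _ rightIdealClassEquiv
  have h2 : Finite (Genus R) := Finite.of_surjective _ RightIdealClass.genus_surjective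
  have h3 : Finite ι := Finite.of_equiv _ Γ.symm
  have := Fintype.ofFinite (Genus R)
  have := Fintype.ofFinite ι
  have h4 : ∀ L : Genus R, Finite (GenusClass L) := fun L =>
    Finite.of_injective (β := Σ L : Genus R, GenusClass L) (Sigma.mk L) sigma_mk_injective
  rw [Nat.card_congr rightIdealClassEquiv, Nat.card_sigma, finsum_eq_sum_of_fintype,
    ← Equiv.sum_comp Γ]
  refine Finset.sum_congr rfl fun g _ => ?_
  rw [← hI]
  exact Nat.card_congr (genusClassEquiv hK (I g))

end Parametrization

end

end GlobalOrders

theorem theorem6p3 (Fq : Type*) (K : Type*) [Field Fq] [Field K] [Algebra Fq K]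
    (hK : GlobalOrders.IsGlobalFunctionField Fq K)
    (infty : GlobalOrders.Place K)
    (D : Type*) [Ring D] [Algebra K D] [FiniteDimensional K D] [Algebra.IsCentral K D]
    [IsSimpleRing D] (hD : GlobalOrders.IsDefinite D infty)
    (R : Subalgebra (GlobalOrders.regularRing infty) D)
    (hR : GlobalOrders.IsOrder R) (hRh : GlobalOrders.IsHereditary R) :
    -- every local order has an invariant, and there are only finitely many right ideal classes
    (∀ v : GlobalOrders.FinitePlace infty, Nonempty (GlobalOrders.LocalDescription R v)) ∧
    Finite (GlobalOrders.RightIdealClass R) ∧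
    -- for any choice of the local descriptions:
    ∀ S : (v : GlobalOrders.FinitePlace infty) → GlobalOrders.LocalDescription R v,
      -- the genera are parametrized by the vectors `g`
      (∃ Γ : GlobalOrders.GenusIndex S ≃ GlobalOrders.Genus R,
        ∀ (I : GlobalOrders.RightIdeal R) (g : GlobalOrders.GenusIndex S),
          GlobalOrders.HasType S I g ↔ GlobalOrders.genusOf I = Γ g) ∧
      Finite (GlobalOrders.GenusIndex S) ∧
      -- the left order of an ideal `I(g)` and the class number of its genus
      (∀ (I : GlobalOrders.RightIdeal R) (g : GlobalOrders.GenusIndex S),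
        GlobalOrders.HasType S I g →
          GlobalOrders.IsOrder (GlobalOrders.leftOrder I) ∧
          GlobalOrders.IsHereditary (GlobalOrders.leftOrder I) ∧
          (∀ v, GlobalOrders.HasInvariant (GlobalOrders.leftOrder I) v (S v).Δ
            ((S v).removeZeros (g v))) ∧
          Finite (GlobalOrders.LocallyFreeClass (GlobalOrders.leftOrder I)) ∧
          Nat.card (GlobalOrders.GenusClass (GlobalOrders.genusOf I)) =
            GlobalOrders.classNumber (GlobalOrders.leftOrder I)) ∧
      -- the total class number, for any choice of an ideal `I(g)` for each `g`
      (∀ I : GlobalOrders.GenusIndex S → GlobalOrders.RightIdeal R,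
        (∀ g, GlobalOrders.HasType S (I g) g) →
          Nat.card (GlobalOrders.RightIdealClass R) =
            ∑ᶠ g, GlobalOrders.classNumber (GlobalOrders.leftOrder (I g))) := by
  have h := hRh.hasDualBases hK hR
  have hfin := GlobalOrders.finite_rightIdealClass hK hD hR
  refine ⟨GlobalOrders.nonempty_localDescription hK hR h, hfin, fun S => ?_⟩
  obtain ⟨Γ, hΓ⟩ := GlobalOrders.exists_genusIndex_equiv hK hR h S
  refine ⟨⟨Γ, hΓ⟩, ?_, fun I g hI => ?_, fun I hI => ?_⟩
  · have h1 : Finite (GlobalOrders.Genus R) :=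
      Finite.of_surjective _ GlobalOrders.RightIdealClass.genus_surjective
    exact Finite.of_equiv _ Γ.symm
  · have hR' := GlobalOrders.isOrder_leftOrder hK I
    refine ⟨hR', (h.leftOrder hK I).isHereditary hK (fun x hx => hD.isUnit hx) hR', fun v => ?_,
      GlobalOrders.finite_locallyFreeClass hK hD hR',
      Nat.card_congr (GlobalOrders.genusClassEquiv hK I)⟩
    have := (S v).finiteDimensional
    obtain ⟨α, t, ht, hg⟩ :=
      (hI v).exists_hasRowType hK hR h (GlobalOrders.isLocalFieldBase_complInt hK v)
    obtain ⟨φ, hφ⟩ := ht.exists_image_eq_standardOrder hg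
    refine ⟨fun k hk => Nat.pos_of_ne_zero (by simpa using (List.mem_filter.1 hk).2), φ, ?_⟩
    rw [← hφ]
    congr 1
    ext x
    exact GlobalOrders.mem_completeOrder_leftOrder hK
  · exact GlobalOrders.card_rightIdealClass_eq_finsum hK Γ I fun g => (hΓ _ _).1 (hI g)
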